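/- Let $M$ be an $\omega$-categorical structure, i.e. $M$ is countable and for every $n$ only finitely many complete $n$-types over $\emptyset$ are realized in $M$. "Definable" refers to $M^{eq}$. *Rank.* For a definable set $D\subseteq M^k$: $\mathrm{rk}(D)\ge 0$ always; $\mathrm{rk}(D)\geq 1$ if $D$ is infinite; and for $n\ge 1$, $\mathrm{rk}(D)\geq n+1$ if there is, in $M^{eq}$, an infinite uniformly definable family $(X_t:t\in E)$ of subsets of $D$ which is $k$-inconsistent for some $k$ (any $k$ members with distinct indices have empty intersection) and such that $\mathrm{rk}(X_t)\geq n$ for every $t\in E$. $M$ has finite rank if $\mathrm{rk}(M)\ge n$ fails for some $n<\omega$. For a finite tuple $a$, $\mathrm{rk}(a)$ is the minimal rank of a $\emptyset$-definable set containing $a$; finite tuples $a,b$ are independent if $\mathrm{rk}(ab)=\mathrm{rk}(a)+\mathrm{rk}(b)$. *NIP.* $M$ is NIP if for every formula $\phi(x;y)$ (with $x,y$ finite tuples of variables) there is $k$ for which there are no tuples $(a_i)_{i<k}$ and $(b_J)_{J\subseteq\{0,\dots,k-1\}}$ in $M$ such that $M\models\phi(a_i;b_J)\iff i\in J$ for all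 $i,J$. *Orders and completions.* A linear or circular order $V$ definable in $M^{eq}$ has topological rank 1 if it admits no equivalence relation that is definable with parameters, has convex classes, and has infinitely many infinite classes. A subset $I$ of a circular order is convex if for any $x\neq y$ in $I$ one of the two open intervals between $x$ and $y$ is contained in $I$; it is bounded if its complement is infinite, and it is then linearly ordered by the circular order. The completion $\overline V$ of a linear order $V$ is the set of initial segments of $V$ that are definable with parameters, are neither empty nor all of $V$, and have no last element. The completion $\overline V$ of a circular order $V$ is the set of nonempty bounded convex subsets of $V$ that are definable with parameters and have no last element, modulo the equivalence relation: one of the two sets is an end segment of the other. In both cases $\overline V$ is a directed union of sets $C_\phi$ definable in $M^{eq}$, where $C_\phi$ is the set of cuts represented by a set of the form $\phi(V;d)$. A function into $\overline V$ is $\emptyset$-definable if it takes values in one such definable set (for some $\phi$ without parameters) and is $\emptyset$-definable as a function to it; an element $c$ of $\overline V$ is in $\mathrm{acl}(a)$ if it lies in a finite $a$-definable subset of some $C_\phi$. **Proposition.** Assume that $M$ has finite rank and is NIP. Let $a,b$ be two finite tuples of elements of $M$, let $p(x,y)=\mathrm{tp}(a,b)$, and let $p(M)$ be the set of realizations of $p$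 in $M$. Assume that $a$ and $b$ are independent or that $\mathrm{rk}(a)=1$. Let $V$ be a $\emptyset$-definable (in $M^{eq}$) linear or circular order of topological rank 1, and let $f\colon p(M)\to\overline V$ be a $\emptyset$-definable function. Then $f(a,b)\in\mathrm{acl}(a)\cup\mathrm{acl}(b)$. -/

import Mathlib

open FirstOrder FirstOrder.Language Set

universe u v w

/-! ### Countably categorical structures, types, NIP -/

section Basic

variable (L : FirstOrder.Language.{u, v}) {M : Type w} [L.Structure M]

/-- The complete type over `∅` of a tuple, as a set of formulas without parameters. -/
def tupleType {α : Type} (a : α → M) : Set (L.Formula α) :=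
  {φ | φ.Realize a}

/-- The set `p(M)` of realizations in `M` of the type `p = tp(a)`. -/
def typeLocus {α : Type} (a : α → M) : Set (α → M) :=
  {a' | tupleType L a' = tupleType L a}

variable (M) in
/-- `M` is countable and, for every `n`, realizes only finitely many `n`-types over `∅`. -/
def OmegaCategorical : Prop :=
  Countable M ∧ ∀ n : ℕ, (Set.range fun a : Fin n → M => tupleType L a).Finite

variable (M) in
/-- The formula `φ(x; y)` is NIP in `M`: for some `k`, no `k` tuples are shattered by `φ`. -/
def NIPFormula {m n : ℕ} (φ : L.Formula (Fin m ⊕ Fin n)) : Prop :=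
  ∃ k : ℕ, ¬ ∃ (a : Fin k → Fin m → M) (b : Set (Fin k) → Fin n → M),
    ∀ (i : Fin k) (J : Set (Fin k)), φ.Realize (Sum.elim (a i) (b J)) ↔ i ∈ J

variable (M) in
/-- `M` is NIP: all formulas `φ(x; y)` are NIP in `M`. -/
def NIPStructure : Prop :=
  ∀ (m n : ℕ) (φ : L.Formula (Fin m ⊕ Fin n)), NIPFormula L M φ

end Basic

/-! ### Definable sets of `M^eq` -/

/-- An `A`-definable set of `M^eq`: the quotient of an `A`-definable subset of a power of `M` by
an `A`-definable equivalence relation. -/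
structure Interpretable (L : FirstOrder.Language.{u, v}) (M : Type w) [L.Structure M]
    (A : Set M) where
  /-- the exponent of the power of `M` -/
  arity : ℕ
  /-- the definable subset of `M ^ arity` -/
  dom : Set (Fin arity → M)
  /-- the definable equivalence relation -/
  rel : Setoid dom
  dom_definable : A.Definable L dom
  rel_definable : A.Definable L
    {v : Fin arity ⊕ Fin arity → M |
      ∃ (h₁ : (fun i => v (Sum.inl i)) ∈ dom) (h₂ : (fun i => v (Sum.inr i)) ∈ dom),
        rel ⟨_, h₁⟩ ⟨_, h₂⟩}

namespace Interpretable

variable {L : FirstOrder.Language.{u, v}} {M : Type w} [L.Structure M] {A : Set M}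

/-- The set of elements (of the sort of imaginaries) that is described by `X`. -/
def Carrier (X : Interpretable L M A) : Type w := Quotient X.rel

/-- The tuple `v` of elements of `M` is a representative of the imaginary element `x`. -/
def Codes (X : Interpretable L M A) (v : Fin X.arity → M) (x : X.Carrier) : Prop :=
  ∃ h : v ∈ X.dom, (Quotient.mk X.rel ⟨v, h⟩ : Quotient X.rel) = x

/-- A relation `S(y, x₁, …, x_l)` between tuples `y` of elements of `M` and elements `x_i` of `X` is
definable with parameters in `B` in `M^eq`, i.e. its pullback to a power of `M` is `B`-definable. -/
def DefinableRel (X : Interpretable L M A) (B : Set M) {α : Type} {l : ℕ}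
    (S : (α → M) → (Fin l → X.Carrier) → Prop) : Prop :=
  B.Definable L {v : α ⊕ (Fin l × Fin X.arity) → M |
    ∃ x : Fin l → X.Carrier,
      (∀ i, X.Codes (fun j => v (Sum.inr (i, j))) (x i)) ∧ S (fun i => v (Sum.inl i)) x}

/-- A family of subsets of `X`, indexed by tuples of elements of `M`, that is uniformly definable
by one formula with parameters in `B`. -/
def DefinableFamily (X : Interpretable L M A) (B : Set M) {α : Type}
    (R : (α → M) → Set X.Carrier) : Prop :=
  X.DefinableRel B (l := 1) fun y x => x 0 ∈ R y

/-- A subset of `X` that is definable with parameters in `B`. -/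
def DefinableSubset (X : Interpretable L M A) (B : Set M) (I : Set X.Carrier) : Prop :=
  X.DefinableFamily B (α := Fin 0) fun _ => I

end Interpretable

/-! ### Rank -/

section Rank

variable (L : FirstOrder.Language.{u, v}) {M : Type w} [L.Structure M]

/-- `rk(D) ≥ n`: always if `n = 0`; for `n = 1` if `D` is infinite; for `n + 1` with `n ≥ 1` if there
is an infinite uniformly definable family `(X_t : t ∈ E)` of subsets of `D` in `M^eq`, which is
`k`-inconsistent for some `k` and such that `rk(X_t) ≥ n` for all `t ∈ E`. -/
def rankGE {α : Type} : ℕ → Set (α → M) → Prop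
  | 0, _ => True
  | 1, D => D.Infinite
  | n + 2, D => ∃ (E : Interpretable L M (Set.univ : Set M)) (X : E.Carrier → Set (α → M)),
      Infinite E.Carrier ∧
      E.DefinableRel Set.univ (l := 1) (fun y t => y ∈ X (t 0)) ∧
      (∀ t, X t ⊆ D) ∧
      (∃ k : ℕ, ∀ s : Finset E.Carrier, s.card = k → ¬ ∃ y, ∀ t ∈ s, y ∈ X t) ∧
      ∀ t, rankGE (n + 1) (X t)

/-- The rank of a definable set; the value `⊤` means that the rank is not finite. -/
noncomputable def setRank {α : Type} (D : Set (α → M)) : ℕ∞ :=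
  ⨆ (n : ℕ) (_ : rankGE L n D), (n : ℕ∞)

/-- The rank `rk(a/B)`: the minimal rank of a `B`-definable set containing `a`. -/
noncomputable def tupleRank {α : Type} (a : α → M) (B : Set M) : ℕ∞ :=
  ⨅ (D : Set (α → M)) (_ : B.Definable L D ∧ a ∈ D), setRank L D

variable (M) in
/-- The structure `M` has finite rank. -/
def FiniteRank : Prop :=
  setRank L (Set.univ : Set (Fin 1 → M)) ≠ ⊤

/-- Rank independence of two tuples over `B`: `rk(ab/B) = rk(a/B) + rk(b/B)`. -/
def RankIndependent {α β : Type} (a : α → M) (b : β → M) (B : Set M) : Prop :=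
  tupleRank L (Sum.elim a b) B = tupleRank L a B + tupleRank L b B

end Rank

/-! ### Completions: the common formalism -/

/-- A notion of cut on `V`: which subsets of `V` represent a cut, and when two of them represent the
same cut. It is used below only for `linearCuts` and `circularCuts`. -/
structure CutNotion (V : Type w) where
  /-- the set `I` represents a cut -/
  IsRep : Set V → Prop
  /-- the two sets represent the same cut -/
  same : Setoid {I : Set V // IsRep I}

namespace CutNotion

/-- The completion: the set of all cuts. -/
def Completion {V : Type w} (N : CutNotion V) : Type w := Quotient N.same

/-- The set `I` represents the cut `c`. -/
def Represents {V : Type w} (N : CutNotion V) (I : Set V) (c : N.Completion) : Prop :=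
  ∃ h : N.IsRep I, (Quotient.mk N.same ⟨I, h⟩ : Quotient N.same) = c

variable {L : FirstOrder.Language.{u, v}} {M : Type w} [L.Structure M] {A : Set M}
  {X : Interpretable L M A}

/-- The function `f` from the set `S` of tuples of elements of `M` to the completion is definable
over `B`: there is a uniformly `∅`-definable family `(R_d)` of subsets of `X` such that `f` takes
values in the imaginary sort of the cuts represented by some `R_d`, and its graph, as a relation
between `S` and this sort, is `B`-definable. -/
def DefinableMap (N : CutNotion X.Carrier) (B : Set M) {α : Type} {S : Set (α → M)}
    (f : S → N.Completion) : Prop :=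
  ∃ (k : ℕ) (R : (Fin k → M) → Set X.Carrier), X.DefinableFamily ∅ R ∧
    (∀ s, ∃ d, N.Represents (R d) (f s)) ∧
    B.Definable L {v : α ⊕ Fin k → M | ∃ h : (fun i => v (Sum.inl i)) ∈ S,
      N.Represents (R fun i => v (Sum.inr i)) (f ⟨_, h⟩)}

/-- The cut `c` is algebraic over `B` in `M^eq`: in the imaginary sort of the cuts represented by the
members of some uniformly `∅`-definable family `(R_d)`, there is a finite `B`-definable set that
contains `c`. Here this finite set is the image of a `B`-definable set `Y` of indices `d`. -/
def Algebraic (N : CutNotion X.Carrier) (B : Set M) (c : N.Completion) : Prop :=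
  ∃ (k : ℕ) (R : (Fin k → M) → Set X.Carrier), X.DefinableFamily ∅ R ∧
    ∃ Y : Set (Fin k → M), B.Definable L Y ∧ (∀ d ∈ Y, N.IsRep (R d)) ∧
      {c' | ∃ d ∈ Y, N.Represents (R d) c'}.Finite ∧ ∃ d ∈ Y, N.Represents (R d) c

end CutNotion

/-! ### Linear orders -/

section Linear

variable {L : FirstOrder.Language.{u, v}} {M : Type w} [L.Structure M] {A : Set M}

/-- The linear order on `X` is definable over `B`. -/
def DefinableLinearOrder (X : Interpretable L M A) [LinearOrder X.Carrier] (B : Set M) : Prop :=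
  X.DefinableRel B (α := Fin 0) (l := 2) fun _ x => x 0 ≤ x 1

/-- Topological rank 1: no equivalence relation on `X` that is definable with parameters and has
convex classes has infinitely many infinite classes. -/
def LinearTopRankOne (X : Interpretable L M A) [LinearOrder X.Carrier] : Prop :=
  ∀ r : Setoid X.Carrier,
    X.DefinableRel Set.univ (α := Fin 0) (l := 2) (fun _ x => r (x 0) (x 1)) →
    (∀ C ∈ r.classes, C.OrdConnected) → {C ∈ r.classes | C.Infinite}.Finite

/-- The completion of a linear order `X` consists of the initial segments that are definable with
parameters, are neither empty nor everything, and have no last element. -/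
def linearCuts (X : Interpretable L M A) [LinearOrder X.Carrier] : CutNotion X.Carrier where
  IsRep I := X.DefinableSubset Set.univ I ∧ IsLowerSet I ∧ I.Nonempty ∧ I ≠ Set.univ ∧
    ∀ x ∈ I, ∃ y ∈ I, x < y
  same := ⊥

end Linear

/-! ### Circular orders -/

section CircularSets

variable {V : Type w} [CircularOrder V]

/-- A subset of a circular order is convex if for any two distinct elements of it, it contains one
of the two open intervals between them. -/
def CircConvex (I : Set V) : Prop :=
  ∀ a ∈ I, ∀ b ∈ I, a ≠ b → Set.cIoo a b ⊆ I ∨ Set.cIoo b a ⊆ I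

/-- The order induced on a bounded convex set `I` by the circular order. -/
def CircLT (I : Set V) (a b : V) : Prop :=
  a ≠ b ∧ Set.cIoo a b ⊆ I

/-- `J` is an end segment of `I`, for the order induced on the bounded convex set `I`. -/
def CircEndSegment (J I : Set V) : Prop :=
  J ⊆ I ∧ ∀ x ∈ J, ∀ y ∈ I, CircLT I x y → y ∈ J

/-- A nonempty bounded convex set without last element in the induced order. -/
def CircPreCut (I : Set V) : Prop :=
  CircConvex I ∧ Iᶜ.Infinite ∧ I.Nonempty ∧ ∀ x ∈ I, ∃ y ∈ I, CircLT I x y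

/-- `I` and `J` define the same cut: one of them is an end segment of the other. -/
def CircSameCut (I J : Set V) : Prop :=
  CircEndSegment I J ∨ CircEndSegment J I

end CircularSets

section CircularSetsProof

variable {V : Type w} [CircularOrder V]

theorem circ_tri {x y j : V} (h1 : x ≠ y) (h2 : y ≠ j) (h3 : j ≠ x) :
    sbtw x y j ∨ sbtw y x j := by
  rcases btw_total x y j with h | h
  · left
    exact sbtw_of_btw_not_btw h fun h' => by
      rcases h.antisymm h' with e | e | e
      exacts [h1 e, h2 e, h3 e]
  · right
    exact (sbtw_of_btw_not_btw h fun h' => by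
      rcases h.antisymm h' with e | e | e
      exacts [h2 e.symm, h1 e.symm, h3 e.symm]).cyclic_left

theorem cIoo_left_subset {x y z : V} (h : z ∈ Set.cIoo x y) : Set.cIoo x z ⊆ Set.cIoo x y := by
  intro t ht
  exact sbtw_trans_right ht h

theorem CircEndSegment.trans {I J K : Set V} (h1 : CircEndSegment I J) (h2 : CircEndSegment J K) :
    CircEndSegment I K := by
  refine ⟨h1.1.trans h2.1, fun x hx y hy hxy => ?_⟩
  refine h1.2 x hx y (h2.2 x (h1.1 hx) y hy hxy) ⟨hxy.1, fun z hz => ?_⟩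
  refine h2.2 x (h1.1 hx) z (hxy.2 hz) ⟨?_, (cIoo_left_subset hz).trans hxy.2⟩
  rintro rfl
  exact sbtw_irrefl_left hz

theorem CircConvex.total {I : Set V} (hI : CircConvex I) {x y : V} (hx : x ∈ I) (hy : y ∈ I)
    (h : x ≠ y) : CircLT I x y ∨ CircLT I y x :=
  (hI x hx y hy h).imp (fun k => ⟨h, k⟩) (fun k => ⟨h.symm, k⟩)

/-- Two end segments of the same convex set are comparable. -/
theorem same_of_endSegments {I J K : Set V} (hJ : CircConvex J) (h1 : CircEndSegment I J)
    (h2 : CircEndSegment K J) : CircSameCut I K := by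
  have key : ∀ {P Q : Set V}, CircEndSegment P J → CircEndSegment Q J → P ⊆ Q →
      CircEndSegment P Q := fun hP hQ hPQ =>
    ⟨hPQ, fun x hx y hy hxy => hP.2 x hx y (hQ.1 hy) ⟨hxy.1, hxy.2.trans hQ.1⟩⟩
  by_cases h : I ⊆ K
  · exact Or.inl (key h1 h2 h)
  · refine Or.inr (key h2 h1 fun y hy => ?_)
    obtain ⟨x, hx, hxK⟩ := Set.not_subset.1 h
    have hne : x ≠ y := fun e => hxK (e ▸ hy)
    rcases hJ.total (h1.1 hx) (h2.1 hy) hne with k | k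
    · exact h1.2 x hx y (h2.1 hy) k
    · exact absurd (h2.2 y hy x (h1.1 hx) k) hxK

/-- Two bounded convex sets with a common nonempty end segment are comparable. -/
theorem same_of_common {I J K : Set V} (hI : CircConvex I) (hK : CircConvex K)
    (bI : Iᶜ.Nonempty) (bK : Kᶜ.Nonempty) (hJ : J.Nonempty)
    (h1 : CircEndSegment J I) (h2 : CircEndSegment J K) : CircSameCut I K := by
  obtain ⟨j, hj⟩ := hJ
  have before : ∀ {P : Set V}, CircConvex P → CircEndSegment J P → ∀ x ∈ P, x ∉ J →
      CircLT P x j := by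
    intro P hP hJP x hx hxJ
    rcases hP.total hx (hJP.1 hj) (fun e => hxJ (e ▸ hj)) with k | k
    · exact k
    · exact absurd (hJP.2 j hj x hx k) hxJ
  have key : ∀ {P Q : Set V}, CircConvex P → CircConvex Q → Qᶜ.Nonempty → CircEndSegment J P →
      CircEndSegment J Q → P ⊆ Q → CircEndSegment P Q := by
    rintro P Q hP hQ ⟨w, hw⟩ hJP hJQ hPQ
    refine ⟨hPQ, fun x hx y hy hxy => ?_⟩
    by_cases hyJ : y ∈ J
    · exact hJP.1 hyJ
    have hxJ : x ∉ J := fun hxJ => hyJ (hJQ.2 x hxJ y hy hxy)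
    have kx := before hP hJP x hx hxJ
    have ky := before hQ hJQ y hy hyJ
    rcases circ_tri hxy.1 ky.1 kx.1.symm with t | t
    · exact kx.2 t
    · exfalso
      have hxw : x ≠ w := fun e => hw (e ▸ hPQ hx)
      have hyw : y ≠ w := fun e => hw (e ▸ hy)
      rcases circ_tri hxw hyw.symm hxy.1.symm with s | s
      · exact hw (hxy.2 s)
      · exact hw (ky.2 (sbtw_trans_right s.cyclic_right t))
  by_cases h : I ⊆ K
  · exact Or.inl (key hI hK bK h1 h2 h)
  · refine Or.inr (key hK hI bI h2 h1 fun y hy => ?_)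
    obtain ⟨x, hx, hxK⟩ := Set.not_subset.1 h
    by_contra hyI
    have kx := before hI h1 x hx fun hxJ => hxK (h2.1 hxJ)
    have ky := before hK h2 y hy fun hyJ => hyI (h1.1 hyJ)
    have hne : x ≠ y := fun e => hxK (e ▸ hy)
    rcases circ_tri hne ky.1 kx.1.symm with t | t
    · exact hyI (kx.2 t)
    · exact hxK (ky.2 t)

theorem CircSameCut.trans {I J K : Set V} (hI : CircPreCut I) (hJ : CircPreCut J)
    (hK : CircPreCut K) (h1 : CircSameCut I J) (h2 : CircSameCut J K) : CircSameCut I K := by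
  rcases h1 with h1 | h1 <;> rcases h2 with h2 | h2
  · exact Or.inl (h1.trans h2)
  · exact same_of_endSegments hJ.1 h1 h2
  · exact same_of_common hI.1 hK.1 hI.2.1.nonempty hK.2.1.nonempty hJ.2.2.1 h1 h2
  · exact Or.inr (h2.trans h1)

theorem CircSameCut.refl (I : Set V) : CircSameCut I I :=
  Or.inl ⟨subset_rfl, fun _ _ _ hy _ => hy⟩

end CircularSetsProof

section Circular

variable {L : FirstOrder.Language.{u, v}} {M : Type w} [L.Structure M] {A : Set M}

/-- The circular order on `X` is definable over `B`. -/
def DefinableCircularOrder (X : Interpretable L M A) [CircularOrder X.Carrier] (B : Set M) : Prop :=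
  X.DefinableRel B (α := Fin 0) (l := 3) fun _ x => btw (x 0) (x 1) (x 2)

/-- Topological rank 1: no equivalence relation on `X` that is definable with parameters and has
convex classes has infinitely many infinite classes. -/
def CircularTopRankOne (X : Interpretable L M A) [CircularOrder X.Carrier] : Prop :=
  ∀ r : Setoid X.Carrier,
    X.DefinableRel Set.univ (α := Fin 0) (l := 2) (fun _ x => r (x 0) (x 1)) →
    (∀ C ∈ r.classes, CircConvex C) → {C ∈ r.classes | C.Infinite}.Finite

/-- The completion of a circular order `X` consists of the nonempty bounded convex sets that are
definable with parameters and have no last element, up to defining the same cut. -/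
def circularCuts (X : Interpretable L M A) [CircularOrder X.Carrier] : CutNotion X.Carrier where
  IsRep I := X.DefinableSubset Set.univ I ∧ CircPreCut I
  same :=
    { r := fun I J => CircSameCut I.1 J.1
      iseqv :=
        { refl := fun I => CircSameCut.refl I.1
          symm := fun h => h.symm
          trans := fun {I J K} h₁ h₂ => CircSameCut.trans I.2.2 J.2.2 K.2.2 h₁ h₂ } }

end Circular

/-! Suppose that c = f(a, b) is algebraic neither over a nor over b. If rk(a) = 1, then either a is
algebraic over b, and then so is c, or the ranks add up; hence a and b may be taken independent.
Choose conjugates b_0, b_1, ... of b over a, each of full rank over a, the earlier ones and a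
parameter (used to cut a circular order open), and put c_i = f(a, b_i). Additivity of the rank shows
that c_i is not algebraic over a, b_0, ..., b_{i-1}, and that for i < K it is not algebraic over
b_0, ..., b_{K-1}, in both cases even with the parameter added (`FiniteRk.exists_sequence`). A
topological argument then shows that the orbit of (c_0, ..., c_{K-1}) under the automorphisms fixing
b_0, ..., b_{K-1} and the parameter is dense in a box of the K-th power of the completion. With
points x_i of V splitting the sides of that box, every pattern of inequalities between x_i and f(a',
b_i) is attained by some conjugate a' of a. So the relation "x lies below f(a', b')" shatters K
pairs (x_i, b_i) for every K, contrary to NIP (`OmegaCategorical.false_of_tame`).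

The topological argument adds one coordinate at a time (`TameAction.interior_closure_ne_empty`). If
the orbit of c is somewhere dense but that of (c, y) is not, the closure of the latter is, over some
open set, the graph of a continuous equivariant function F; this rests on a Baire theorem for
definable families of closed sets (`TameAction.baire`). If F is locally constant in all coordinate
directions, it is constant on a box, and y is one of finitely many heights at which the closure is a
horizontal plane. Otherwise F restricts to a strictly monotone germ at a coordinate of c, with value
y there. Translating it by automorphisms that fix c gives infinitely many germs at the same point,
no two of which cross. Two of them with very close values yield a long chain of points fixed by a
common group, but the number of such points is bounded by a number of orbits that is uniform over
the pairs used (`TameAction.MonoGerm.finite_orbit`). Topological rank 1 enters only through the fact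
that an infinite invariant set of cuts is somewhere dense.

The model theory is expressed through the group of elementary permutations. By ω-categoricity,
definable over a finite set means invariant under an open subgroup, and algebraic means having a
finite orbit. The rank of a tuple becomes a rank `RkGE` of its stabilizer P: one step passes from K
to the stabilizer T of an imaginary that has an infinite orbit under K but a finite one under K ⊓ P.
Additivity is proved for this rank. -/

set_option linter.unusedSectionVars false

/-! ### Order actions with finitely many orbits on rational tuples (tuples from `Q`) -/

section TameBasic

open MulAction Topology

/-- An order-preserving action on a complete dense linear order, with a family of "open"
subgroups and a dense set `Q` of points with open stabilizers, such that open subgroups have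
finitely many orbits on tuples from `Q` and infinite invariant sets are somewhere dense. -/
structure TameAction (G R : Type*) [Group G] [CompleteLinearOrder R] [TopologicalSpace R]
    [MulAction G R] (Op : Subgroup G → Prop) (Q : Set R) : Prop where
  smul_lt : ∀ (g : G) {x y : R}, x < y → g • x < g • y
  smul_mem : ∀ (g : G) {q : R}, q ∈ Q → g • q ∈ Q
  dense : ∀ {x y : R}, x < y → ∃ q ∈ Q, x < q ∧ q < y
  inf : ∀ {H K : Subgroup G}, Op H → Op K → Op (H ⊓ K)
  conj : ∀ {H : Subgroup G} (g : G), Op H → Op (H.map (MulAut.conj g).toMonoidHom)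
  stab : ∀ {q : R}, q ∈ Q → Op (stabilizer G q)
  orbits : ∀ {H : Subgroup G}, Op H → ∀ (ι : Type) [Finite ι], ∃ S : Set (ι → R), S.Finite ∧
    ∀ p : ι → R, (∀ i, p i ∈ Q) → ∃ s ∈ S, ∃ h ∈ H, p = h • s
  tame : ∀ {H : Subgroup G}, Op H → ∀ Z : Set R, (∀ h ∈ H, ∀ z ∈ Z, h • z ∈ Z) → Z.Infinite →
    (interior (closure Z)).Nonempty
  unif : ∀ {H K : Subgroup G}, Op H → Op K → ∃ N : ℕ, ∀ g : G, ∃ S : Finset R, S.card ≤ N ∧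
    ∀ q ∈ Q, ∃ s ∈ S, ∃ h ∈ H ⊓ K.map (MulAut.conj g).toMonoidHom, q = h • s

variable {G R : Type*} [Group G] [CompleteLinearOrder R] [TopologicalSpace R]
    [OrderTopology R] [DenselyOrdered R] [Nontrivial R] [MulAction G R] {Op : Subgroup G → Prop}
    {Q : Set R}

namespace TameAction

theorem smul_lt_iff (hA : TameAction G R Op Q) (g : G) {x y : R} : g • x < g • y ↔ x < y :=
  ⟨fun h => by simpa using hA.smul_lt g⁻¹ h, hA.smul_lt g⟩

theorem smul_le_iff (hA : TameAction G R Op Q) (g : G) {x y : R} : g • x ≤ g • y ↔ x ≤ y := by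
  rw [← not_lt, ← not_lt, hA.smul_lt_iff]

theorem continuousConstSMul (hA : TameAction G R Op Q) : ContinuousConstSMul G R where
  continuous_const_smul g := by
    have : Monotone (fun x : R => g • x) := fun x y h => (hA.smul_le_iff g).2 h
    exact this.continuous_of_surjective (MulAction.surjective g)

theorem stab_finite (hA : TameAction G R Op Q) {H : Subgroup G} (hH : Op H) {n : ℕ}
    (p : Fin n → R) (hp : ∀ i, p i ∈ Q) :
    ∃ K : Subgroup G, Op K ∧ K ≤ H ∧ ∀ k ∈ K, k • p = p := by
  induction n with
  | zero => exact ⟨H, hH, le_rfl, fun k _ => Subsingleton.elim _ _⟩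
  | succ n ih =>
    obtain ⟨K, hK, hKH, hk⟩ := ih (fun i => p i.succ) (fun i => hp _)
    refine ⟨K ⊓ stabilizer G (p 0), hA.inf hK (hA.stab (hp 0)), inf_le_left.trans hKH, ?_⟩
    intro k hk'
    obtain ⟨h1, h2⟩ := Subgroup.mem_inf.1 hk'
    funext i
    refine Fin.cases ?_ (fun j => ?_) i
    · exact h2
    · exact congrFun (hk k h1) j

theorem exists_Icc (hA : TameAction G R Op Q) {U : Set R} (hU : IsOpen U) (hne : U.Nonempty) :
    ∃ p ∈ Q, ∃ q ∈ Q, p < q ∧ Icc p q ⊆ U := by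
  obtain ⟨a, b, hab, hs⟩ := hU.exists_Ioo_subset hne
  obtain ⟨q, hq, haq, hqb⟩ := hA.dense hab
  obtain ⟨p, hp, hap, hpq⟩ := hA.dense haq
  exact ⟨p, hp, q, hq, hpq, fun x hx => hs ⟨hap.trans_le hx.1, hx.2.trans_lt hqb⟩⟩

theorem exists_box (hA : TameAction G R Op Q) {n : ℕ} {U : Set (Fin n → R)} (hU : IsOpen U)
    {x : Fin n → R} (hx : x ∈ U) :
    ∃ p q : Fin n → R, (∀ i, p i ∈ Q) ∧ (∀ i, q i ∈ Q) ∧ (∀ i, p i < q i) ∧ Icc p q ⊆ U := by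
  obtain ⟨u, hu, hs⟩ := isOpen_pi_iff'.1 hU x hx
  choose p hp q hq hpq hsub using fun i => hA.exists_Icc (hu i).1 ⟨x i, (hu i).2⟩
  exact ⟨p, q, hp, hq, hpq, fun y hy => hs fun i _ => hsub i ⟨hy.1 i, hy.2 i⟩⟩

theorem exists_rat (hA : TameAction G R Op Q) {n : ℕ} {U : Set (Fin n → R)} (hU : IsOpen U)
    (hne : U.Nonempty) : ∃ p ∈ U, ∀ i, p i ∈ Q := by
  obtain ⟨x, hx⟩ := hne
  obtain ⟨p, q, hp, -, hpq, hs⟩ := hA.exists_box hU hx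
  exact ⟨p, hs ⟨le_rfl, fun i => (hpq i).le⟩, hp⟩

/-- Equivariance makes the cardinality of `N p` constant on `H`-orbits, and the rational tuples lie
in finitely many of these. -/
theorem card_bound (hA : TameAction G R Op Q) {H : Subgroup G} (hH : Op H) {ι : Type} [Finite ι]
    {α : Type*} [MulAction G α] (N : (ι → R) → Set α)
    (hN : ∀ h ∈ H, ∀ p x, x ∈ N p → h • x ∈ N (h • p)) :
    ∃ B : ℕ, ∀ p : ι → R, (∀ i, p i ∈ Q) → (N p).Finite → (N p).ncard ≤ B := by
  obtain ⟨S, hS, hcov⟩ := hA.orbits hH ι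
  obtain ⟨B, hB⟩ := (hS.image fun s => (N s).ncard).bddAbove
  refine ⟨B, fun p hp _ => ?_⟩
  obtain ⟨s, hs, h, hh, rfl⟩ := hcov p hp
  have : N (h • s) = (fun x => h • x) '' N s := by
    ext x
    constructor
    · intro hx
      refine ⟨h⁻¹ • x, ?_, smul_inv_smul _ _⟩
      simpa using hN h⁻¹ (H.inv_mem hh) _ _ hx
    · rintro ⟨y, hy, rfl⟩
      exact hN h hh _ _ hy
  rw [this, Set.ncard_image_of_injective _ (MulAction.injective h)]
  exact hB ⟨s, hs, rfl⟩

end TameAction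
end TameBasic

/-! ### Finiteness of invariant families of open sets -/

section TameFinite

open MulAction Topology

variable {G R : Type*} [Group G] [CompleteLinearOrder R] [TopologicalSpace R]
    [OrderTopology R] [DenselyOrdered R] [Nontrivial R] [MulAction G R] {Op : Subgroup G → Prop}
    {Q : Set R}

/-- A preconnected set disjoint from the frontier of `s` lies inside `s` or outside. -/
theorem IsPreconnected.mem_iff_of_disjoint_frontier {X : Type*} [TopologicalSpace X] {s t : Set X}
    (ht : IsPreconnected t) (h : Disjoint t (frontier s)) {x y : X} (hx : x ∈ t) (hy : y ∈ t) :
    x ∈ s ↔ y ∈ s := by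
  have key : ∀ {x y : X}, x ∈ t → y ∈ t → x ∈ s → y ∈ s := by
    intro x y hx hy hxs
    by_contra hys
    have hf : ∀ z ∈ t, z ∈ closure s → z ∈ interior s := fun z hz hzc => by
      by_contra hzi
      exact Set.disjoint_left.1 h hz ⟨hzc, hzi⟩
    obtain ⟨z, -, hz1, hz2⟩ := ht (interior s) (closure s)ᶜ isOpen_interior
      isClosed_closure.isOpen_compl
      (fun z hz => (em (z ∈ closure s)).imp (hf z hz) id) ⟨x, hx, hf x hx (subset_closure hxs)⟩
      ⟨y, hy, fun hyc => hys (interior_subset (hf y hy hyc))⟩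
    exact hz2 (subset_closure (interior_subset hz1))
  exact ⟨key hx hy, key hy hx⟩

namespace TameAction

theorem smul_frontier (hA : TameAction G R Op Q) (g : G) (s : Set R) {x : R}
    (hx : x ∈ frontier s) : g • x ∈ frontier ((fun y => g • y) '' s) := by
  have := hA.continuousConstSMul
  have := (Homeomorph.smul (α := R) g).image_frontier s
  have h2 : g • x ∈ (Homeomorph.smul (α := R) g) '' frontier s := ⟨x, hx, rfl⟩
  rw [this] at h2
  exact h2

/-- Consider the set `Θ` of all frontier points of members. If it is finite, it cuts the line into
finitely many pieces, each inside or outside any given member, so a nonempty member contains one of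
finitely many rational test points. If it is infinite, it is somewhere dense, which is incompatible
with a bounded number of members through each rational point. -/
theorem finite_of_point_finite_one (hA : TameAction G R Op Q) {H : Subgroup G} (hH : Op H)
    (Λ : R → R → Prop) (hinv : ∀ h ∈ H, ∀ x y, Λ x y → Λ (h • x) (h • y))
    (hopen : ∀ x, IsOpen {y | Λ x y}) (hfin : ∀ y ∈ Q, {x | Λ x y}.Finite) :
    {x | ∃ y, Λ x y}.Finite := by
  set Θ : Set R := {θ | ∃ x, θ ∈ frontier {y | Λ x y}} with hΘ
  have himg : ∀ h ∈ H, ∀ x, (fun y => h • y) '' {y | Λ x y} = {y | Λ (h • x) y} := by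
    intro h hh x
    ext y
    constructor
    · rintro ⟨z, hz, rfl⟩
      exact hinv h hh _ _ hz
    · intro hy
      refine ⟨h⁻¹ • y, ?_, smul_inv_smul _ _⟩
      simpa using hinv h⁻¹ (H.inv_mem hh) _ _ hy
  have hΘinv : ∀ h ∈ H, ∀ z ∈ Θ, h • z ∈ Θ := by
    rintro h hh z ⟨x, hx⟩
    refine ⟨h • x, ?_⟩
    rw [← himg h hh]
    exact hA.smul_frontier h _ hx
  by_cases hΘf : Θ.Finite
  · -- finitely many complementary intervals
    let s : R → Set R := fun y => {θ ∈ Θ | θ < y}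
    have hsfin : (s '' (Q \ Θ)).Finite :=
      hΘf.finite_subsets.subset (by
        rintro _ ⟨y, -, rfl⟩
        exact fun θ h => h.1)
    obtain ⟨Y, hYsub, hYbij⟩ := Set.exists_subset_bijOn (Q \ Θ) s
    have hYs := hYbij.image_eq
    have hYfin : Y.Finite := Set.Finite.of_finite_image (hYs ▸ hsfin) hYbij.injOn
    have hsub : {x | ∃ y, Λ x y} ⊆ ⋃ y ∈ Y, {x | Λ x y} := by
      rintro x ⟨y0, hy0⟩
      have hne : ({y | Λ x y} \ Θ).Nonempty := by
        by_contra hemp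
        rw [Set.not_nonempty_iff_eq_empty, Set.sdiff_eq_empty] at hemp
        obtain ⟨p, -, q, -, hpq, hs⟩ := hA.exists_Icc (hopen x) ⟨y0, hy0⟩
        exact (Set.Icc_infinite hpq) (hΘf.subset (hs.trans hemp))
      obtain ⟨p, hp, q, -, hpq, hs⟩ := hA.exists_Icc
        ((hopen x).sdiff hΘf.isClosed) hne
      have hpx := hs ⟨le_rfl, hpq.le⟩
      have : s p ∈ s '' Y := by
        rw [hYs]; exact ⟨p, ⟨hp, hpx.2⟩, rfl⟩
      obtain ⟨y, hyY, hys⟩ := this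
      refine Set.mem_biUnion hyY ?_
      have hdisj : Disjoint (uIcc p y) (frontier {y | Λ x y}) := by
        rw [Set.disjoint_left]
        intro z hz hzf
        have hzΘ : z ∈ Θ := ⟨x, hzf⟩
        have hyΘ : y ∉ Θ := (hYsub hyY).2
        have e : (z ∈ s p ↔ z ∈ s y) := by rw [hys]
        have e1 : (z < p ↔ z < y) := by simpa [s, hzΘ] using e
        have n1 : z ≠ p := fun h => hpx.2 (h ▸ hzΘ)
        have n2 : z ≠ y := fun h => hyΘ (h ▸ hzΘ)
        rw [Set.mem_uIcc] at hz
        rcases hz with ⟨h1, h2⟩ | ⟨h1, h2⟩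
        · exact absurd (e1.2 (lt_of_le_of_ne h2 n2)) (not_lt.2 h1)
        · exact absurd (e1.1 (lt_of_le_of_ne h2 n1)) (not_lt.2 h1)
      exact (isPreconnected_uIcc.mem_iff_of_disjoint_frontier hdisj left_mem_uIcc
        right_mem_uIcc).1 hpx.1
    exact (hYfin.biUnion fun y hy => hfin y (hYsub hy).1).subset hsub
  · exfalso
    obtain ⟨z0, hz0⟩ := hA.tame hH Θ hΘinv hΘf
    set J := interior (closure Θ)
    have hJ : IsOpen J := isOpen_interior
    obtain ⟨B, hB⟩ := hA.card_bound hH (ι := Fin 1) (fun p : Fin 1 → R => {x | Λ x (p 0)})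
      (fun h hh p x hx => hinv h hh _ _ hx)
    have hB' : ∀ y ∈ Q, {x | Λ x y}.ncard ≤ B := fun y hy =>
      hB (fun _ => y) (fun _ => hy) (hfin y hy)
    obtain ⟨p, hp, q, -, hpq, hs⟩ := hA.exists_Icc hJ ⟨z0, hz0⟩
    have hex : ∃ m, ∃ y ∈ Q ∩ J, {x | Λ x y}.ncard = m := ⟨_, p, ⟨hp, hs ⟨le_rfl, hpq.le⟩⟩, rfl⟩
    -- The number of members through a rational point is bounded, so it has a maximum on `J`. Near a
    -- maximal point `y`, the members through any rational point are exactly those through `y`.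
    obtain ⟨y, ⟨hyQ, hyJ⟩, hmax⟩ : ∃ y ∈ Q ∩ J, ∀ y' ∈ Q ∩ J,
        {x | Λ x y'}.ncard ≤ {x | Λ x y}.ncard := by
      by_contra hcon
      push Not at hcon
      have : ∀ n : ℕ, ∃ y ∈ Q ∩ J, n ≤ {x | Λ x y}.ncard := by
        intro n
        induction n with
        | zero => exact ⟨p, ⟨hp, hs ⟨le_rfl, hpq.le⟩⟩, Nat.zero_le _⟩
        | succ n ih =>
          obtain ⟨y, hy, hn⟩ := ih
          obtain ⟨y', hy', hlt⟩ := hcon y hy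
          exact ⟨y', hy', by omega⟩
      obtain ⟨y, hy, hn⟩ := this (B + 1)
      have := hB' y hy.1
      omega
    set J' := J ∩ ⋂ x ∈ {x | Λ x y}, {y' | Λ x y'} with hJ'
    have hJ'o : IsOpen J' := hJ.inter ((hfin y hyQ).isOpen_biInter fun x _ => hopen x)
    have hyJ' : y ∈ J' := ⟨hyJ, Set.mem_iInter₂.2 fun x hx => hx⟩
    have heq : ∀ y' ∈ Q, y' ∈ J' → {x | Λ x y'} = {x | Λ x y} := by
      intro y' hy' hyJ''
      refine (Set.eq_of_subset_of_ncard_le ?_ (hmax y' ⟨hy', hyJ''.1⟩) (hfin y' hy')).symm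
      intro x hx
      exact Set.mem_iInter₂.1 hyJ''.2 x hx
    obtain ⟨θ, hθJ, x, hx⟩ : (J' ∩ Θ).Nonempty := by
      have : y ∈ closure Θ := interior_subset hyJ
      exact mem_closure_iff.1 this J' hJ'o hyJ'
    -- The member `x` has a frontier point in `J'`. If it contains `y`, it contains the whole of
    -- `J'`; if not, it still meets `J'` in a rational point, which lies only in members through
    -- `y`.
    by_cases hxy : Λ x y
    · have hsub : J' ⊆ {y' | Λ x y'} := fun z hz => Set.mem_iInter₂.1 hz.2 x hxy
      have := hx.2
      rw [(hopen x).interior_eq] at this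
      exact this (hsub hθJ)
    · have : (J' ∩ {y' | Λ x y'}).Nonempty := mem_closure_iff.1 hx.1 J' hJ'o hθJ
      obtain ⟨p', hp', q', -, hpq', hs'⟩ := hA.exists_Icc (hJ'o.inter (hopen x)) this
      have hm := hs' ⟨le_rfl, hpq'.le⟩
      have : x ∈ {x | Λ x y} := by
        rw [← heq p' hp' hm.1]
        exact hm.2
      exact hxy this

theorem fin_cons_smul {G R : Type*} [SMul G R] {n : ℕ} (g : G) (x : R) (w : Fin n → R) :
    g • (Fin.cons x w : Fin (n + 1) → R) = Fin.cons (g • x) (g • w) := by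
  funext i
  refine Fin.cases ?_ (fun j => ?_) i <;> simp

/-- An invariant family of nonempty open sets, indexed by points, in which every rational tuple
lies in finitely many members, is finite. -/
theorem finite_of_point_finite (hA : TameAction G R Op Q) {r : ℕ} : ∀ {H : Subgroup G}, Op H →
    ∀ (Λ : R → (Fin r → R) → Prop), (∀ h ∈ H, ∀ x y, Λ x y → Λ (h • x) (h • y)) →
    (∀ x, IsOpen {y | Λ x y}) → (∀ y, (∀ i, y i ∈ Q) → {x | Λ x y}.Finite) →
    {x | ∃ y, Λ x y}.Finite := by
  induction r with
  | zero =>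
    intro H _ Λ _ _ hfin
    refine (hfin Fin.elim0 (fun i => i.elim0)).subset ?_
    rintro x ⟨y, hy⟩
    rwa [Subsingleton.elim y Fin.elim0] at hy
  | succ r ih =>
    intro H hH Λ hinv hopen hfin
    -- One coordinate is projected away. Over a rational `w` only finitely many `x` occur, by the
    -- one-dimensional case for the stabilizer of `w`.
    have key := ih hH (fun x w => ∃ y0, Λ x (Fin.cons y0 w)) ?_ ?_ ?_
    · refine key.subset ?_
      rintro x ⟨y, hy⟩
      exact ⟨Fin.tail y, y 0, by rwa [Fin.cons_self_tail]⟩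
    · rintro h hh x w ⟨y0, hy⟩
      exact ⟨h • y0, by rw [← fin_cons_smul]; exact hinv h hh _ _ hy⟩
    · intro x
      have : {w : Fin r → R | ∃ y0, Λ x (Fin.cons y0 w)}
          = ⋃ y0, (fun w : Fin r → R => (Fin.cons y0 w : Fin (r + 1) → R)) ⁻¹' {y | Λ x y} := by
        ext w; simp
      rw [this]
      exact isOpen_iUnion fun y0 => (hopen x).preimage (by fun_prop)
    · intro w hw
      obtain ⟨K, hK, hKH, hKw⟩ := hA.stab_finite hH w hw
      refine hA.finite_of_point_finite_one hK (fun x y0 => Λ x (Fin.cons y0 w)) ?_ ?_ ?_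
      · intro k hk x y0 h
        have := hinv k (hKH hk) _ _ h
        rwa [fin_cons_smul, hKw k hk] at this
      · intro x
        exact (hopen x).preimage (f := fun y0 => (Fin.cons y0 w : Fin (r + 1) → R)) (by fun_prop)
      · intro y hy
        refine hfin _ fun i => ?_
        refine Fin.cases ?_ (fun j => ?_) i
        · simpa using hy
        · simpa using hw j

end TameAction
end TameFinite

/-! ### A Baire category theorem for invariant families of closed sets -/

section TameBaire

open MulAction Topology

variable {G R : Type*} [Group G] [CompleteLinearOrder R] [TopologicalSpace R]
    [OrderTopology R] [DenselyOrdered R] [Nontrivial R] [MulAction G R] {Op : Subgroup G → Prop}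
    {Q : Set R}

/-- `(p, q)` is a box with corners in `Q` and nonempty interior. -/
def RatBox {R : Type*} [LT R] (Q : Set R) {r : ℕ} (p q : Fin r → R) : Prop :=
  (∀ i, p i ∈ Q) ∧ (∀ i, q i ∈ Q) ∧ ∀ i, p i < q i

/-- A family of closed sets indexed by boxes: it is equivariant under `H` and grows when the boxes
shrink. -/
structure BoxFamily {G R : Type*} [Group G] [CompleteLinearOrder R] [TopologicalSpace R]
    [MulAction G R] (H : Subgroup G) {r : ℕ} {X : Type*} [TopologicalSpace X] [MulAction G X]
    (N : (Fin r → R) → (Fin r → R) → Set X) : Prop where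
  equivariant : ∀ h ∈ H, ∀ p q x, x ∈ N p q → h • x ∈ N (h • p) (h • q)
  mono : ∀ {p q p' q'}, p ≤ p' → q' ≤ q → N p q ⊆ N p' q'
  closed : ∀ p q, IsClosed (N p q)

theorem RatBox.cons {R : Type*} [LT R] {Q : Set R} {r : ℕ} {p q : Fin r → R} (h : RatBox Q p q)
    {a b : R} (ha : a ∈ Q) (hb : b ∈ Q) (hab : a < b) :
    RatBox (r := r + 1) Q (Fin.cons a p) (Fin.cons b q) := by
  refine ⟨fun i => ?_, fun i => ?_, fun i => ?_⟩ <;> refine Fin.cases ?_ (fun j => ?_) i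
  · simpa using ha
  · simpa using h.1 j
  · simpa using hb
  · simpa using h.2.1 j
  · simpa using hab
  · simpa using h.2.2 j

theorem RatBox.tail {R : Type*} [LT R] {Q : Set R} {r : ℕ} {p q : Fin (r + 1) → R}
    (h : RatBox Q p q) : RatBox Q (Fin.tail p) (Fin.tail q) :=
  ⟨fun i => h.1 i.succ, fun i => h.2.1 i.succ, fun i => h.2.2 i.succ⟩

namespace TameAction

theorem RatBox_smul (hA : TameAction G R Op Q) {r : ℕ} {p q : Fin r → R} (h : RatBox Q p q)
    (g : G) : RatBox Q (g • p) (g • q) :=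
  ⟨fun i => hA.smul_mem g (h.1 i), fun i => hA.smul_mem g (h.2.1 i), fun i => hA.smul_lt g (h.2.2 i)⟩

theorem smul_mem_Ioo (hA : TameAction G R Op Q) {g : G} {l z x : R} (hl : g • l = l) (hz : g • z = z)
    (hx : x ∈ Ioo l z) : g • x ∈ Ioo l z := by
  constructor
  · rw [← hl]; exact hA.smul_lt g hx.1
  · rw [← hz]; exact hA.smul_lt g hx.2

theorem smul_mem_Icc (hA : TameAction G R Op Q) {g : G} {l z x : R} (hl : g • l = l) (hz : g • z = z)
    (hx : x ∈ Icc l z) : g • x ∈ Icc l z := by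
  constructor
  · rw [← hl]; exact (hA.smul_le_iff g).2 hx.1
  · rw [← hz]; exact (hA.smul_le_iff g).2 hx.2

/-- A closed invariant set without interior in `(l, z)` is finite in `(l, z)`. -/
theorem finite_of_closed (hA : TameAction G R Op Q) {H : Subgroup G} (hH : Op H) {C : Set R}
    (hC : IsClosed C) (hinv : ∀ h ∈ H, ∀ x ∈ C, h • x ∈ C) {U : Set R}
    (hUinv : ∀ h ∈ H, ∀ x ∈ U, h • x ∈ U) (hemp : interior C ∩ U = ∅) : (C ∩ U).Finite := by
  by_contra hinf
  obtain ⟨x, hx⟩ := hA.tame hH (C ∩ U)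
    (fun h hh z hz => ⟨hinv h hh z hz.1, hUinv h hh z hz.2⟩) hinf
  obtain ⟨y, hy1, hy2⟩ := mem_closure_iff.1 (interior_subset hx) _ isOpen_interior hx
  have : y ∈ interior C ∩ U := by
    refine ⟨interior_mono ?_ hy1, hy2.2⟩
    exact (closure_mono inter_subset_left).trans hC.closure_subset
  rw [hemp] at this
  exact this

/-- In the interval each `N p q` is closed, without interior and invariant under an open subgroup,
hence finite, of size at most some `B`. Attach to `x` the open set of those `y` that lie inside some
box with `x ∈ N p q`; `finite_of_point_finite` applies to these open sets. -/
theorem finite_union_of_boxFamily (hA : TameAction G R Op Q) {H : Subgroup G} (hH : Op H) {r : ℕ}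
    {N : (Fin r → R) → (Fin r → R) → Set R} (hN : BoxFamily H N) {l z : R} (hl : l ∈ Q)
    (hz : z ∈ Q) (hemp : ∀ p q, RatBox Q p q → interior (N p q) ∩ Ioo l z = ∅) :
    {x | x ∈ Ioo l z ∧ ∃ p q, RatBox Q p q ∧ x ∈ N p q}.Finite := by
  set K := H ⊓ stabilizer G l ⊓ stabilizer G z with hKdef
  have hK : Op K := hA.inf (hA.inf hH (hA.stab hl)) (hA.stab hz)
  have hKl : ∀ k ∈ K, k ∈ H ∧ k • l = l ∧ k • z = z := fun k hk => ⟨hk.1.1, hk.1.2, hk.2⟩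
  set Λ : R → (Fin r → R) → Prop := fun x y => x ∈ Ioo l z ∧ ∃ p q, RatBox Q p q ∧
    (∀ i, p i < y i ∧ y i < q i) ∧ x ∈ N p q with hΛ
  have key := hA.finite_of_point_finite hK Λ ?_ ?_ ?_
  · refine key.subset ?_
    rintro x ⟨hx, p, q, hpq, hxN⟩
    choose y hy using fun i => hA.dense (hpq.2.2 i)
    exact ⟨y, hx, p, q, hpq, fun i => (hy i).2, hxN⟩
  · rintro k hk x y ⟨hx, p, q, hpq, hy, hxN⟩
    obtain ⟨hkH, hkl, hkz⟩ := hKl k hk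
    exact ⟨hA.smul_mem_Ioo hkl hkz hx, k • p, k • q, hA.RatBox_smul hpq k,
      fun i => ⟨hA.smul_lt k (hy i).1, hA.smul_lt k (hy i).2⟩, hN.equivariant k hkH _ _ _ hxN⟩
  · intro x
    have : {y | Λ x y} = ⋃ (p : Fin r → R) (q : Fin r → R)
        (_ : x ∈ Ioo l z ∧ RatBox Q p q ∧ x ∈ N p q), Set.pi univ fun i => Ioo (p i) (q i) := by
      ext y
      simp only [hΛ, mem_ofPred_eq, mem_iUnion, mem_pi, mem_univ, true_implies, mem_Ioo, exists_prop]
      tauto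
    rw [this]
    exact isOpen_iUnion fun p => isOpen_iUnion fun q => isOpen_iUnion fun _ =>
      isOpen_set_pi finite_univ fun i _ => isOpen_Ioo
  · intro y hy
    obtain ⟨B, hB⟩ := hA.card_bound hK (ι := Fin r ⊕ Fin r)
      (fun pq : Fin r ⊕ Fin r → R => N (fun i => pq (Sum.inl i)) (fun i => pq (Sum.inr i)) ∩ Ioo l z)
      (fun k hk p x hx => ⟨hN.equivariant k (hKl k hk).1 _ _ _ hx.1,
        hA.smul_mem_Ioo (hKl k hk).2.1 (hKl k hk).2.2 hx.2⟩)
    have hfin : ∀ p q, RatBox Q p q → (N p q ∩ Ioo l z).Finite ∧ (N p q ∩ Ioo l z).ncard ≤ B := by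
      intro p q hpq
      have hf : (N p q ∩ Ioo l z).Finite := by
        obtain ⟨K1, hK1, hK1H, hp⟩ := hA.stab_finite hK p hpq.1
        obtain ⟨K2, hK2, hK2H, hq⟩ := hA.stab_finite hK1 q hpq.2.1
        refine hA.finite_of_closed hK2 (hN.closed p q) ?_ ?_ (hemp p q hpq)
        · intro k hk x hx
          have := hN.equivariant k (hKl k (hK1H (hK2H hk))).1 _ _ _ hx
          rwa [hp k (hK2H hk), hq k hk] at this
        · intro k hk x hx
          have := hKl k (hK1H (hK2H hk))
          exact hA.smul_mem_Ioo this.2.1 this.2.2 hx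
      refine ⟨hf, ?_⟩
      refine hB (Sum.elim p q) ?_ hf
      rintro (i | i)
      · exact hpq.1 i
      · exact hpq.2.1 i
    by_contra hinf
    -- Given `B + 1` points attached to the same `y`, the intersection of their boxes is a rational
    -- box around `y`, and by monotonicity its member of the family contains all of them.
    obtain ⟨t, hts, htc⟩ := Set.Infinite.exists_subset_card_eq hinf (B + 1)
    have hne : t.Nonempty := Finset.card_pos.1 (by omega)
    choose! hx P Q' hbox hy' hmem using fun x (hx : x ∈ t) => hts (Finset.mem_coe.2 hx)
    have hp : ∀ i, ∃ p ∈ Q, p < y i ∧ ∀ x ∈ t, P x i ≤ p := by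
      intro i
      obtain ⟨x, hxt, he⟩ := Finset.exists_max_image t (fun x => P x i) hne
      exact ⟨P x i, (hbox x hxt).1 i, (hy' x hxt i).1, he⟩
    have hq : ∀ i, ∃ q ∈ Q, y i < q ∧ ∀ x ∈ t, q ≤ Q' x i := by
      intro i
      obtain ⟨x, hxt, he⟩ := Finset.exists_min_image t (fun x => Q' x i) hne
      exact ⟨Q' x i, (hbox x hxt).2.1 i, (hy' x hxt i).2, he⟩
    choose p hpQ hpy hpt using hp
    choose q hqQ hqy hqt using hq
    obtain ⟨hf, hc⟩ := hfin p q ⟨hpQ, hqQ, fun i => (hpy i).trans (hqy i)⟩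
    have hsub : (t : Set R) ⊆ N p q ∩ Ioo l z := fun x hxt =>
      ⟨hN.mono (fun i => hpt i x hxt) (fun i => hqt i x hxt) (hmem x hxt), hx x hxt⟩
    have := Set.ncard_le_ncard hsub hf
    rw [Set.ncard_coe_finset] at this
    omega

/-- A definable version of the Baire category theorem. -/
theorem baire (hA : TameAction G R Op Q) {s : ℕ} : ∀ {r : ℕ} {H : Subgroup G}, Op H →
    ∀ {N : (Fin r → R) → (Fin r → R) → Set (Fin s → R)}, BoxFamily H N →
    ∀ {U : Set (Fin s → R)}, IsOpen U → U.Nonempty →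
    (∀ p q, RatBox Q p q → interior (N p q) ∩ U = ∅) →
    ∃ U' ⊆ U, IsOpen U' ∧ U'.Nonempty ∧ ∀ x ∈ U', ∀ p q, RatBox Q p q → x ∉ N p q := by
  induction s with
  | zero =>
    intro r H hH N hN U hU hne hemp
    refine ⟨U, subset_rfl, hU, hne, fun x hx p q hpq hxN => ?_⟩
    have : N p q = univ := Set.eq_univ_of_forall fun y => by rwa [Subsingleton.elim y x]
    have h2 := hemp p q hpq
    rw [this, interior_univ, univ_inter] at h2
    rw [h2] at hne
    exact not_nonempty_empty hne
  | succ s ih =>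
    intro r H hH N hN U hU hne hemp
    -- If no open subset of `U` avoids the family, its union is dense in `U`. Two applications of
    -- the induction hypothesis then clash: above every point of some open `W1` there are more than
    -- `B` points of the union, whereas above a suitable rational point of `W1` there are at most
    -- `B`.
    by_contra hcon
    have hdense : ∀ U' ⊆ U, IsOpen U' → U'.Nonempty → ∃ x ∈ U', ∃ p q, RatBox Q p q ∧ x ∈ N p q := by
      intro U' h1 h2 h3
      by_contra hno
      push Not at hno
      exact hcon ⟨U', h1, h2, h3, hno⟩
    obtain ⟨x0, hx0⟩ := hne
    obtain ⟨p0, q0, hp0, hq0, hpq0, hs0⟩ := hA.exists_box hU hx0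
    set l := p0 0
    set z := q0 0
    set W : Set (Fin s → R) := Set.pi univ fun i => Ioo (p0 i.succ) (q0 i.succ) with hW
    have hWo : IsOpen W := isOpen_set_pi finite_univ fun i _ => isOpen_Ioo
    have hWne : W.Nonempty := by
      choose y hy using fun i : Fin s => hA.dense (hpq0 i.succ)
      exact ⟨y, fun i _ => (hy i).2⟩
    have hWU : ∀ x ∈ Ioo l z, ∀ w ∈ W, (Fin.cons x w : Fin (s + 1) → R) ∈ U := by
      intro x hx w hw
      apply hs0
      constructor <;> intro i <;> refine Fin.cases ?_ (fun j => ?_) i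
      · exact hx.1.le
      · exact (hw j (mem_univ _)).1.le
      · exact hx.2.le
      · exact (hw j (mem_univ _)).2.le
    set P : (Fin s → R) → Set R := fun w =>
      {x | x ∈ Ioo l z ∧ ∃ p q, RatBox Q p q ∧ (Fin.cons x w : Fin (s + 1) → R) ∈ N p q} with hP
    set K := H ⊓ stabilizer G l ⊓ stabilizer G z with hKdef
    have hK : Op K := hA.inf (hA.inf hH (hA.stab (hp0 0))) (hA.stab (hq0 0))
    have hKl : ∀ k ∈ K, k ∈ H ∧ k • l = l ∧ k • z = z := fun k hk => ⟨hk.1.1, hk.1.2, hk.2⟩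
    obtain ⟨B, hB⟩ := hA.card_bound hK (ι := Fin s) P (by
      rintro k hk w x ⟨hx, p, q, hpq, hxN⟩
      obtain ⟨hkH, hkl, hkz⟩ := hKl k hk
      refine ⟨hA.smul_mem_Ioo hkl hkz hx, k • p, k • q, hA.RatBox_smul hpq k, ?_⟩
      rw [← fin_cons_smul]
      exact hN.equivariant k hkH _ _ _ hxN)
    -- many points above every tuple of a smaller open set
    have many : ∀ n : ℕ, ∀ l' : R, l ≤ l' → l' < z → ∀ W0 ⊆ W, IsOpen W0 → W0.Nonempty →
        ∃ W' ⊆ W0, IsOpen W' ∧ W'.Nonempty ∧ ∀ w ∈ W', ∃ t : Finset R, t.card = n ∧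
          ∀ x ∈ t, l' < x ∧ x ∈ P w := by
      intro n
      induction n with
      | zero => exact fun l' _ _ W0 _ h2 h3 => ⟨W0, subset_rfl, h2, h3, fun w _ => ⟨∅, by simp⟩⟩
      | succ n ihn =>
        intro l' hl' hlz W0 hW0 hW0o hW0ne
        obtain ⟨c, hc, hlc, hcz⟩ := hA.dense hlz
        obtain ⟨b, hb, hlb, hbc⟩ := hA.dense hlc
        obtain ⟨a, ha, hla, hab⟩ := hA.dense hlb
        -- The projection of the part of `N p q` with first coordinate in `[a, b]`; it is closed
        -- because `R` is compact.
        set M : (Fin r → R) → (Fin r → R) → Set (Fin s → R) := fun p q =>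
          {w | ∃ x ∈ Icc a b, (Fin.cons x w : Fin (s + 1) → R) ∈ N p q} with hM
        have hK' : Op (H ⊓ stabilizer G a ⊓ stabilizer G b) :=
          hA.inf (hA.inf hH (hA.stab ha)) (hA.stab hb)
        have hMf : BoxFamily (H ⊓ stabilizer G a ⊓ stabilizer G b) M := by
          refine ⟨?_, ?_, ?_⟩
          · rintro k hk p q w ⟨x, hx, hxN⟩
            refine ⟨k • x, hA.smul_mem_Icc hk.1.2 hk.2 hx, ?_⟩
            rw [← fin_cons_smul]
            exact hN.equivariant k hk.1.1 _ _ _ hxN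
          · rintro p q p' q' h1 h2 w ⟨x, hx, hxN⟩
            exact ⟨x, hx, hN.mono h1 h2 hxN⟩
          · intro p q
            have hcl : IsClosed {y : R × (Fin s → R) | y.1 ∈ Icc a b ∧
                (Fin.cons y.1 y.2 : Fin (s + 1) → R) ∈ N p q} :=
              (isClosed_Icc.preimage continuous_fst).inter
                ((hN.closed p q).preimage (by fun_prop))
            convert isClosedMap_snd_of_compactSpace _ hcl using 1
            ext w
            simp [hM]
        -- If all these projections had empty interior in `W0`, the induction hypothesis would give
        -- an open set of tuples above which `[a, b]` misses the union, against density.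
        obtain ⟨p, q, hpq, hpne⟩ : ∃ p q, RatBox Q p q ∧ (interior (M p q) ∩ W0).Nonempty := by
          by_contra hno
          push Not at hno
          obtain ⟨W', hW', hW'o, ⟨w', hw'⟩, hW'N⟩ := ih hK' hMf hW0o hW0ne hno
          obtain ⟨m, -, ham, hmb⟩ := hA.dense hab
          obtain ⟨x, hx, p, q, hpq, hxN⟩ := hdense
            {x | x 0 ∈ Ioo a b ∧ Fin.tail x ∈ W'} (by
              rintro x ⟨h1, h2⟩
              rw [← Fin.cons_self_tail x]
              exact hWU _ ⟨(hl'.trans_lt hla).trans h1.1, h1.2.trans (hbc.trans hcz)⟩ _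
                (hW0 (hW' h2)))
            ((isOpen_Ioo.preimage (continuous_apply 0)).inter
              (hW'o.preimage (by unfold Fin.tail; fun_prop)))
            ⟨Fin.cons m w', by simpa using ⟨ham, hmb⟩, by simpa using hw'⟩
          refine hW'N _ hx.2 p q hpq ⟨x 0, Ioo_subset_Icc_self hx.1, ?_⟩
          rwa [Fin.cons_self_tail]
        -- The other `n` points are sought beyond `c > b`, so that the point found in `[a, b]` is
        -- new.
        obtain ⟨W', hW', hW'o, hW'ne, hW't⟩ := ihn c (hl'.trans hlc.le) hcz (interior (M p q) ∩ W0)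
          (inter_subset_right.trans hW0) (isOpen_interior.inter hW0o) hpne
        refine ⟨W', hW'.trans inter_subset_right, hW'o, hW'ne, fun w hw => ?_⟩
        obtain ⟨t, htc, ht⟩ := hW't w hw
        obtain ⟨x, hx, hxN⟩ := interior_subset (hW' hw).1
        have hxt : x ∉ t := fun hxt => absurd ((ht x hxt).1) (not_lt.2 (hx.2.trans hbc.le))
        refine ⟨insert x t, by rw [Finset.card_insert_of_notMem hxt, htc], ?_⟩
        intro y hy
        rcases Finset.mem_insert.1 hy with rfl | hy
        · exact ⟨hla.trans_le hx.1, ⟨(hl'.trans_lt hla).trans_le hx.1,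
            hx.2.trans_lt (hbc.trans hcz)⟩, p, q, hpq, hxN⟩
        · exact ⟨hlc.trans (ht y hy).1, (ht y hy).2⟩
    obtain ⟨W1, hW1, hW1o, hW1ne, hW1t⟩ := many (B + 1) l le_rfl (hpq0 0) W subset_rfl hWo hWne
    -- avoid tuples above which some member contains an interval
    set M : (Fin (r + 1) → R) → (Fin (r + 1) → R) → Set (Fin s → R) := fun p q =>
      {w | (l ≤ p 0 ∧ q 0 ≤ z) ∧ ∀ x ∈ Icc (p 0) (q 0),
        (Fin.cons x w : Fin (s + 1) → R) ∈ N (Fin.tail p) (Fin.tail q)} with hM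
    have hMf : BoxFamily K M := by
      refine ⟨?_, ?_, ?_⟩
      · rintro k hk p q w ⟨⟨h1, h2⟩, h3⟩
        obtain ⟨hkH, hkl, hkz⟩ := hKl k hk
        refine ⟨⟨?_, ?_⟩, ?_⟩
        · rw [← hkl]; exact (hA.smul_le_iff k).2 h1
        · rw [← hkz]; exact (hA.smul_le_iff k).2 h2
        · intro x hx
          have := h3 (k⁻¹ • x) ⟨by rw [← hA.smul_le_iff k, smul_inv_smul]; exact hx.1,
            by rw [← hA.smul_le_iff k, smul_inv_smul]; exact hx.2⟩
          have := hN.equivariant k hkH _ _ _ this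
          rwa [fin_cons_smul, smul_inv_smul] at this
      · rintro p q p' q' h1 h2 w ⟨⟨h3, h4⟩, h5⟩
        exact ⟨⟨h3.trans (h1 0), (h2 0).trans h4⟩, fun x hx =>
          hN.mono (fun i => h1 i.succ) (fun i => h2 i.succ)
            (h5 x ⟨(h1 0).trans hx.1, hx.2.trans (h2 0)⟩)⟩
      · intro p q
        refine isClosed_const.inter ?_
        have : {w : Fin s → R | ∀ x ∈ Icc (p 0) (q 0),
            (Fin.cons x w : Fin (s + 1) → R) ∈ N (Fin.tail p) (Fin.tail q)} = ⋂ x,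
            ⋂ (_ : x ∈ Icc (p 0) (q 0)),
            {w | (Fin.cons x w : Fin (s + 1) → R) ∈ N (Fin.tail p) (Fin.tail q)} := by
          ext w
          simp only [mem_ofPred_eq, mem_iInter]
        change IsClosed {w : Fin s → R | ∀ x ∈ Icc (p 0) (q 0),
            (Fin.cons x w : Fin (s + 1) → R) ∈ N (Fin.tail p) (Fin.tail q)}
        rw [this]
        exact isClosed_iInter fun x => isClosed_iInter fun _ =>
          (hN.closed _ _).preimage (f := fun w => (Fin.cons x w : Fin (s + 1) → R)) (by fun_prop)
    -- If a member of this family had interior, some member of `N` would contain an interval times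
    -- an open set.
    obtain ⟨W2, hW2, hW2o, hW2ne, hW2N⟩ := ih hK hMf hW1o hW1ne (by
      intro p q hpq
      by_contra hne
      obtain ⟨w, hw1, hw2⟩ := Set.nonempty_iff_ne_empty.2 hne
      have hwM := interior_subset hw1
      obtain ⟨m, -, hpm, hmq⟩ := hA.dense (hpq.2.2 0)
      have hcons : (Fin.cons m w : Fin (s + 1) → R) ∈
          interior (N (Fin.tail p) (Fin.tail q)) ∩ U := by
        refine ⟨?_, hWU _ ⟨hwM.1.1.trans_lt hpm, hmq.trans_le hwM.1.2⟩ _ (hW1 hw2)⟩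
        rw [mem_interior]
        refine ⟨{x | x 0 ∈ Ioo (p 0) (q 0) ∧ Fin.tail x ∈ interior (M p q)}, ?_,
          (isOpen_Ioo.preimage (continuous_apply 0)).inter
            (isOpen_interior.preimage (by unfold Fin.tail; fun_prop)), ?_⟩
        · rintro x ⟨h1, h2⟩
          rw [← Fin.cons_self_tail x]
          exact (interior_subset h2).2 _ (Ioo_subset_Icc_self h1)
        · exact ⟨by simpa using ⟨hpm, hmq⟩, by simpa using hw1⟩
      rw [hemp _ _ hpq.tail] at hcons
      exact hcons)
    obtain ⟨w, hw, hwQ⟩ := hA.exists_rat hW2o hW2ne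
    obtain ⟨K2, hK2, hK2H, hK2w⟩ := hA.stab_finite hH w hwQ
    have hfin : (P w).Finite := by
      refine hA.finite_union_of_boxFamily (N := fun p q => {x | (Fin.cons x w : Fin (s + 1) → R) ∈ N p q})
        hK2 ⟨?_, ?_, ?_⟩ (hp0 0) (hq0 0) ?_
      · intro k hk p q x hx
        have := hN.equivariant k (hK2H hk) _ _ _ hx
        rwa [fin_cons_smul, hK2w k hk] at this
      · exact fun h1 h2 x hx => hN.mono h1 h2 hx
      · exact fun p q => (hN.closed p q).preimage (f := fun x => (Fin.cons x w : Fin (s + 1) → R))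
          (by fun_prop)
      · intro p q hpq
        by_contra hne
        obtain ⟨a, ha, b, hb, hab, hs⟩ := hA.exists_Icc (isOpen_interior.inter isOpen_Ioo)
          (Set.nonempty_iff_ne_empty.2 hne)
        refine hW2N w hw _ _ (hpq.cons ha hb hab) ⟨⟨?_, ?_⟩, ?_⟩
        · exact (hs ⟨le_rfl, hab.le⟩).2.1.le
        · exact (hs ⟨hab.le, le_rfl⟩).2.2.le
        · intro x hx
          have : x ∈ {x | (Fin.cons x w : Fin (s + 1) → R) ∈ N p q} := interior_subset (hs hx).1
          simpa using this
    obtain ⟨t, htc, ht⟩ := hW1t w (hW2 hw)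
    have h1 := hB w hwQ hfin
    have h2 := Set.ncard_le_ncard (fun x hx => (ht x hx).2 : (t : Set R) ⊆ P w) hfin
    rw [Set.ncard_coe_finset] at h2
    omega

end TameAction
end TameBaire

/-! ### Closed invariant sets without interior are locally graphs -/

section TameGraph

open MulAction Topology

variable {G R : Type*} [Group G] [CompleteLinearOrder R] [TopologicalSpace R]
    [OrderTopology R] [DenselyOrdered R] [Nontrivial R] [MulAction G R] {Op : Subgroup G → Prop}
    {Q : Set R}

/-- Over the open set `W`, the closed set `Γ` has exactly one point in the open set `O`, and it has
no other points in the closed set `C` containing `O`. -/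
structure IsGraphBox {X R : Type*} [TopologicalSpace X] [TopologicalSpace R] (Γ : Set (X × R))
    (W : Set X) (O C : Set R) : Prop where
  isOpen_base : IsOpen W
  isOpen_fibre : IsOpen O
  isClosed : IsClosed C
  subset : O ⊆ C
  mem : ∀ x ∈ W, ∀ y ∈ C, (x, y) ∈ Γ → y ∈ O
  existsUnique : ∀ x ∈ W, ∃ y ∈ O, (x, y) ∈ Γ ∧ ∀ y' ∈ O, (x, y') ∈ Γ → y' = y

theorem isClosed_proj {X R : Type*} [TopologicalSpace X] [TopologicalSpace R] [CompactSpace R]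
    {Γ : Set (X × R)} (hΓ : IsClosed Γ) {C : Set R} (hC : IsClosed C) :
    IsClosed {x | ∃ y ∈ C, (x, y) ∈ Γ} := by
  convert isClosedMap_fst_of_compactSpace _ ((hC.preimage continuous_snd).inter hΓ) using 1
  ext x
  simp

/-- The points of `W` at which `F` leaves a neighbourhood `V'` of `F x` lie in the projection of the
part of `Γ` over `C \ V'`. This projection is closed since `R` is compact, and it misses `x` since
`Γ` has only one point above `x` in `C`. -/
theorem IsGraphBox.continuousOn {X R : Type*} [TopologicalSpace X] [TopologicalSpace R]
    [CompactSpace R] {Γ : Set (X × R)} (hΓ : IsClosed Γ) {W : Set X} {O C : Set R}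
    (h : IsGraphBox Γ W O C) {F : X → R} (hF : ∀ x ∈ W, F x ∈ O ∧ (x, F x) ∈ Γ) :
    ContinuousOn F W := by
  intro x hx V hV
  obtain ⟨V', hV', hV'o, hxV'⟩ := mem_nhds_iff.1 hV
  have hcl := isClosed_proj hΓ (h.isClosed.inter hV'o.isClosed_compl)
  have hxA : x ∈ {x | ∃ y ∈ C ∩ V'ᶜ, (x, y) ∈ Γ}ᶜ := by
    rintro ⟨y, ⟨hyC, hyV⟩, hy⟩
    obtain ⟨y0, -, -, hu⟩ := h.existsUnique x hx
    have e1 := hu y (h.mem x hx y hyC hy) hy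
    have e2 := hu _ (hF x hx).1 (hF x hx).2
    exact hyV (by rw [e1, ← e2]; exact hxV')
  refine mem_nhdsWithin.2 ⟨_, hcl.isOpen_compl, hxA, ?_⟩
  rintro x' ⟨hx'A, hx'W⟩
  by_contra hcon
  exact hx'A ⟨F x', ⟨h.subset (hF x' hx'W).1, fun hh => hcon (hV' hh)⟩, (hF x' hx'W).2⟩

namespace TameAction

/-- Induction on a bound for the number of points in the rational fibres inside `C`. Consider the
base points having two fibre points separated by rational `p < q`. If for no `p`, `q` they have
interior in `W`, the Baire theorem avoids them all and leaves one point in each fibre. Otherwise,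
over a smaller base, some level `m` between `p` and `q` avoids `Γ`, and the part of the fibres below
`m` has fewer points. -/
theorem exists_isGraphBox_of_count (hA : TameAction G R Op Q) {s : ℕ} {H : Subgroup G}
    {Γ : Set ((Fin s → R) × R)} (hΓ : IsClosed Γ) (hinv : ∀ h ∈ H, ∀ z ∈ Γ, h • z ∈ Γ)
    {U : Set (Fin s → R)}
    (hfin : ∀ x ∈ U, (∀ i, x i ∈ Q) → {y | (x, y) ∈ Γ}.Finite) (k : ℕ) :
    ∀ {W : Set (Fin s → R)} {O C : Set R} {K : Subgroup G}, Op K → K ≤ H →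
      (∀ g ∈ K, ∀ y ∈ O, g • y ∈ O) → (∀ g ∈ K, ∀ y ∈ C, g • y ∈ C) →
      IsOpen W → W.Nonempty → W ⊆ U → IsOpen O → IsClosed C → O ⊆ C →
      (∀ x ∈ W, ∀ y ∈ C, (x, y) ∈ Γ → y ∈ O) → (∀ x ∈ W, ∃ y ∈ C, (x, y) ∈ Γ) →
      (∀ x ∈ W, (∀ i, x i ∈ Q) → {y | y ∈ C ∧ (x, y) ∈ Γ}.ncard < k) →
      ∃ (W' : Set (Fin s → R)) (O' C' : Set R) (K' : Subgroup G), W' ⊆ U ∧ W'.Nonempty ∧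
        IsGraphBox Γ W' O' C' ∧ Op K' ∧ K' ≤ H ∧ ∀ g ∈ K', ∀ y ∈ O', g • y ∈ O' := by
  induction k with
  | zero =>
    intro W O C K _ _ _ _ hW hWne _ _ _ _ _ _ hc
    obtain ⟨x, hx, hxQ⟩ := hA.exists_rat hW hWne
    exact absurd (hc x hx hxQ) (by omega)
  | succ k ih =>
    intro W O C K hK hKH hKO hKC hW hWne hWU hO hC hOC hmem hex hc
    set J : (Fin 1 → R) → (Fin 1 → R) → Set (Fin s → R) := fun p q =>
      {x | ∃ y ∈ C ∩ Iic (p 0), (x, y) ∈ Γ} ∩ {x | ∃ y ∈ C ∩ Ici (q 0), (x, y) ∈ Γ} with hJ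
    have hJf : BoxFamily K J := by
      refine ⟨?_, ?_, ?_⟩
      · rintro g hg p q x ⟨⟨y, ⟨h1, h2⟩, h3⟩, ⟨y', ⟨h4, h5⟩, h6⟩⟩
        exact ⟨⟨g • y, ⟨hKC g hg y h1, (hA.smul_le_iff g).2 h2⟩, hinv g (hKH hg) _ h3⟩,
          ⟨g • y', ⟨hKC g hg y' h4, (hA.smul_le_iff g).2 h5⟩, hinv g (hKH hg) _ h6⟩⟩
      · rintro p q p' q' h1 h2 x ⟨⟨y, ⟨h3, h4⟩, h5⟩, ⟨y', ⟨h6, h7⟩, h8⟩⟩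
        exact ⟨⟨y, ⟨h3, h4.trans (h1 0)⟩, h5⟩, ⟨y', ⟨h6, (h2 0).trans h7⟩, h8⟩⟩
      · exact fun p q => (isClosed_proj hΓ (hC.inter isClosed_Iic)).inter
          (isClosed_proj hΓ (hC.inter isClosed_Ici))
    by_cases hcase : ∀ p q, RatBox Q p q → interior (J p q) ∩ W = ∅
    · obtain ⟨W', hW'W, hW'o, hW'ne, hW'⟩ := hA.baire hK hJf hW hWne hcase
      refine ⟨W', O, C, K, hW'W.trans hWU, hW'ne, ⟨hW'o, hO, hC, hOC,
        fun x hx => hmem x (hW'W hx), fun x hx => ?_⟩, hK, hKH, hKO⟩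
      obtain ⟨y, hyC, hy⟩ := hex x (hW'W hx)
      have huniq : ∀ y y', y ∈ C → y' ∈ C → (x, y) ∈ Γ → (x, y') ∈ Γ → ¬ y < y' := by
        intro y y' h1 h2 h3 h4 hlt
        obtain ⟨q, hq, h5, h6⟩ := hA.dense hlt
        obtain ⟨p, hp, h7, h8⟩ := hA.dense h5
        exact hW' x hx (fun _ => p) (fun _ => q) ⟨fun _ => hp, fun _ => hq, fun _ => h8⟩
          ⟨⟨y, ⟨h1, h7.le⟩, h3⟩, ⟨y', ⟨h2, h6.le⟩, h4⟩⟩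
      refine ⟨y, hmem x (hW'W hx) y hyC hy, hy, fun y' hy'O hy' => ?_⟩
      rcases lt_trichotomy y' y with h | h | h
      · exact absurd h (huniq _ _ (hOC hy'O) hyC hy' hy)
      · exact h
      · exact absurd h (huniq _ _ hyC (hOC hy'O) hy hy')
    · push Not at hcase
      obtain ⟨p, q, hpq, hne⟩ := hcase
      obtain ⟨x, hx, hxQ⟩ := hA.exists_rat (isOpen_interior.inter hW) hne
      have hxf := hfin x (hWU hx.2) hxQ
      have hne2 : (Ioo (p 0) (q 0) \ {y | (x, y) ∈ Γ}).Nonempty :=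
        ((Ioo_infinite (hpq.2.2 0)).sdiff hxf).nonempty
      obtain ⟨m, hm, m', -, hmm', hms⟩ := hA.exists_Icc (isOpen_Ioo.sdiff hxf.isClosed) hne2
      have hmm := hms ⟨le_rfl, hmm'.le⟩
      have hopen : IsOpen {x : Fin s → R | (x, m) ∉ Γ} :=
        (hΓ.preimage (f := fun x : Fin s → R => (x, m)) (by fun_prop)).isOpen_compl
      have hW2 : (interior (J p q) ∩ W ∩ {x : Fin s → R | (x, m) ∉ Γ}).Nonempty :=
        ⟨x, ⟨hx, hmm.2⟩⟩
      refine ih (W := interior (J p q) ∩ W ∩ {x | (x, m) ∉ Γ}) (O := O ∩ Iio m) (C := C ∩ Iic m)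
        (K := K ⊓ stabilizer G m) (hA.inf hK (hA.stab hm)) (inf_le_left.trans hKH) ?_ ?_
        ((isOpen_interior.inter hW).inter hopen)
        hW2
        (fun x hx => hWU hx.1.2) (hO.inter isOpen_Iio) (hC.inter isClosed_Iic)
        (fun y hy => ⟨hOC hy.1, le_of_lt (mem_Iio.1 hy.2)⟩) ?_ ?_ ?_
      · rintro g ⟨hg, hgm⟩ y ⟨h1, h2⟩
        refine ⟨hKO g hg y h1, ?_⟩
        have := hA.smul_lt g h2
        rwa [show g • m = m from hgm] at this
      · rintro g ⟨hg, hgm⟩ y ⟨h1, h2⟩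
        refine ⟨hKC g hg y h1, ?_⟩
        have := (hA.smul_le_iff g).2 h2
        rwa [show g • m = m from hgm] at this
      · rintro x' ⟨⟨-, hx'W⟩, hx'm⟩ y ⟨hyC, hym⟩ hy
        refine ⟨hmem x' hx'W y hyC hy, lt_of_le_of_ne hym ?_⟩
        rintro rfl
        exact hx'm hy
      · rintro x' ⟨⟨hx'J, -⟩, -⟩
        obtain ⟨⟨y, ⟨h1, h2⟩, h3⟩, -⟩ := interior_subset hx'J
        exact ⟨y, ⟨h1, h2.trans hmm.1.1.le⟩, h3⟩
      · rintro x' ⟨⟨hx'J, hx'W⟩, -⟩ hx'Q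
        obtain ⟨-, ⟨y, ⟨h1, h2⟩, h3⟩⟩ := interior_subset hx'J
        have hf : {y | y ∈ C ∧ (x', y) ∈ Γ}.Finite := (hfin x' (hWU hx'W) hx'Q).subset fun y hy => hy.2
        have hlt : {y | y ∈ C ∩ Iic m ∧ (x', y) ∈ Γ}.ncard < {y | y ∈ C ∧ (x', y) ∈ Γ}.ncard := by
          refine Set.ncard_lt_ncard ?_ hf
          have hsub : {y | y ∈ C ∩ Iic m ∧ (x', y) ∈ Γ} ⊆ {y | y ∈ C ∧ (x', y) ∈ Γ} :=
            fun y hy => ⟨hy.1.1, hy.2⟩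
          refine (Set.ssubset_iff_of_subset hsub).2 ⟨y, ⟨h1, h3⟩, ?_⟩
          rintro ⟨⟨-, h4⟩, -⟩
          exact absurd (h4.trans_lt (hmm.1.2)) (not_lt.2 h2)
        have := hc x' hx'W hx'Q
        omega

/-- A closed invariant set with empty interior is, somewhere over every open subset of its
projection, the graph of a function. -/
theorem exists_isGraphBox (hA : TameAction G R Op Q) {s : ℕ} {H : Subgroup G} (hH : Op H)
    {Γ : Set ((Fin s → R) × R)} (hΓ : IsClosed Γ) (hinv : ∀ h ∈ H, ∀ z ∈ Γ, h • z ∈ Γ)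
    (hemp : interior Γ = ∅) {U : Set (Fin s → R)} (hU : IsOpen U) (hUne : U.Nonempty)
    (hproj : ∀ x ∈ U, ∃ y, (x, y) ∈ Γ) :
    ∃ (W : Set (Fin s → R)) (O C : Set R) (K : Subgroup G), W ⊆ U ∧ W.Nonempty ∧
        IsGraphBox Γ W O C ∧ Op K ∧ K ≤ H ∧ ∀ g ∈ K, ∀ y ∈ O, g • y ∈ O := by
  set N : (Fin 1 → R) → (Fin 1 → R) → Set (Fin s → R) := fun p q =>
    {x | ∀ y ∈ Icc (p 0) (q 0), (x, y) ∈ Γ} with hN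
  have hNf : BoxFamily H N := by
    refine ⟨?_, ?_, ?_⟩
    · intro g hg p q x hx y hy
      have := hinv g hg _ (hx (g⁻¹ • y) ⟨by rw [← hA.smul_le_iff g, smul_inv_smul]; exact hy.1,
            by rw [← hA.smul_le_iff g, smul_inv_smul]; exact hy.2⟩)
      rwa [Prod.smul_mk, smul_inv_smul] at this
    · exact fun h1 h2 x hx y hy => hx y ⟨(h1 0).trans hy.1, hy.2.trans (h2 0)⟩
    · intro p q
      have : N p q = ⋂ y, ⋂ (_ : y ∈ Icc (p 0) (q 0)), {x | (x, y) ∈ Γ} := by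
        ext x
        simp only [hN, mem_ofPred_eq, mem_iInter]
      rw [this]
      exact isClosed_iInter fun y => isClosed_iInter fun _ =>
        hΓ.preimage (f := fun x : Fin s → R => (x, y)) (by fun_prop)
  -- Since `Γ` has empty interior, the Baire theorem gives an open set of base points whose fibres
  -- contain no interval. Over rational points these fibres are then finite, of bounded size.
  obtain ⟨U1, hU1U, hU1o, hU1ne, hU1⟩ := hA.baire hH hNf hU hUne (by
    intro p q hpq
    by_contra hne
    obtain ⟨x, hx, -⟩ := Set.nonempty_iff_ne_empty.2 hne
    obtain ⟨m, -, h1, h2⟩ := hA.dense (hpq.2.2 0)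
    have : (x, m) ∈ interior Γ := mem_interior.2 ⟨interior (N p q) ×ˢ Ioo (p 0) (q 0), fun z hz =>
      interior_subset hz.1 _ (Ioo_subset_Icc_self hz.2), isOpen_interior.prod isOpen_Ioo,
      hx, h1, h2⟩
    rw [hemp] at this
    exact this)
  have hfin : ∀ x ∈ U1, (∀ i, x i ∈ Q) → {y | (x, y) ∈ Γ}.Finite := by
    intro x hx hxQ
    obtain ⟨K, hK, hKH, hKx⟩ := hA.stab_finite hH x hxQ
    have := hA.finite_of_closed (U := univ) hK (hΓ.preimage (f := fun y => (x, y)) (by fun_prop)) ?_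
      (fun _ _ _ _ => mem_univ _) ?_
    · rwa [inter_univ] at this
    · intro k hk y hy
      have := hinv k (hKH hk) _ hy
      rwa [Prod.smul_mk, hKx k hk] at this
    · rw [inter_univ]
      by_contra hne
      obtain ⟨p, hp, q, hq, hpq, hs⟩ := hA.exists_Icc isOpen_interior
        (Set.nonempty_iff_ne_empty.2 hne)
      exact hU1 x hx (fun _ => p) (fun _ => q) ⟨fun _ => hp, fun _ => hq, fun _ => hpq⟩
        fun y hy => by
          have : y ∈ (fun y => (x, y)) ⁻¹' Γ := interior_subset (hs hy)
          exact this
  obtain ⟨B, hB⟩ := hA.card_bound hH (ι := Fin s) (fun x : Fin s → R => {y | (x, y) ∈ Γ})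
    (fun h hh x y hy => hinv h hh _ hy)
  obtain ⟨W, O, C, K, h1, h2⟩ := hA.exists_isGraphBox_of_count hΓ hinv hfin (B + 1)
    (W := U1) (O := univ) (C := univ)
    hH le_rfl (fun _ _ _ _ => mem_univ _) (fun _ _ _ _ => mem_univ _) hU1o hU1ne subset_rfl
    isOpen_univ isClosed_univ subset_rfl (fun _ _ _ _ _ => mem_univ _)
    (fun x hx => by simpa using hproj x (hU1U hx)) (by
      intro x hx hxQ
      have := hB x hxQ (hfin x hx hxQ)
      simp only [mem_univ, true_and]
      omega)
  exact ⟨W, O, C, K, h1.trans hU1U, h2⟩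

end TameAction
end TameGraph

/-! ### One-sided monotonicity of continuous equivariant functions -/

section TameGerm

open MulAction Topology

variable {G R : Type*} [Group G] [CompleteLinearOrder R] [TopologicalSpace R]
    [OrderTopology R] [DenselyOrdered R] [Nontrivial R] [MulAction G R] {Op : Subgroup G → Prop}
    {Q : Set R}

namespace TameAction

/-- A function without flat intervals has finitely many local maxima. -/
theorem finite_isLocalMax (hA : TameAction G R Op Q) {Y : Type*} [LinearOrder Y]
    [TopologicalSpace Y] [OrderClosedTopology Y] [MulAction G Y]
    (hY : ∀ (g : G) {y y' : Y}, y ≤ y' → g • y ≤ g • y') {K : Subgroup G} (hK : Op K)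
    {x b : R} {f : R → Y} (hf : ContinuousOn f (Ioo x b))
    (hx : ∀ k ∈ K, k • x = x) (hb : ∀ k ∈ K, k • b = b)
    (hcomm : ∀ k ∈ K, ∀ t ∈ Ioo x b, f (k • t) = k • f t)
    (hflat : ∀ V ⊆ Ioo x b, IsOpen V → V.Nonempty → ∃ t ∈ V, ∃ t' ∈ V, f t ≠ f t') :
    {t ∈ Ioo x b | IsLocalMax f t}.Finite := by
  -- Requiring the maximum on an interval strictly larger than `[y 0, y 1]` makes the condition open
  -- in `y`, so that `finite_of_point_finite` applies.
  set Λ : R → (Fin 2 → R) → Prop := fun t y => y 0 < t ∧ t < y 1 ∧ ∃ l z, l < y 0 ∧ y 1 < z ∧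
    Icc l z ⊆ Ioo x b ∧ ∀ u ∈ Icc l z, f u ≤ f t with hΛ
  have hIcc : ∀ {l z : R} (k : G), ∀ u ∈ Icc (k • l) (k • z), k⁻¹ • u ∈ Icc l z := by
    intro l z k u hu
    constructor
    · rw [← hA.smul_le_iff k, smul_inv_smul]; exact hu.1
    · rw [← hA.smul_le_iff k, smul_inv_smul]; exact hu.2
  have hinv : ∀ k ∈ K, ∀ t y, Λ t y → Λ (k • t) (k • y) := by
    rintro k hk t y ⟨h1, h2, l, z, h3, h4, h5, h6⟩
    refine ⟨hA.smul_lt k h1, hA.smul_lt k h2, k • l, k • z, hA.smul_lt k h3, hA.smul_lt k h4, ?_, ?_⟩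
    · intro u hu
      have := hA.smul_mem_Ioo (hx k hk) (hb k hk) (h5 (hIcc k u hu))
      rwa [smul_inv_smul] at this
    · intro u hu
      have h7 := hIcc k u hu
      have := hY k (h6 _ h7)
      rw [← hcomm k hk _ (h5 h7), smul_inv_smul] at this
      rwa [hcomm k hk _ (h5 ⟨(h3.trans h1).le, (h2.trans h4).le⟩)]
  have hopen : ∀ t, IsOpen {y | Λ t y} := by
    intro t
    have : {y | Λ t y} = ⋃ (l : R) (z : R) (_ : Icc l z ⊆ Ioo x b ∧ ∀ u ∈ Icc l z, f u ≤ f t),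
        {y : Fin 2 → R | y 0 ∈ Ioo l t ∧ y 1 ∈ Ioo t z} := by
      ext y
      simp only [hΛ, mem_ofPred_eq, mem_iUnion, mem_Ioo, exists_prop]
      constructor
      · rintro ⟨h1, h2, l, z, h3, h4, h5⟩
        exact ⟨l, z, h5, ⟨h3, h1⟩, h2, h4⟩
      · rintro ⟨l, z, h5, ⟨h3, h1⟩, h2, h4⟩
        exact ⟨h1, h2, l, z, h3, h4, h5⟩
    rw [this]
    exact isOpen_iUnion fun l => isOpen_iUnion fun z => isOpen_iUnion fun _ =>
      (isOpen_Ioo.preimage (continuous_apply 0)).inter (isOpen_Ioo.preimage (continuous_apply 1))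
  refine (hA.finite_of_point_finite hK Λ hinv hopen ?_).subset ?_
  · -- infinitely many maxima in one interval give a flat interval
    intro y hyQ
    by_contra hinf
    obtain ⟨t0, h1, h2, l0, z0, h3, h4, h5, h6⟩ := Set.Infinite.nonempty hinf
    obtain ⟨K1, hK1, hK1K, hK1y⟩ := hA.stab_finite hK y hyQ
    set E : Set R := {t ∈ Ioo (y 0) (y 1) | ∀ u ∈ Icc (y 0) (y 1), f u ≤ f t} with hE
    have hysub : Icc (y 0) (y 1) ⊆ Ioo x b := (Icc_subset_Icc h3.le h4.le).trans h5
    have hval : ∀ t ∈ E, f t = f t0 := fun t ht =>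
      le_antisymm (h6 t ⟨(h3.trans ht.1.1).le, (ht.1.2.trans h4).le⟩) (ht.2 t0 ⟨h1.le, h2.le⟩)
    have hEinf : E.Infinite := by
      refine Set.Infinite.mono ?_ hinf
      rintro t ⟨h1, h2, l, z, h3, h4, -, h6⟩
      exact ⟨⟨h1, h2⟩, fun u hu => h6 u ⟨h3.le.trans hu.1, hu.2.trans h4.le⟩⟩
    obtain ⟨u0, hu0⟩ := hA.tame hK1 E (by
      rintro k hk t ⟨ht, hmax⟩
      have e0 : k • y 0 = y 0 := congrFun (hK1y k hk) 0
      have e1 : k • y 1 = y 1 := congrFun (hK1y k hk) 1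
      refine ⟨hA.smul_mem_Ioo e0 e1 ht, fun u hu => ?_⟩
      have h7 : k⁻¹ • u ∈ Icc (y 0) (y 1) := hIcc k u (by rwa [e0, e1])
      have := hY k (hmax _ h7)
      rwa [← hcomm k (hK1K hk) _ (hysub h7), smul_inv_smul,
        ← hcomm k (hK1K hk) _ (hysub (Ioo_subset_Icc_self ht))] at this) hEinf
    -- Maxima on the same interval share their value, so `f` is constant on the closure of `E`,
    -- which has interior.
    have hcl : closure E ⊆ {t ∈ Icc (y 0) (y 1) | f t = f t0} := by
      refine closure_minimal (fun t ht => ⟨Ioo_subset_Icc_self ht.1, hval t ht⟩) ?_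
      exact (hf.mono hysub).preimage_isClosed_of_isClosed isClosed_Icc isClosed_singleton
    obtain ⟨t, ht, t', ht', hne⟩ := hflat (interior (closure E))
      (fun t ht => hysub (hcl (interior_subset ht)).1) isOpen_interior ⟨u0, hu0⟩
    exact hne ((hcl (interior_subset ht)).2.trans (hcl (interior_subset ht')).2.symm)
  · rintro t ⟨ht, hmax⟩
    have hnhds : {u | f u ≤ f t} ∩ Ioo x b ∈ 𝓝 t := Filter.inter_mem hmax (Ioo_mem_nhds ht.1 ht.2)
    obtain ⟨l, z, htlz, hsub⟩ := (mem_nhds_iff_exists_Ioo_subset' ⟨x, ht.1⟩ ⟨b, ht.2⟩).1 hnhds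
    obtain ⟨l2, -, hl1, hl2⟩ := hA.dense htlz.1
    obtain ⟨l3, -, hl3, hl4⟩ := hA.dense hl2
    obtain ⟨z2, -, hz1, hz2⟩ := hA.dense htlz.2
    obtain ⟨z3, -, hz3, hz4⟩ := hA.dense hz1
    have hs : Icc l2 z2 ⊆ {u | f u ≤ f t} ∩ Ioo x b := fun u hu =>
      hsub ⟨hl1.trans_le hu.1, hu.2.trans_lt hz2⟩
    refine ⟨![l3, z3], hl4, hz3, l2, z2, hl3, hz4, fun u hu => (hs hu).2, fun u hu => (hs hu).1⟩

theorem exists_rat_disjoint (hA : TameAction G R Op Q) {x b : R} (hxb : x < b) {E : Set R}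
    (hE : E.Finite) : ∃ b' ∈ Q, x < b' ∧ b' < b ∧ Disjoint (Ioc x b') E := by
  have h1 : (E \ {x})ᶜ ∈ 𝓝 x := (hE.subset sdiff_subset).isClosed.isOpen_compl.mem_nhds (by simp)
  obtain ⟨u, hu, hs⟩ := exists_Ico_subset_of_mem_nhds h1 ⟨b, hxb⟩
  obtain ⟨b', hb', h2, h3⟩ := hA.dense (lt_min hu hxb)
  refine ⟨b', hb', h2, h3.trans_le (min_le_right _ _), Set.disjoint_left.2 fun t ht htE => ?_⟩
  exact hs ⟨ht.1.le, ht.2.trans_lt (h3.trans_le (min_le_left _ _))⟩ ⟨htE, ht.1.ne'⟩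

/-- A continuous equivariant function is, to the right of a point, strictly monotone or constant. -/
theorem strictMono_germ (hA : TameAction G R Op Q) {K : Subgroup G} (hK : Op K)
    {x b : R} (hxb : x < b) {f : R → R} (hf : ContinuousOn f (Icc x b))
    (hx : ∀ k ∈ K, k • x = x)
    (hcomm : ∀ k ∈ K, ∀ t ∈ Icc x b, k • t ∈ Icc x b → f (k • t) = k • f t)
    (hflat : ∀ b' ∈ Ioc x b, ∃ t ∈ Icc x b', f t ≠ f x) :
    ∃ b' ∈ Q, x < b' ∧ b' < b ∧ (StrictMonoOn f (Icc x b') ∨ StrictAntiOn f (Icc x b')) := by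
  obtain ⟨b0, hb0, hxb0, hb0b⟩ := hA.dense hxb
  have hsub0 : Icc x b0 ⊆ Icc x b := Icc_subset_Icc le_rfl hb0b.le
  set K0 := K ⊓ stabilizer G b0 with hK0def
  have hK0 : Op K0 := hA.inf hK (hA.stab hb0)
  have hcomm0 : ∀ k ∈ K0, ∀ t ∈ Icc x b0, f (k • t) = k • f t := fun k hk t ht =>
    hcomm k hk.1 t (hsub0 ht) (hsub0 (hA.smul_mem_Icc (hx k hk.1) hk.2 ht))
  set Fl : Set R := {t | ∃ V, IsOpen V ∧ t ∈ V ∧ V ⊆ Ioo x b0 ∧ ∀ u ∈ V, ∀ u' ∈ V, f u = f u'} with hFl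
  have hFlo : IsOpen Fl := isOpen_iff_forall_mem_open.2 fun t ⟨V, h1, h2, h3⟩ =>
    ⟨V, fun u hu => ⟨V, h1, hu, h3⟩, h1, h2⟩
  have := hA.continuousConstSMul
  have hFlinv : ∀ k ∈ K0, ∀ t ∈ Fl, k • t ∈ Fl := by
    rintro k hk t ⟨V, h1, h2, h3, h4⟩
    refine ⟨(fun u => k⁻¹ • u) ⁻¹' V, h1.preimage (continuous_const_smul _), by simpa using h2, ?_, ?_⟩
    · intro u hu
      have := hA.smul_mem_Ioo (hx k hk.1) hk.2 (h3 hu)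
      rwa [smul_inv_smul] at this
    · intro u hu u' hu'
      have e := h4 _ hu _ hu'
      have e1 := hcomm0 k hk _ (Ioo_subset_Icc_self (h3 hu))
      have e2 := hcomm0 k hk _ (Ioo_subset_Icc_self (h3 hu'))
      rw [smul_inv_smul] at e1 e2
      rw [e1, e2, e]
  -- The frontier of an open set has empty interior, so an invariant one is finite. Hence, close
  -- enough to `x`, the function is flat everywhere or nowhere.
  have hfr : (frontier Fl).Finite := by
    by_contra hinf
    have := hA.tame hK0 (frontier Fl) (by
      intro k hk z hz
      have h1 := hA.smul_frontier k Fl hz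
      have h2 : (fun y => k • y) '' Fl = Fl := by
        ext y
        constructor
        · rintro ⟨z, hz, rfl⟩
          exact hFlinv k hk z hz
        · intro hy
          exact ⟨k⁻¹ • y, hFlinv _ (K0.inv_mem hk) y hy, smul_inv_smul _ _⟩
      rwa [h2] at h1) hinf
    rw [isClosed_frontier.closure_eq, ← frontier_compl, interior_frontier hFlo.isClosed_compl] at this
    exact not_nonempty_empty this
  obtain ⟨b1, hb1, hxb1, hb1b, hdisj⟩ := hA.exists_rat_disjoint hxb0 hfr
  have hsub1 : Icc x b1 ⊆ Icc x b0 := Icc_subset_Icc le_rfl hb1b.le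
  have hnoflat : ∀ t ∈ Ioo x b1, t ∉ Fl := by
    intro t ht htF
    have hall : ∀ u ∈ Ioo x b1, u ∈ Fl := fun u hu =>
      (isPreconnected_Ioo.mem_iff_of_disjoint_frontier
        (hdisj.mono_left Ioo_subset_Ioc_self) ht hu).1 htF
    have hconst : ∀ u ∈ Ioo x b1, f u = f t := by
      intro u hu
      have hd : Disjoint (Ioo x b1) (frontier {u | f u = f t}) := by
        rw [Set.disjoint_left]
        intro z hz hzf
        obtain ⟨V, h1, h2, h3, h4⟩ := hall z hz
        obtain ⟨z', hz'V, hz'⟩ := mem_closure_iff.1 hzf.1 V h1 h2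
        apply hzf.2
        exact mem_interior.2 ⟨V, fun w hw => (h4 w hw z' hz'V).trans hz', h1, h2⟩
      exact (isPreconnected_Ioo.mem_iff_of_disjoint_frontier hd ht hu).1 rfl
    have hcl : IsClosed {u ∈ Icc x b1 | f u = f t} :=
      (hf.mono (hsub1.trans hsub0)).preimage_isClosed_of_isClosed isClosed_Icc isClosed_singleton
    have hall2 : Icc x b1 ⊆ {u ∈ Icc x b1 | f u = f t} := by
      rw [← closure_Ioo hxb1.ne]
      refine closure_minimal ?_ ?_
      · rw [closure_Ioo hxb1.ne]
        exact fun u hu => ⟨Ioo_subset_Icc_self hu, hconst u hu⟩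
      · rw [closure_Ioo hxb1.ne]; exact hcl
    obtain ⟨u, hu, hne⟩ := hflat b1 ⟨hxb1, (hb1b.trans hb0b).le⟩
    exact hne ((hall2 hu).2.trans (hall2 ⟨le_rfl, hxb1.le⟩).2.symm)
  have hflat1 : ∀ V ⊆ Ioo x b1, IsOpen V → V.Nonempty → ∃ t ∈ V, ∃ t' ∈ V, f t ≠ f t' := by
    intro V hV hVo ⟨t, ht⟩
    by_contra hcon
    push Not at hcon
    exact hnoflat t (hV ht) ⟨V, hVo, ht, hV.trans (Ioo_subset_Ioo le_rfl hb1b.le), hcon⟩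
  have hK1 : Op (K0 ⊓ stabilizer G b1) := hA.inf hK0 (hA.stab hb1)
  have hcont1 : ContinuousOn f (Ioo x b1) :=
    hf.mono (Ioo_subset_Icc_self.trans (hsub1.trans hsub0))
  have hcomm1 : ∀ k ∈ K0 ⊓ stabilizer G b1, ∀ t ∈ Ioo x b1, f (k • t) = k • f t :=
    fun k hk t ht => hcomm0 k hk.1 t (hsub1 (Ioo_subset_Icc_self ht))
  have hmax := hA.finite_isLocalMax (fun g {_ _} h => (hA.smul_le_iff g).2 h) hK1 hcont1
    (fun k hk => hx k hk.1.1) (fun k hk => hk.2) hcomm1 hflat1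
  have hmin := hA.finite_isLocalMax (Y := Rᵒᵈ) (f := fun t => OrderDual.toDual (f t))
    (fun g {_ _} h => (hA.smul_le_iff g).2 h) hK1 (continuous_toDual.comp_continuousOn hcont1)
    (fun k hk => hx k hk.1.1) (fun k hk => hk.2) (fun k hk t ht => congrArg OrderDual.toDual (hcomm1 k hk t ht))
    (fun V h1 h2 h3 => by
      obtain ⟨t, ht, t', ht', hne⟩ := hflat1 V h1 h2 h3
      exact ⟨t, ht, t', ht', fun h => hne (OrderDual.toDual.injective h)⟩)
  obtain ⟨b2, hb2, hxb2, hb2b, hdisj2⟩ := hA.exists_rat_disjoint hxb1 (hmax.union hmin)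
  refine ⟨b2, hb2, hxb2, hb2b.trans (hb1b.trans hb0b), ?_⟩
  have hcont2 : ContinuousOn f (Icc x b2) :=
    hf.mono (Icc_subset_Icc le_rfl (hb2b.trans (hb1b.trans hb0b)).le)
  refine hcont2.strictMonoOn_of_injOn_Icc' hxb2.le ?_
  -- Equal values at two points force a local extremum between them, but `b2` was chosen to the left
  -- of all the extrema.
  have key : ∀ s t, s ∈ Icc x b2 → t ∈ Icc x b2 → s < t → f s ≠ f t := by
    intro s t hs ht hst he
    obtain ⟨m, hm, hext⟩ := exists_isLocalExtr_Ioo hst (hcont2.mono (Icc_subset_Icc hs.1 ht.2)) he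
    have hmI : m ∈ Ioc x b2 := ⟨hs.1.trans_lt hm.1, hm.2.le.trans ht.2⟩
    have hmI1 : m ∈ Ioo x b1 := ⟨hmI.1, hmI.2.trans_lt hb2b⟩
    refine Set.disjoint_left.1 hdisj2 hmI ?_
    rcases hext with h | h
    · exact Or.inr ⟨hmI1, h⟩
    · exact Or.inl ⟨hmI1, h⟩
  intro s hs t ht he
  rcases lt_trichotomy s t with h | h | h
  · exact absurd he (key s t hs ht h)
  · exact h
  · exact absurd he.symm (key t s ht hs h)

end TameAction
end TameGerm

/-! ### Conjugates of a monotone germ -/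

section TameIter

open MulAction Topology

variable {G R : Type*} [Group G] [CompleteLinearOrder R] [TopologicalSpace R]
    [OrderTopology R] [DenselyOrdered R] [Nontrivial R] [MulAction G R] {Op : Subgroup G → Prop}
    {Q : Set R}

namespace TameAction

theorem exists_orbit_finset (hA : TameAction G R Op Q) {F : Subgroup G} (hF : Op F) :
    ∃ S : Finset R, ∀ q ∈ Q, ∃ s ∈ S, ∃ h ∈ F, q = h • s := by
  obtain ⟨S, hS, hcov⟩ := hA.orbits hF (Fin 1)
  refine ⟨(hS.image fun s => s 0).toFinset, fun q hq => ?_⟩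
  obtain ⟨s, hs, h, hh, e⟩ := hcov (fun _ => q) fun _ => hq
  exact ⟨s 0, by simpa using ⟨s, hs, rfl⟩, h, hh, congrFun e 0⟩

/-- The number of fixed points of a subgroup is bounded by its number of orbits on `Q`. -/
theorem card_fixed_le (hA : TameAction G R Op Q) {F : Subgroup G} {S : Finset R}
    (hS : ∀ q ∈ Q, ∃ s ∈ S, ∃ h ∈ F, q = h • s) (T : Finset R)
    (hT : ∀ t ∈ T, ∀ h ∈ F, h • t = t) : T.card ≤ S.card + 1 := by
  rcases hn : T.card with _ | n
  · omega
  set e := T.orderEmbOfFin hn with he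
  have hlt : ∀ i : Fin n, e i.castSucc < e i.succ := fun i => by simp
  -- Each gap between consecutive fixed points contains a rational point; `F` preserves the gaps, so
  -- different gaps use different orbits.
  choose q hq h1 h2 using fun i => hA.dense (hlt i)
  choose s hs h hh hqs using fun i => hS (q i) (hq i)
  have key : ∀ i j : Fin n, i < j → s i ≠ s j := by
    intro i j hij hsij
    have e1 : q j = (h j * (h i)⁻¹) • q i := by
      rw [hqs i, mul_smul, inv_smul_smul, hsij, ← hqs j]
    have e2 : (h j * (h i)⁻¹) • e i.succ = e i.succ :=
      hT _ (T.orderEmbOfFin_mem hn _) _ (F.mul_mem (hh j) (F.inv_mem (hh i)))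
    have h3 : q j < e i.succ := by
      rw [e1, ← e2]
      exact hA.smul_lt _ (h2 i)
    have h4 : e i.succ ≤ e j.castSucc := e.monotone (by
      rw [Fin.le_def]; simp; exact hij)
    exact absurd (h1 j) (not_lt.2 (h3.le.trans h4))
  have hinj : Function.Injective s := by
    intro i j hij
    by_contra hne
    rcases lt_or_gt_of_ne hne with h | h
    · exact key i j h hij
    · exact key j i h hij.symm
  have := Finset.card_le_card_of_injOn (s := Finset.univ) (t := S) s (fun i _ => hs i)
    hinj.injOn
  simp only [Finset.card_univ, Fintype.card_fin] at this
  omega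

/-- The conjugate by `g` of the function `h`. -/
def conjFun {G R Y : Type*} [Group G] [MulAction G R] [MulAction G Y] (h : R → Y) (g : G) (t : R) :
    Y :=
  g • h (g⁻¹ • t)

section ConjFun

variable {Y : Type*} [LinearOrder Y] [TopologicalSpace Y] [OrderTopology Y] [DenselyOrdered Y]
  [MulAction G Y]

theorem conjFun_left {h : R → Y} {g : G} {x : R} (hx : g • x = x) : conjFun h g x = g • h x := by
  rw [conjFun, inv_smul_eq_iff.2 hx.symm]

theorem conjFun_maps (hA : TameAction G R Op Q) {x β : R} {g : G} (hx : g • x = x) :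
    MapsTo (fun t => g⁻¹ • t) (Icc x (g • β)) (Icc x β) := by
  intro t ht
  constructor
  · rw [← hA.smul_le_iff g, smul_inv_smul, hx]; exact ht.1
  · rw [← hA.smul_le_iff g, smul_inv_smul]; exact ht.2

/-- A continuous strictly increasing function to the right of the point `x`, which commutes with a
group `H` that fixes the end points of its domain. -/
structure MonoGerm {G R Y : Type*} [Group G] [CompleteLinearOrder R] [TopologicalSpace R]
    [MulAction G R] [LinearOrder Y] [TopologicalSpace Y] [MulAction G Y]
    (H : Subgroup G) (x β : R) (h : R → Y) : Prop where
  smul_lt : ∀ (g : G) {y y' : Y}, y < y' → g • y < g • y'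
  continuousOn : ContinuousOn h (Icc x β)
  strictMonoOn : StrictMonoOn h (Icc x β)
  left : ∀ k ∈ H, k • x = x
  right : ∀ k ∈ H, k • β = β
  comm : ∀ k ∈ H, ∀ t ∈ Icc x β, h (k • t) = k • h t

theorem MonoGerm.conj (hA : TameAction G R Op Q) {H : Subgroup G} {x β : R} {h : R → Y}
    (hh : MonoGerm H x β h) {g : G} (hg : g • x = x) :
    MonoGerm (H.map (MulAut.conj g).toMonoidHom) x (g • β) (conjFun h g) := by
  have hsm : ∀ (g : G), StrictMono fun y : Y => g • y := fun g y y' => hh.smul_lt g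
  have := hA.continuousConstSMul
  refine ⟨hh.smul_lt, ?_, ?_, ?_, ?_, ?_⟩
  · have h1 : Continuous fun y : Y => g • y :=
      (hsm g).monotone.continuous_of_surjective (MulAction.surjective g)
    exact h1.comp_continuousOn (hh.continuousOn.comp (continuous_const_smul g⁻¹).continuousOn
      (hA.conjFun_maps hg))
  · intro t ht t' ht' htt'
    exact hh.smul_lt g (hh.strictMonoOn (hA.conjFun_maps hg ht) (hA.conjFun_maps hg ht')
      (hA.smul_lt _ htt'))
  · rintro _ ⟨k, hk, rfl⟩
    have e : g⁻¹ • x = x := inv_smul_eq_iff.2 hg.symm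
    simp [MulAut.conj_apply, mul_smul, e, hh.left k hk, hg]
  · rintro _ ⟨k, hk, rfl⟩
    simp [MulAut.conj_apply, mul_smul, hh.right k hk]
  · rintro _ ⟨k, hk, rfl⟩ t ht
    have := hh.comm k hk _ (hA.conjFun_maps hg ht)
    simp only [MulEquiv.coe_toMonoidHom, MulAut.conj_apply, conjFun, mul_smul, inv_smul_smul, this]

theorem MonoGerm.mono {H H' : Subgroup G} {x β : R} {h : R → Y}
    (hh : MonoGerm H x β h) (hH : H' ≤ H) : MonoGerm H' x β h :=
  ⟨hh.smul_lt, hh.continuousOn, hh.strictMonoOn, fun k hk => hh.left k (hH hk),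
    fun k hk => hh.right k (hH hk), fun k hk => hh.comm k (hH hk)⟩

/-- A preimage of a fixed point by an equivariant increasing function is a fixed point. -/
theorem MonoGerm.fixed (hA : TameAction G R Op Q) {F : Subgroup G} {x β β' : R} {P P' : R → Y}
    (hP : MonoGerm F x β P) (hP' : MonoGerm F x β' P') {t t' : R} (ht : t ∈ Icc x β)
    (ht' : t' ∈ Icc x β') (e : P t = P' t') (hfix : ∀ k ∈ F, k • t' = t') :
    ∀ k ∈ F, k • t = t := by
  intro k hk
  refine hP.strictMonoOn.injOn (hA.smul_mem_Icc (hP.left k hk) (hP.right k hk) ht) ht ?_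
  rw [hP.comm k hk t ht, e, ← hP'.comm k hk t' ht', hfix k hk]

theorem MonoGerm.exists_eq {H : Subgroup G} {x β b : R} {h : R → Y} (hh : MonoGerm H x β h)
    (hxb : x ≤ b) (hb : b ≤ β) {v : Y} (h1 : h x ≤ v) (h2 : v ≤ h b) : ∃ t ∈ Icc x b, h t = v :=
  intermediate_value_Icc hxb (hh.continuousOn.mono (Icc_subset_Icc le_rfl hb)) ⟨h1, h2⟩

/-- Two germs with common symmetries do not cross. -/
theorem MonoGerm.lt_of_lt (hA : TameAction G R Op Q) {F : Subgroup G} (hF : Op F) {x b β β' : R}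
    {P P' : R → Y} (hP : MonoGerm F x β P) (hP' : MonoGerm F x β' P') (hb : b ≤ β) (hb' : b ≤ β')
    (hlt : P x < P' x) {t : R} (ht : t ∈ Icc x b) : P t < P' t := by
  by_contra hcon
  push Not at hcon
  have hsub : Icc x t ⊆ Icc x β := Icc_subset_Icc le_rfl (ht.2.trans hb)
  have hsub' : Icc x t ⊆ Icc x β' := Icc_subset_Icc le_rfl (ht.2.trans hb')
  have hxx : x ∈ Icc x t := ⟨le_rfl, ht.1⟩
  -- If the germs crossed, iterating `P⁻¹ ∘ P'` from `x` would stay in `[x, t]` and produce an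
  -- infinite increasing sequence of points fixed by `F`.
  have step : ∀ u : Icc x t, ∃ u' : Icc x t, P u' = P' u := by
    rintro ⟨u, hu⟩
    obtain ⟨u', hu', e⟩ := hP.exists_eq ht.1 (ht.2.trans hb) (v := P' u)
      (hlt.le.trans (hP'.strictMonoOn.monotoneOn (hsub' hxx) (hsub' hu) hu.1))
      ((hP'.strictMonoOn.monotoneOn (hsub' hu) (hsub' ⟨ht.1, le_rfl⟩) hu.2).trans hcon)
    exact ⟨⟨u', hu'⟩, e⟩
  choose nxt hnxt using step
  set u : ℕ → Icc x t := fun n => nxt^[n] ⟨x, hxx⟩ with hu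
  have hsucc : ∀ n, P (u (n + 1)) = P' (u n) := fun n => by
    rw [← hnxt, hu]
    simp only [Function.iterate_succ_apply']
  have hmono : ∀ n, (u n : R) < u (n + 1) := by
    intro n
    have key : P (u n) < P (u (n + 1)) := by
      rw [hsucc]
      induction n with
      | zero => exact hlt
      | succ n ih =>
        rw [hsucc]
        exact hP'.strictMonoOn (hsub' (u n).2) (hsub' (u (n + 1)).2)
          ((hP.strictMonoOn.lt_iff_lt (hsub (u n).2) (hsub (u (n + 1)).2)).1 (by rwa [hsucc]))
    exact (hP.strictMonoOn.lt_iff_lt (hsub (u n).2) (hsub (u (n + 1)).2)).1 key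
  have hfix : ∀ n, ∀ k ∈ F, k • (u n : R) = u n := by
    intro n
    induction n with
    | zero => exact hP.left
    | succ n ih => exact hP.fixed hA hP' (hsub (u _).2) (hsub' (u n).2) (hsucc n) ih
  obtain ⟨S, hS⟩ := hA.exists_orbit_finset hF
  have hsm : StrictMono fun n => (u n : R) := strictMono_nat_of_lt_succ hmono
  have := hA.card_fixed_le hS ((Finset.range (S.card + 2)).map ⟨_, hsm.injective⟩) (by
    intro t ht
    obtain ⟨n, -, rfl⟩ := Finset.mem_map.1 ht
    exact hfix n)
  rw [Finset.card_map, Finset.card_range] at this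
  omega

/-- `z` is the end of a descending chain of length `n` in `(x, b]` from `b`, whose steps go from `t`
to the point where `P` takes the value `P₀ t`. -/
def Reach {R Y : Type*} [LinearOrder R] (x b : R) (P₀ P : R → Y) : ℕ → R → Prop
  | 0, z => z = b
  | n + 1, z => ∃ t, Reach x b P₀ P n t ∧ x < z ∧ z < t ∧ P z = P₀ t

theorem Reach.mem {x b : R} (hxb : x < b) {P₀ P : R → Y} {n : ℕ} {z : R}
    (hz : Reach x b P₀ P n z) : x < z ∧ z ≤ b := by
  induction n generalizing z with
  | zero => exact ⟨hz ▸ hxb, le_of_eq hz⟩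
  | succ n ih =>
    obtain ⟨t, ht, h1, h2, -⟩ := hz
    exact ⟨h1, h2.le.trans (ih ht).2⟩

/-- Each point of the chain is the unique solution of an equivariant equation in the preceding one,
so it inherits being fixed by `F`. -/
theorem Reach.exists_fixed (hA : TameAction G R Op Q) {F : Subgroup G} {x β β' b : R}
    (hxb : x < b) {P₀ P : R → Y} (hP₀ : MonoGerm F x β P₀) (hP : MonoGerm F x β' P) (hb : b ≤ β)
    (hb' : b ≤ β') (hfb : ∀ k ∈ F, k • b = b) {n : ℕ} {z : R} (hz : Reach x b P₀ P n z) :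
    ∃ T : Finset R, T.card = n + 1 ∧ z ∈ T ∧ ∀ t ∈ T, z ≤ t ∧ ∀ k ∈ F, k • t = t := by
  induction n generalizing z with
  | zero =>
    rw [show z = b from hz]
    exact ⟨{b}, by simp, by simp, fun t ht => by
      rw [Finset.mem_singleton.1 ht]; exact ⟨le_rfl, hfb⟩⟩
  | succ n ih =>
    obtain ⟨t, ht, h1, h2, e⟩ := hz
    obtain ⟨T, hT1, hT2, hT3⟩ := ih ht
    have ht' := ht.mem hxb
    refine ⟨insert z T, ?_, Finset.mem_insert_self _ _, fun t' htt' => ?_⟩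
    · rw [Finset.card_insert_of_notMem fun hzT => absurd h2 (not_lt.2 (hT3 z hzT).1), hT1]
    · rcases Finset.mem_insert.1 htt' with rfl | h
      · exact ⟨le_rfl, hP.fixed hA hP₀ ⟨h1.le, h2.le.trans (ht'.2.trans hb')⟩
          ⟨ht'.1.le, ht'.2.trans hb⟩ e (hT3 t hT2).2⟩
      · exact ⟨h2.le.trans (hT3 t' h).1, (hT3 t' h).2⟩

/-- A germ `P'` between `P₀` and `P` descends in smaller steps than `P`. Its chain stays above that
of `P`, and it can be continued as long as the value of `P'` at `x` is below the required one. -/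
theorem Reach.exists_of_lt {x β β'' b : R} (hxb : x < b) {F₀ F' : Subgroup G}
    {P₀ P P' : R → Y} (hP₀ : MonoGerm F₀ x β P₀)
    (hP' : MonoGerm F' x β'' P') (hb : b ≤ β) (hb'' : b ≤ β'')
    (hlt : ∀ t ∈ Icc x b, P₀ t < P' t) (hlt' : ∀ t ∈ Icc x b, P' t < P t) {n : ℕ} {z : R}
    (hz : Reach x b P₀ P n z) (hzx : P' x < P₀ z) : ∃ z' ≥ z, Reach x b P₀ P' n z' := by
  induction n generalizing z with
  | zero => exact ⟨z, le_rfl, hz⟩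
  | succ n ih =>
    obtain ⟨t, ht, h1, h2, e⟩ := hz
    have ht' := ht.mem hxb
    have m₀ : ∀ {t}, t ∈ Icc x b → t ∈ Icc x β := fun h => ⟨h.1, h.2.trans hb⟩
    have m' : ∀ {t}, t ∈ Icc x b → t ∈ Icc x β'' := fun h => ⟨h.1, h.2.trans hb''⟩
    have htm : t ∈ Icc x b := ⟨ht'.1.le, ht'.2⟩
    have hzm : z ∈ Icc x b := ⟨h1.le, h2.le.trans ht'.2⟩
    have hzt := hP₀.strictMonoOn (m₀ hzm) (m₀ htm) h2
    obtain ⟨t', htt', ht'r⟩ := ih ht (hzx.trans hzt)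
    have ht'' := ht'r.mem hxb
    have ht'm : t' ∈ Icc x b := ⟨ht''.1.le, ht''.2⟩
    have hle : P₀ t ≤ P₀ t' := hP₀.strictMonoOn.monotoneOn (m₀ htm) (m₀ ht'm) htt'
    obtain ⟨z', hz', e'⟩ := hP'.exists_eq ht''.1.le (ht''.2.trans hb'')
      ((hzx.trans hzt).le.trans hle) (hlt t' ht'm).le
    have hz'm : z' ∈ Icc x b := ⟨hz'.1, hz'.2.trans ht''.2⟩
    have hzz' : z < z' := by
      refine (hP'.strictMonoOn.lt_iff_lt (m' hzm) (m' hz'm)).1 ?_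
      rw [e']
      exact (hlt' z hzm).trans_le (e ▸ hle)
    refine ⟨z', hzz'.le, t', ht'r, h1.trans hzz', ?_, e'⟩
    refine (hP'.strictMonoOn.lt_iff_lt (m' hz'm) (m' ht'm)).1 ?_
    rw [e']
    exact hlt t' ht'm

/-- The value of an increasing germ at a fixed point of the open group `S` has a finite
`S`-orbit. -/
theorem MonoGerm.finite_orbit (hA : TameAction G R Op Q) {S H : Subgroup G} (hS : Op S) (hH : Op H)
    {x β : R} (hxβ : x < β) {h : R → Y} (hh : MonoGerm H x β h)
    (hSx : ∀ g ∈ S, g • x = x)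
    (htame : ∀ {K : Subgroup G}, Op K → ∀ Z : Set Y, (∀ k ∈ K, ∀ z ∈ Z, k • z ∈ Z) → Z.Infinite →
      (interior (closure Z)).Nonempty) :
    {y | ∃ g ∈ S, y = g • h x}.Finite := by
  by_contra hinf
  -- Infinitely many values come from translated germs that are defined on a common interval `[x,
  -- b]`. Otherwise there are finitely many for each rational `b`, with a uniform bound `B` by
  -- `card_bound`; but any `B + 1` germs share some interval.
  obtain ⟨b, hbQ, hxb, hYb⟩ : ∃ b ∈ Q, x < b ∧ {y | ∃ g ∈ S, b ≤ g • β ∧ y = g • h x}.Infinite := by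
    by_contra hcon
    push Not at hcon
    obtain ⟨B, hB⟩ := hA.card_bound hS (ι := Fin 1) (α := Y)
      (fun p => {y | x < p 0 ∧ ∃ g ∈ S, p 0 ≤ g • β ∧ y = g • h x}) (by
        rintro k hk p y ⟨h1, g, hg, h2, rfl⟩
        refine ⟨?_, k * g, S.mul_mem hk hg, ?_, ?_⟩
        · have := hA.smul_lt k h1
          rwa [hSx k hk] at this
        · rw [mul_smul]; exact (hA.smul_le_iff k).2 h2
        · rw [mul_smul])
    obtain ⟨T, hT, hTc⟩ := Set.Infinite.exists_subset_card_eq hinf (B + 1)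
    have hT' : ∀ y : T, ∃ g ∈ S, (y : Y) = g • h x := fun y => hT y.2
    choose g hg hgy using hT'
    classical
    have hne : (T.attach.image fun y => g y • β).Nonempty := by
      rw [Finset.image_nonempty, Finset.attach_nonempty_iff, ← Finset.card_pos]; omega
    set m : R := (T.attach.image fun y => g y • β).min' hne with hm
    have hxm : x < m := by
      refine (Finset.lt_min'_iff _ _).2 fun z hz => ?_
      obtain ⟨y, -, rfl⟩ := Finset.mem_image.1 hz
      have := hA.smul_lt (g y) hxβ
      rwa [hSx _ (hg y)] at this
    obtain ⟨b, hb, h1, h2⟩ := hA.dense hxm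
    have hfin := hcon b hb h1
    have hfin' : {y | x < b ∧ ∃ g ∈ S, b ≤ g • β ∧ y = g • h x}.Finite :=
      hfin.subset fun y hy => hy.2
    have h3 := hB (fun _ => b) (fun _ => hb) hfin'
    have h4 : (T : Set Y) ⊆ {y | x < b ∧ ∃ g ∈ S, b ≤ g • β ∧ y = g • h x} := by
      intro y hy
      refine ⟨h1, g ⟨y, hy⟩, hg _, h2.le.trans ?_, hgy ⟨y, hy⟩⟩
      rw [hm]
      exact Finset.min'_le _ _ (Finset.mem_image_of_mem _ (Finset.mem_attach T ⟨y, hy⟩))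
    have h5 := Set.ncard_le_ncard h4 hfin'
    rw [Set.ncard_coe_finset] at h5
    omega
  have hbS : Op (S ⊓ stabilizer G b) := hA.inf hS (hA.stab hbQ)
  obtain ⟨y1, hy1⟩ := htame hbS _ (by
    rintro k ⟨hk, hkb⟩ y ⟨g, hg, h2, rfl⟩
    refine ⟨k * g, S.mul_mem hk hg, ?_, by rw [mul_smul]⟩
    rw [mul_smul, ← show k • b = b from hkb]
    exact (hA.smul_le_iff k).2 h2) hYb
  set J := interior (closure {y | ∃ g ∈ S, b ≤ g • β ∧ y = g • h x}) with hJ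
  have hmeet : ∀ V : Set Y, IsOpen V → (V ∩ J).Nonempty →
      ∃ g ∈ S, b ≤ g • β ∧ g • h x ∈ V ∩ J := by
    rintro V hV ⟨y, hy, hyJ⟩
    obtain ⟨_, hz, g, hg, h1, rfl⟩ := mem_closure_iff.1 (interior_subset hyJ) _
      (hV.inter isOpen_interior) ⟨hy, hyJ⟩
    exact ⟨g, hg, h1, hz⟩
  -- The values at `x` are dense in `J`, so above the germ of `g0` there are germs with values at
  -- `x` arbitrarily close to its own.
  obtain ⟨g0, hg0, hbg0, -, hg0J⟩ := hmeet univ isOpen_univ ⟨y1, mem_univ _, hy1⟩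
  have hG : ∀ g ∈ S, MonoGerm (H.map (MulAut.conj g).toMonoidHom) x (g • β) (conjFun h g) :=
    fun g hg => hh.conj hA (hSx g hg)
  have hval : ∀ g ∈ S, conjFun h g x = g • h x := fun g hg => conjFun_left (hSx g hg)
  have hnc : ∀ g ∈ S, ∀ g' ∈ S, b ≤ g • β → b ≤ g' • β → g • h x < g' • h x →
      ∀ t ∈ Icc x b, conjFun h g t < conjFun h g' t := by
    intro g hg g' hg' h1 h2 hlt t ht
    exact ((hG g hg).mono inf_le_left).lt_of_lt hA
      (hA.inf (hA.conj g hH) (hA.conj g' hH)) ((hG g' hg').mono inf_le_right) h1 h2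
      (by rwa [hval g hg, hval g' hg']) ht
  have hup : ∀ v, g0 • h x < v → ∃ g ∈ S, b ≤ g • β ∧ g0 • h x < g • h x ∧ g • h x < v := by
    intro v hv
    obtain ⟨w, hw, hwJ⟩ := exists_Ico_subset_of_mem_nhds (isOpen_interior.mem_nhds hg0J) ⟨v, hv⟩
    obtain ⟨y, hy1, hy2⟩ := exists_between (lt_min hv hw)
    obtain ⟨g, hg, h1, h2, -⟩ := hmeet (Ioo (g0 • h x) v) isOpen_Ioo
      ⟨y, ⟨hy1, hy2.trans_le (min_le_left _ _)⟩, hwJ ⟨hy1.le, hy2.trans_le (min_le_right _ _)⟩⟩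
    exact ⟨g, hg, h1, h2⟩
  -- Moving the value of the upper germ at `x` closer to that of `g0` keeps a chain of length `n`
  -- and leaves room for one more step, found by the intermediate value theorem.
  have hchain : ∀ n, ∃ g ∈ S, b ≤ g • β ∧ g0 • h x < g • h x ∧
      ∃ z, Reach x b (conjFun h g0) (conjFun h g) n z := by
    intro n
    induction n with
    | zero =>
      obtain ⟨g, hg, h1, h2, -⟩ := hup (conjFun h g0 b) (by
        rw [← hval g0 hg0]
        exact (hG g0 hg0).strictMonoOn ⟨le_rfl, hxb.le.trans hbg0⟩ ⟨hxb.le, hbg0⟩ hxb)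
      exact ⟨g, hg, h1, h2, b, rfl⟩
    | succ n ih =>
      obtain ⟨g, hg, hbg, hlt, z, hz⟩ := ih
      have hzm := hz.mem hxb
      obtain ⟨g', hg', hbg', h1, h2⟩ := hup (min (g • h x) (conjFun h g0 z)) (by
        refine lt_min hlt ?_
        rw [← hval g0 hg0]
        exact (hG g0 hg0).strictMonoOn ⟨le_rfl, hxb.le.trans hbg0⟩ ⟨hzm.1.le, hzm.2.trans hbg0⟩
          hzm.1)
      have h3 : conjFun h g' x < conjFun h g0 z := by
        rw [hval g' hg']; exact h2.trans_le (min_le_right _ _)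
      have hc := hnc g0 hg0 g' hg' hbg0 hbg' h1
      obtain ⟨z', hzz', hz'⟩ := hz.exists_of_lt hxb (hG g0 hg0) (hG g' hg') hbg0 hbg'
        hc (hnc g' hg' g hg hbg' hbg (h2.trans_le (min_le_left _ _))) h3
      have hzm' := hz'.mem hxb
      have h4 : conjFun h g' x < conjFun h g0 z' := h3.trans_le
        ((hG g0 hg0).strictMonoOn.monotoneOn ⟨hzm.1.le, hzm.2.trans hbg0⟩
          ⟨hzm'.1.le, hzm'.2.trans hbg0⟩ hzz')
      have h5 := hc z' ⟨hzm'.1.le, hzm'.2⟩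
      obtain ⟨t, ht, e⟩ := (hG g' hg').exists_eq hzm'.1.le (hzm'.2.trans hbg') h4.le h5.le
      refine ⟨g', hg', hbg', h1, t, z', hz', lt_of_le_of_ne ht.1 ?_, lt_of_le_of_ne ht.2 ?_, e⟩
      · rintro rfl
        exact h4.ne e
      · rintro rfl
        exact h5.ne' e
  -- A chain of length `N + 1` consists of `N + 2` points fixed by a group which, whatever `g` is,
  -- has at most `N` orbits on `Q`, hence at most `N + 1` fixed points.
  obtain ⟨N, hN⟩ := hA.unif (hA.inf (hA.conj g0 hH) (hA.stab hbQ)) hH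
  obtain ⟨g, hg, hbg, hlt, z, hz⟩ := hchain (N + 1)
  obtain ⟨S', hS'N, hS'⟩ := hN g
  obtain ⟨T, hT1, -, hT2⟩ := hz.exists_fixed hA hxb ((hG g0 hg0).mono
    (inf_le_left.trans inf_le_left)) ((hG g hg).mono inf_le_right) hbg0 hbg
    (F := (H.map (MulAut.conj g0).toMonoidHom ⊓ stabilizer G b) ⊓
      H.map (MulAut.conj g).toMonoidHom) (fun k hk => hk.1.2)
  have := hA.card_fixed_le hS' T fun t ht => (hT2 t ht).2
  omega
end ConjFun
end TameAction
end TameIter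

/-! ### Horizontal pieces of closed invariant sets, and locally constant functions -/

section TameCore

open MulAction Topology

variable {G R : Type*} [Group G] [CompleteLinearOrder R] [TopologicalSpace R]
    [OrderTopology R] [DenselyOrdered R] [Nontrivial R] [MulAction G R] {Op : Subgroup G → Prop}
    {Q : Set R}

theorem update_smul {ι G R : Type*} [DecidableEq ι] [SMul G R] (g : G) (c : ι → R) (i : ι) (t : R) :
    g • Function.update c i t = Function.update (g • c) i (g • t) := by
  funext j
  by_cases h : j = i
  · subst h; simp
  · simp [h]

theorem update_mem_Icc {ι R : Type*} [DecidableEq ι] [Preorder R] {p q x : ι → R}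
    (hx : x ∈ Icc p q) {i : ι} {t : R} (h1 : p i ≤ t) (h2 : t ≤ q i) :
    Function.update x i t ∈ Icc p q := by
  refine ⟨fun j => ?_, fun j => ?_⟩ <;> by_cases h : j = i
  · subst h; simpa
  · simpa [h] using hx.1 j
  · subst h; simpa
  · simpa [h] using hx.2 j

namespace TameAction

/-- An invariant closed set that is locally a horizontal plane has only finitely many orbits of
such planes. -/
theorem finite_flat (hA : TameAction G R Op Q) {s : ℕ} {H : Subgroup G} (hH : Op H)
    {Γ : Set ((Fin s → R) × R)} (hΓ : IsClosed Γ) (hinv : ∀ h ∈ H, ∀ z ∈ Γ, h • z ∈ Γ) :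
    {z | ∃ (V : Set (Fin s → R)) (O : Set R), IsOpen V ∧ IsOpen O ∧ V.Nonempty ∧ z ∈ O ∧
      ∀ x ∈ V, ∀ y ∈ O, (x, y) ∈ Γ ↔ y = z}.Finite := by
  have hcs := hA.continuousConstSMul
  set Λ : R → (Fin s → R) → Prop := fun z x => ∃ (V : Set (Fin s → R)) (O : Set R), IsOpen V ∧
    IsOpen O ∧ x ∈ V ∧ z ∈ O ∧ ∀ x ∈ V, ∀ y ∈ O, (x, y) ∈ Γ ↔ y = z with hΛ
  have hΛinv : ∀ h ∈ H, ∀ z x, Λ z x → Λ (h • z) (h • x) := by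
    rintro h hh z x ⟨V, O, hV, hO, hx, hz, hVO⟩
    refine ⟨(fun x => h⁻¹ • x) ⁻¹' V, (fun y => h⁻¹ • y) ⁻¹' O, hV.preimage (continuous_const_smul _),
      hO.preimage (continuous_const_smul _), by simpa, by simpa, fun x' hx' y hy => ?_⟩
    rw [← inv_smul_eq_iff, ← hVO _ hx' _ hy]
    constructor
    · intro h1
      exact hinv h⁻¹ (H.inv_mem hh) _ h1
    · intro h1
      have := hinv h hh _ h1
      simpa using this
  refine (hA.finite_of_point_finite hH Λ hΛinv ?_ ?_).subset ?_
  · intro z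
    refine isOpen_iff_forall_mem_open.2 ?_
    rintro x ⟨V, O, hV, hO, hx, hz, hVO⟩
    exact ⟨V, fun x' hx' => ⟨V, O, hV, hO, hx', hz, hVO⟩, hV, hx⟩
  · intro x hx
    by_contra hinf
    obtain ⟨K, hK, hKH, hKx⟩ := hA.stab_finite hH x hx
    -- Infinitely many flat heights over one rational `x` would be dense in an interval, which the
    -- closed set `Γ` would then contain above `x`; but close to a flat height the fibre has no
    -- other point.
    obtain ⟨y, hy⟩ := hA.tame hK {z | Λ z x} (fun k hk z hz => by
      have := hΛinv k (hKH hk) z x hz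
      rwa [hKx k hk] at this) hinf
    obtain ⟨z, hzJ, hz⟩ := mem_closure_iff.1 (interior_subset hy) _ isOpen_interior hy
    obtain ⟨V, O, hV, hO, hxV, hzO, hVO⟩ := hz
    obtain ⟨p, -, q, -, hpq, hs⟩ := hA.exists_Icc (isOpen_interior.inter hO) ⟨z, hzJ, hzO⟩
    have hcl : closure {z | Λ z x} ⊆ (fun y => (x, y)) ⁻¹' Γ := by
      refine closure_minimal ?_ (hΓ.preimage (by fun_prop))
      rintro z' ⟨V', O', -, -, hx', hz', h'⟩
      exact (h' x hx' z' hz').2 rfl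
    have key : ∀ t ∈ Icc p q, t = z := fun t ht =>
      (hVO x hxV t (hs ht).2).1 (hcl (interior_subset (hs ht).1))
    exact hpq.ne ((key p ⟨le_rfl, hpq.le⟩).trans (key q ⟨hpq.le, le_rfl⟩).symm)
  · rintro z ⟨V, O, hV, hO, ⟨x, hx⟩, hz, h⟩
    exact ⟨x, V, O, hV, hO, hx, hz, h⟩

/-- A continuous equivariant function which is locally constant to the right in every coordinate
direction, at every point of a dense set, is constant on some box. -/
theorem exists_const_box (hA : TameAction G R Op Q) {s : ℕ} {K : Subgroup G} (hK : Op K)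
    {W D : Set (Fin s → R)} (hW : IsOpen W) (hWne : W.Nonempty) (hD : W ⊆ closure D)
    {F : (Fin s → R) → R} (hF : ContinuousOn F W)
    (hcomm : ∀ k ∈ K, ∀ x ∈ W, k • x ∈ W → F (k • x) = k • F x)
    (hflat : ∀ d ∈ D, d ∈ W → ∀ i, d i < ⊤ → ∃ β > d i, ∀ t ∈ Icc (d i) β,
      F (Function.update d i t) = F d) :
    ∃ V ⊆ W, IsOpen V ∧ V.Nonempty ∧ ∀ x ∈ V, ∀ x' ∈ V, F x = F x' := by
  -- The box is shrunk repeatedly, each time making `F` independent of one more coordinate.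
  have key : ∀ I : Finset (Fin s), ∃ p q, RatBox Q p q ∧ Icc p q ⊆ W ∧
      ∀ x ∈ Icc p q, ∀ x' ∈ Icc p q, (∀ i ∉ I, x i = x' i) → F x = F x' := by
    intro I
    induction I using Finset.induction_on with
    | empty =>
      obtain ⟨x, hx⟩ := hWne
      obtain ⟨p, q, hp, hq, hpq, hs⟩ := hA.exists_box hW hx
      refine ⟨p, q, ⟨hp, hq, hpq⟩, hs, fun x _ x' _ h => ?_⟩
      rw [show x = x' from funext fun i => h i (Finset.notMem_empty i)]
    | insert i I hi ih =>
      obtain ⟨p, q, hpq, hpqW, hI⟩ := ih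
      -- The tuples along which `F` does not depend on the coordinate `i` in `[l, z]`. Points of the
      -- dense set `D` inside the box lie in such sets by right flatness, so by the Baire theorem
      -- one of the sets has interior there.
      set N : (Fin 1 → R) → (Fin 1 → R) → Set (Fin s → R) := fun l z =>
        {x | x ∈ Icc p q ∧ p i ≤ l 0 ∧ z 0 ≤ q i ∧ ∀ t ∈ Icc (l 0) (z 0), ∀ t' ∈ Icc (l 0) (z 0),
          F (Function.update x i t) = F (Function.update x i t')} with hN
      obtain ⟨K1, hK1, hK1K, hK1p⟩ := hA.stab_finite hK p hpq.1
      obtain ⟨K2, hK2, hK2K, hK2q⟩ := hA.stab_finite hK1 q hpq.2.1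
      have hup : ∀ {x l z t}, x ∈ Icc p q → p i ≤ l → z ≤ q i → t ∈ Icc l z →
          Function.update x i t ∈ Icc p q := fun hx h1 h2 ht =>
        update_mem_Icc hx (h1.trans ht.1) (ht.2.trans h2)
      have hsm : ∀ k ∈ K2, ∀ x ∈ Icc p q, k • x ∈ Icc p q := by
        intro k hk x hx
        rw [← hK1p k (hK2K hk), ← hK2q k hk]
        exact ⟨fun j => (hA.smul_le_iff k).2 (hx.1 j), fun j => (hA.smul_le_iff k).2 (hx.2 j)⟩
      have hNf : BoxFamily K2 N := by
        refine ⟨?_, ?_, ?_⟩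
        · rintro k hk l z x ⟨hx, h1, h2, h3⟩
          have e1 : ∀ t, k • l 0 ≤ t → l 0 ≤ k⁻¹ • t := fun t ht => by
            rwa [← hA.smul_le_iff k, smul_inv_smul]
          have e2 : ∀ t, t ≤ k • z 0 → k⁻¹ • t ≤ z 0 := fun t ht => by
            rwa [← hA.smul_le_iff k, smul_inv_smul]
          have e3 : ∀ t ∈ Icc (k • l 0) (k • z 0), F (Function.update (k • x) i t) =
              k • F (Function.update x i (k⁻¹ • t)) := by
            intro t ht
            have hm := hup hx h1 h2 ⟨e1 t ht.1, e2 t ht.2⟩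
            rw [← hcomm k (hK1K (hK2K hk)) _ (hpqW hm) (hpqW (hsm k hk _ hm)), update_smul,
              smul_inv_smul]
          refine ⟨hsm k hk x hx, ?_, ?_, fun t ht t' ht' => ?_⟩
          · rw [← congrFun (hK1p k (hK2K hk)) i]
            exact (hA.smul_le_iff k).2 h1
          · rw [← congrFun (hK2q k hk) i]
            exact (hA.smul_le_iff k).2 h2
          · rw [e3 t ht, e3 t' ht', h3 _ ⟨e1 t ht.1, e2 t ht.2⟩ _ ⟨e1 t' ht'.1, e2 t' ht'.2⟩]
        · rintro l z l' z' hl hz x ⟨hx, h1, h2, h3⟩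
          exact ⟨hx, h1.trans (hl 0), (hz 0).trans h2, fun t ht t' ht' =>
            h3 t ⟨(hl 0).trans ht.1, ht.2.trans (hz 0)⟩ t' ⟨(hl 0).trans ht'.1, ht'.2.trans (hz 0)⟩⟩
        · intro l z
          by_cases hlz : p i ≤ l 0 ∧ z 0 ≤ q i
          · have hc : ∀ t ∈ Icc (l 0) (z 0),
                ContinuousOn (fun x => F (Function.update x i t)) (Icc p q) := fun t ht =>
              hF.comp (Continuous.continuousOn (by fun_prop))
                fun x hx => hpqW (hup hx hlz.1 hlz.2 ht)
            have : N l z = Icc p q ∩ ⋂ t ∈ Icc (l 0) (z 0), ⋂ t' ∈ Icc (l 0) (z 0),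
                Icc p q ∩ {x | F (Function.update x i t) = F (Function.update x i t')} := by
              ext x
              simp only [hN, mem_ofPred_eq, mem_inter_iff, mem_iInter]
              constructor
              · rintro ⟨h1, -, -, h2⟩
                exact ⟨h1, fun t ht t' ht' => ⟨h1, h2 t ht t' ht'⟩⟩
              · rintro ⟨h1, h2⟩
                exact ⟨h1, hlz.1, hlz.2, fun t ht t' ht' => (h2 t ht t' ht').2⟩
            rw [this]
            refine isClosed_Icc.inter (isClosed_iInter fun t => isClosed_iInter fun ht =>
              isClosed_iInter fun t' => isClosed_iInter fun ht' => ?_)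
            exact ((hc t ht).prodMk (hc t' ht')).preimage_isClosed_of_isClosed isClosed_Icc
              isClosed_diagonal
          · have : N l z = ∅ := by
              ext x
              simp only [hN, mem_ofPred_eq, mem_empty_iff_false, iff_false]
              rintro ⟨-, h1, h2, -⟩
              exact hlz ⟨h1, h2⟩
            rw [this]
            exact isClosed_empty
      set U : Set (Fin s → R) := Set.pi univ fun j => Ioo (p j) (q j) with hU
      have hUo : IsOpen U := isOpen_set_pi finite_univ fun j _ => isOpen_Ioo
      have hUne : U.Nonempty := by
        choose m hm using fun j => exists_between (hpq.2.2 j)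
        exact ⟨m, fun j _ => hm j⟩
      have hUsub : U ⊆ Icc p q := fun x hx =>
        ⟨fun j => (hx j trivial).1.le, fun j => (hx j trivial).2.le⟩
      have hex : ∃ l z, RatBox Q l z ∧ (interior (N l z) ∩ U).Nonempty := by
        by_contra hcon
        obtain ⟨U', hU'U, hU'o, ⟨x, hx⟩, hU'⟩ := hA.baire hK2 hNf hUo hUne (fun l z hlz => by
          by_contra hne
          exact hcon ⟨l, z, hlz, Set.nonempty_iff_ne_empty.2 hne⟩)
        obtain ⟨d, hdU', hdD⟩ := mem_closure_iff.1 (hD (hpqW (hUsub (hU'U hx)))) U' hU'o hx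
        have hdU := hU'U hdU'
        obtain ⟨β, hβ, hβf⟩ := hflat d hdD (hpqW (hUsub hdU)) i ((hdU i trivial).2.trans_le le_top)
        obtain ⟨z, hzQ, h1, h2⟩ := hA.dense (lt_min hβ (hdU i trivial).2)
        obtain ⟨l, hlQ, h3, h4⟩ := hA.dense h1
        refine hU' d hdU' (fun _ => l) (fun _ => z) ⟨fun _ => hlQ, fun _ => hzQ, fun _ => h4⟩
          ⟨hUsub hdU, ((hdU i trivial).1.trans h3).le, (h2.trans_le (min_le_right _ _)).le, ?_⟩
        have hf : ∀ t ∈ Icc l z, F (Function.update d i t) = F d := fun t ht =>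
          hβf t ⟨h3.le.trans ht.1, ht.2.trans (h2.trans_le (min_le_left _ _)).le⟩
        intro t ht t' ht'
        rw [hf t ht, hf t' ht']
      obtain ⟨l, z, hlz, x, hx⟩ := hex
      obtain ⟨p', q', hp', hq', hpq', hs⟩ := hA.exists_box (isOpen_interior.inter hUo) hx
      -- The new box has `[l, z]` as its `i`-th side. Resetting the `i`-th coordinate to `p' i`
      -- leads into `N l z`, where that coordinate can be moved freely within `[l, z]` without
      -- changing `F`.
      have hs' : ∀ x ∈ Icc (Function.update p' i (l 0)) (Function.update q' i (z 0)),
          Function.update x i (p' i) ∈ N l z ∧ x i ∈ Icc (l 0) (z 0) := by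
        intro x hx
        refine ⟨interior_subset (hs ?_).1, by simpa using hx.1 i, by simpa using hx.2 i⟩
        refine ⟨fun j => ?_, fun j => ?_⟩ <;> by_cases h : j = i
        · subst h; simp
        · simpa [h] using hx.1 j
        · subst h; simpa using (hpq' j).le
        · simpa [h] using hx.2 j
      have hs'' : ∀ x ∈ Icc (Function.update p' i (l 0)) (Function.update q' i (z 0)),
          x ∈ Icc p q := by
        intro x hx
        obtain ⟨⟨h1, h2, h3, -⟩, h4⟩ := hs' x hx
        have := hup h1 h2 h3 h4
        rwa [Function.update_idem, Function.update_eq_self] at this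
      refine ⟨Function.update p' i (l 0), Function.update q' i (z 0), ⟨fun j => ?_, fun j => ?_,
        fun j => ?_⟩, fun x hx => hpqW (hs'' x hx), fun x hx x' hx' hxx' => ?_⟩
      · by_cases h : j = i
        · subst h; simpa using hlz.1 0
        · simpa [h] using hp' j
      · by_cases h : j = i
        · subst h; simpa using hlz.2.1 0
        · simpa [h] using hq' j
      · by_cases h : j = i
        · subst h; simpa using hlz.2.2 0
        · simpa [h] using hpq' j
      · obtain ⟨⟨h1, h2, h3, h4⟩, h5⟩ := hs' x hx
        have h6 := (hs' x' hx').2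
        have h7 := h4 _ h5 _ h6
        simp only [Function.update_idem, Function.update_eq_self] at h7
        rw [h7]
        refine hI _ ?_ _ (hs'' x' hx') fun j hj => ?_
        · have := hup h1 h2 h3 h6
          rwa [Function.update_idem] at this
        · by_cases h : j = i
          · subst h; simp
          · simpa [h] using hxx' j (by simp [h, hj])
  obtain ⟨p, q, hpq, hpqW, h⟩ := key Finset.univ
  refine ⟨Set.pi univ fun j => Ioo (p j) (q j), ?_, isOpen_set_pi finite_univ fun j _ => isOpen_Ioo,
    ?_, ?_⟩
  · exact fun x hx => hpqW ⟨fun j => (hx j trivial).1.le, fun j => (hx j trivial).2.le⟩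
  · choose m hm using fun j => exists_between (hpq.2.2 j)
    exact ⟨m, fun j _ => hm j⟩
  · exact fun x hx x' hx' => h x ⟨fun j => (hx j trivial).1.le, fun j => (hx j trivial).2.le⟩
      x' ⟨fun j => (hx' j trivial).1.le, fun j => (hx' j trivial).2.le⟩ (by simp)

end TameAction
end TameCore

/-! ### Adding a coordinate to a somewhere dense orbit -/

section TameCoreFinal

open MulAction Topology

variable {G R : Type*} [Group G] [CompleteLinearOrder R] [TopologicalSpace R]
    [OrderTopology R] [DenselyOrdered R] [Nontrivial R] [MulAction G R] {Op : Subgroup G → Prop}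
    {Q : Set R}

theorem continuous_update_right {ι R : Type*} [DecidableEq ι] [TopologicalSpace R] (c : ι → R)
    (i : ι) : Continuous fun t : R => Function.update c i t :=
  continuous_const.update i continuous_id

namespace TameAction

theorem smul_top (hA : TameAction G R Op Q) (g : G) : g • (⊤ : R) = ⊤ :=
  top_le_iff.1 (by
    have := (hA.smul_le_iff g).2 (le_top (a := g⁻¹ • (⊤ : R)))
    rwa [smul_inv_smul] at this)

theorem smul_lt_top (hA : TameAction G R Op Q) (g : G) {x : R} : g • x < ⊤ ↔ x < ⊤ := by
  conv_lhs => rw [← hA.smul_top g]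
  exact hA.smul_lt_iff g

/-- The case of `not_interior_eq_empty` in which the point lies in a box over which the closure of
its orbit is a graph. -/
theorem false_of_isGraphBox (hA : TameAction G R Op Q) {s : ℕ} {H S K : Subgroup G} (hH : Op H)
    (hS : Op S) (hK : Op K) (hKH : K ≤ H) {c : Fin s → R} {y : R} (hSc : ∀ g ∈ S, g • c = c)
    (hHy : {z | ∃ h ∈ H, z = h • y}.Infinite) (hSy : {z | ∃ g ∈ S, z = g • y}.Infinite)
    {Γ : Set ((Fin s → R) × R)} (hΓ : Γ = closure {z | ∃ h ∈ H, z = h • (c, y)})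
    (hinv : ∀ h ∈ H, ∀ z ∈ Γ, h • z ∈ Γ)
    {W : Set (Fin s → R)} {O C : Set R} (hbox : IsGraphBox Γ W O C)
    (hKO : ∀ g ∈ K, ∀ y ∈ O, g • y ∈ O) (hcW : c ∈ W) (hyO : y ∈ O) : False := by
  have hcs := hA.continuousConstSMul
  have hΓc : IsClosed Γ := hΓ ▸ isClosed_closure
  have hD : ∀ h ∈ H, (h • c, h • y) ∈ Γ := fun h hh => hΓ ▸ subset_closure ⟨h, hh, rfl⟩
  have hcy : (c, y) ∈ Γ := by simpa using hD 1 H.one_mem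
  classical
  set F : (Fin s → R) → R := fun x =>
    if h : ∃ y ∈ O, (x, y) ∈ Γ then h.choose else y with hFdef
  have hF : ∀ x ∈ W, F x ∈ O ∧ (x, F x) ∈ Γ := by
    intro x hx
    obtain ⟨y', h1, h2, -⟩ := hbox.existsUnique x hx
    have h : ∃ y ∈ O, (x, y) ∈ Γ := ⟨y', h1, h2⟩
    simp only [hFdef, dif_pos h]
    exact h.choose_spec
  have hFu : ∀ x ∈ W, ∀ y' ∈ O, (x, y') ∈ Γ → F x = y' := by
    intro x hx y' h1 h2
    obtain ⟨z, -, -, hz⟩ := hbox.existsUnique x hx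
    rw [hz _ (hF x hx).1 (hF x hx).2, hz _ h1 h2]
  have hFc : ContinuousOn F W := hbox.continuousOn hΓc hF
  have hcomm : ∀ k ∈ K, ∀ x ∈ W, k • x ∈ W → F (k • x) = k • F x := by
    intro k hk x hx hkx
    exact hFu _ hkx _ (hKO k hk _ (hF x hx).1) (hinv k (hKH hk) _ (hF x hx).2)
  -- The translates of `(c, y)` are dense in the graph of `F`.
  have hmeet : ∀ V ⊆ W, IsOpen V → V.Nonempty → ∃ h ∈ H, h • c ∈ V ∧ h • y ∈ O := by
    rintro V hVW hV ⟨x, hx⟩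
    have h1 := (hF x (hVW hx)).2
    rw [hΓ] at h1
    obtain ⟨_, ⟨h2, h3⟩, h, hh, rfl⟩ := mem_closure_iff.1 h1 _ (hV.prod hbox.isOpen_fibre)
      ⟨hx, (hF x (hVW hx)).1⟩
    exact ⟨h, hh, h2, h3⟩
  -- If `F` were constant on `V`, with value some translate of `y`, then every translate of `y`
  -- would be the height of a horizontal piece of `Γ`, and `finite_flat` would make the `H`-orbit of
  -- `y` finite.
  have hnconst : ∀ V ⊆ W, IsOpen V → V.Nonempty → ¬ ∀ x ∈ V, ∀ x' ∈ V, F x = F x' := by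
    intro V hVW hV hne hconst
    obtain ⟨h1, hh1, h2, h3⟩ := hmeet V hVW hV hne
    have e1 : F (h1 • c) = h1 • y := hFu _ (hVW h2) _ h3 (hD h1 hh1)
    refine hHy ((hA.finite_flat hH hΓc hinv).subset ?_)
    rintro _ ⟨h, hh, rfl⟩
    have hg : h * h1⁻¹ ∈ H := H.mul_mem hh (H.inv_mem hh1)
    have e2 : h • y = (h * h1⁻¹) • h1 • y := by rw [mul_smul, inv_smul_smul]
    set g := h * h1⁻¹ with hgdef
    refine ⟨(fun x => g⁻¹ • x) ⁻¹' V, (fun y => g⁻¹ • y) ⁻¹' O,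
      hV.preimage (continuous_const_smul _), hbox.isOpen_fibre.preimage (continuous_const_smul _),
      ⟨g • h1 • c, by simpa using h2⟩, by simpa [e2] using h3, fun x hx z hz => ?_⟩
    have e3 : (x, z) ∈ Γ ↔ (g⁻¹ • x, g⁻¹ • z) ∈ Γ := by
      constructor
      · exact fun h4 => hinv g⁻¹ (H.inv_mem hg) _ h4
      · intro h4
        have := hinv g hg _ h4
        simpa using this
    rw [e3, e2, ← inv_smul_eq_iff]
    constructor
    · intro h4
      have h5 := hFu _ (hVW hx) _ hz h4
      rw [show g⁻¹ • z = F (g⁻¹ • x) from h5.symm, ← e1]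
      exact hconst _ hx _ h2
    · intro h4
      rw [h4, ← e1, hconst _ h2 _ hx]
      exact (hF _ (hVW hx)).2
  -- Flatness to the right at the single point `c` propagates to its translates, which are dense in
  -- `W`, and forces `F` to be constant on a box.
  by_cases hflat : ∀ i, c i < ⊤ → ∃ β > c i, ∀ t ∈ Icc (c i) β, (Function.update c i t, y) ∈ Γ
  · obtain ⟨V, h1, h2, h3, h4⟩ := hA.exists_const_box hK
      (D := {d | ∃ h ∈ H, d = h • c ∧ h • y ∈ O}) hbox.isOpen_base ⟨c, hcW⟩ (by
        intro x hx
        refine mem_closure_iff.2 fun V hV hxV => ?_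
        obtain ⟨h, hh, h1, h2⟩ := hmeet (V ∩ W) inter_subset_right (hV.inter hbox.isOpen_base)
          ⟨x, hxV, hx⟩
        exact ⟨_, h1.1, h, hh, rfl, h2⟩) hFc hcomm (by
        rintro _ ⟨h, hh, rfl, hyO'⟩ hW i hi
        obtain ⟨β, hβ, hβΓ⟩ := hflat i ((hA.smul_lt_top h).1 hi)
        have hnh : (fun t => Function.update (h • c) i t) ⁻¹' W ∈ 𝓝 ((h • c) i) :=
          (hbox.isOpen_base.preimage (continuous_update_right _ i)).mem_nhds
            (by rw [mem_preimage, Function.update_eq_self]; exact hW)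
        obtain ⟨v, hv, hvs⟩ := exists_Ico_subset_of_mem_nhds hnh ⟨_, hi⟩
        obtain ⟨β', h1, h2⟩ := exists_between (lt_min hv (hA.smul_lt h hβ))
        refine ⟨β', h1, fun t ht => ?_⟩
        rw [hFu _ hW _ hyO' (hD h hh)]
        refine hFu _ (hvs ⟨ht.1, ht.2.trans_lt (h2.trans_le (min_le_left _ _))⟩) _ hyO' ?_
        have h3 := hinv h hh _ (hβΓ (h⁻¹ • t) ⟨by
          rw [← hA.smul_le_iff h, smul_inv_smul]; exact ht.1, by
          rw [← hA.smul_le_iff h, smul_inv_smul]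
          exact ht.2.trans (h2.trans_le (min_le_right _ _)).le⟩)
        rwa [Prod.smul_mk, update_smul, smul_inv_smul] at h3)
    exact hnconst V h1 h2 h3 h4
  -- In the coordinate `i`, the function is not constant to the right of `c i`, so it has there a
  -- strictly monotone germ with value `y`, and `finite_orbit` makes the `S`-orbit of `y` finite. A
  -- decreasing germ becomes increasing when the order of the values is reversed.
  · push Not at hflat
    obtain ⟨i, hi, hnf⟩ := hflat
    have hnh : (fun t => Function.update c i t) ⁻¹' W ∈ 𝓝 (c i) :=
      (hbox.isOpen_base.preimage (continuous_update_right _ i)).mem_nhds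
        (by simpa using hcW)
    obtain ⟨v, hv, hvs⟩ := exists_Ico_subset_of_mem_nhds hnh ⟨_, hi⟩
    obtain ⟨β, hβ1, hβ2⟩ := exists_between hv
    have hsubW : ∀ t ∈ Icc (c i) β, Function.update c i t ∈ W := fun t ht =>
      hvs ⟨ht.1, ht.2.trans_lt hβ2⟩
    set f : R → R := fun t => F (Function.update c i t) with hf
    have hfx : f (c i) = y := by
      simp only [hf, Function.update_eq_self]
      exact hFu c hcW y hyO hcy
    have hSi : ∀ k ∈ S, k • c i = c i := fun k hk => congrFun (hSc k hk) i
    have hfcont : ContinuousOn f (Icc (c i) β) :=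
      hFc.comp (f := fun t => Function.update c i t)
        (continuous_update_right _ i).continuousOn hsubW
    have hfcomm : ∀ k ∈ K ⊓ S, ∀ t ∈ Icc (c i) β, k • t ∈ Icc (c i) β → f (k • t) = k • f t := by
      rintro k ⟨hk, hkS⟩ t ht hkt
      have e : Function.update c i (k • t) = k • Function.update c i t := by
        rw [update_smul, hSc k hkS]
      simp only [hf]
      rw [e]
      exact hcomm k hk _ (hsubW t ht) (e ▸ hsubW _ hkt)
    obtain ⟨b, hbQ, hb1, hb2, hmon⟩ := hA.strictMono_germ (hA.inf hK hS) hβ1 hfcont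
      (fun k hk => hSi k hk.2) hfcomm (by
        intro b' hb'
        obtain ⟨t, ht, htΓ⟩ := hnf b' hb'.1
        refine ⟨t, ht, fun e => htΓ ?_⟩
        rw [hfx] at e
        have := (hF _ (hsubW t ⟨ht.1, ht.2.trans hb'.2⟩)).2
        rwa [show F (Function.update c i t) = y from e] at this)
    have hsub : Icc (c i) b ⊆ Icc (c i) β := Icc_subset_Icc le_rfl hb2.le
    have hfcomm' : ∀ k ∈ K ⊓ S ⊓ stabilizer G b, ∀ t ∈ Icc (c i) b, f (k • t) = k • f t :=
      fun k hk t ht => hfcomm k hk.1 t (hsub ht) (hsub (hA.smul_mem_Icc (hSi k hk.1.2) hk.2 ht))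
    have hH' := hA.inf (hA.inf hK hS) (hA.stab hbQ)
    refine hSy ?_
    rcases hmon with hmon | hmon
    · have hg : MonoGerm (K ⊓ S ⊓ stabilizer G b) (c i) b f :=
        ⟨hA.smul_lt, hfcont.mono hsub, hmon, fun k hk => hSi k hk.1.2, fun k hk => hk.2, hfcomm'⟩
      have := hg.finite_orbit hA hS hH' hb1 hSi (fun hK => hA.tame hK)
      rwa [hfx] at this
    · have hg : MonoGerm (Y := Rᵒᵈ) (K ⊓ S ⊓ stabilizer G b) (c i) b (fun t => OrderDual.toDual (f t)) :=
        ⟨fun g y y' h => hA.smul_lt g h, hfcont.mono hsub, fun t ht t' ht' h => hmon ht ht' h,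
          fun k hk => hSi k hk.1.2, fun k hk => hk.2, hfcomm'⟩
      have := hg.finite_orbit hA hS hH' hb1 hSi (fun hK => hA.tame hK)
      rw [hfx] at this
      exact this

/-- If `S` fixes the tuple `c` and moves `y` infinitely often, and the `H`-orbit of `c` is somewhere
dense, then so is the `H`-orbit of `(c, y)`. -/
theorem interior_closure_ne_empty (hA : TameAction G R Op Q) {s : ℕ} {H S : Subgroup G} (hH : Op H)
    (hS : Op S) {c : Fin s → R} {y : R} (hSc : ∀ g ∈ S, g • c = c)
    (hHy : {z | ∃ h ∈ H, z = h • y}.Infinite) (hSy : {z | ∃ g ∈ S, z = g • y}.Infinite)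
    (hne : (interior (closure {z | ∃ h ∈ H, z = h • c})).Nonempty) :
    (interior (closure {z | ∃ h ∈ H, z = h • (c, y)})).Nonempty := by
  have hcs := hA.continuousConstSMul
  by_contra hemp
  rw [Set.not_nonempty_iff_eq_empty] at hemp
  set Γ := closure {z | ∃ h ∈ H, z = h • (c, y)} with hΓ
  have hinv : ∀ h ∈ H, ∀ z ∈ Γ, h • z ∈ Γ := by
    intro h hh z hz
    refine map_mem_closure (continuous_const_smul h) hz ?_
    rintro _ ⟨h', hh', rfl⟩
    exact ⟨h * h', H.mul_mem hh hh', (mul_smul _ _ _).symm⟩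
  have hΓc : IsClosed Γ := isClosed_closure
  obtain ⟨W, O, C, K, -, ⟨x, hx⟩, hbox, hK, hKH, hKO⟩ := hA.exists_isGraphBox hH hΓc hinv hemp
    isOpen_interior hne (by
      intro x hx
      have h1 := isClosed_proj hΓc isClosed_univ
      have h2 : closure {z | ∃ h ∈ H, z = h • c} ⊆ {x | ∃ y ∈ univ, (x, y) ∈ Γ} := by
        refine closure_minimal ?_ h1
        rintro _ ⟨h, hh, rfl⟩
        exact ⟨h • y, trivial, subset_closure ⟨h, hh, rfl⟩⟩
      obtain ⟨y, -, hy⟩ := h2 (interior_subset hx)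
      exact ⟨y, hy⟩)
  obtain ⟨y', hy'O, hy'Γ, -⟩ := hbox.existsUnique x hx
  -- Some translate of `(c, y)` lies in the graph box. The hypotheses pass to translates, with `S`
  -- replaced by its conjugate.
  obtain ⟨_, ⟨h1, h2⟩, g, hg, rfl⟩ := mem_closure_iff.1 hy'Γ _
    (hbox.isOpen_base.prod hbox.isOpen_fibre) ⟨hx, hy'O⟩
  refine hA.false_of_isGraphBox hH (hA.conj g hS) hK hKH (c := g • c) (y := g • y) ?_ ?_ ?_ ?_ hinv
    hbox hKO h1 h2
  · rintro _ ⟨k, hk, rfl⟩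
    simp [MulAut.conj_apply, mul_smul, hSc k hk]
  · refine hHy.mono ?_
    rintro _ ⟨h, hh, rfl⟩
    exact ⟨h * g⁻¹, H.mul_mem hh (H.inv_mem hg), by rw [mul_smul, inv_smul_smul]⟩
  · refine (hSy.image (MulAction.injective g).injOn).mono ?_
    rintro _ ⟨_, ⟨k, hk, rfl⟩, rfl⟩
    exact ⟨_, ⟨k, hk, rfl⟩, by simp [MulAut.conj_apply, mul_smul]⟩
  · rw [hΓ]
    congr 1
    ext z
    constructor
    · rintro ⟨h, hh, rfl⟩
      exact ⟨h * g⁻¹, H.mul_mem hh (H.inv_mem hg), by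
        rw [← Prod.smul_mk, mul_smul, inv_smul_smul]⟩
    · rintro ⟨h, hh, rfl⟩
      exact ⟨h * g, H.mul_mem hh hg, by rw [← Prod.smul_mk, mul_smul]⟩

end TameAction
end TameCoreFinal

/-! ### Open subgroups, smooth actions and a rank for stabilizers -/

section OpenSubgroups

open MulAction

/-- The conjugate `g H g⁻¹`. -/
abbrev cj {G : Type*} [Group G] (g : G) (H : Subgroup G) : Subgroup G :=
  H.map (MulAut.conj g).toMonoidHom

/-- A filter of subgroups, invariant under conjugation, such that any two of its members have
finitely many double cosets. -/
structure OpenSubgroups {G : Type*} [Group G] (Op : Subgroup G → Prop) : Prop where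
  top : Op ⊤
  mono : ∀ {H K : Subgroup G}, H ≤ K → Op H → Op K
  inf : ∀ {H K : Subgroup G}, Op H → Op K → Op (H ⊓ K)
  conj : ∀ {H : Subgroup G} (g : G), Op H → Op (cj g H)
  cover : ∀ {H K : Subgroup G}, Op H → Op K → ∃ F : Set G, F.Finite ∧
    ∀ g, ∃ h ∈ H, ∃ f ∈ F, ∃ k ∈ K, g = h * f * k

section Conj

variable {G : Type*} [Group G]

theorem mem_cj {g x : G} {H : Subgroup G} : x ∈ cj g H ↔ g⁻¹ * x * g ∈ H := by
  constructor
  · rintro ⟨h, hh, rfl⟩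
    simpa [MulAut.conj_apply, mul_assoc] using hh
  · intro h
    exact ⟨_, h, by simp [MulAut.conj_apply, mul_assoc]⟩

theorem cj_mul (g g' : G) (H : Subgroup G) : cj (g * g') H = cj g (cj g' H) := by
  ext x
  simp only [mem_cj, mul_inv_rev, mul_assoc]

theorem cj_one (H : Subgroup G) : cj 1 H = H := by
  ext x
  simp

theorem cj_inv_cj (g : G) (H : Subgroup G) : cj g⁻¹ (cj g H) = H := by
  rw [← cj_mul, inv_mul_cancel, cj_one]

theorem cj_inf (g : G) (H K : Subgroup G) : cj g (H ⊓ K) = cj g H ⊓ cj g K := by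
  ext x
  simp only [mem_cj, Subgroup.mem_inf]

theorem cj_mono (g : G) {H K : Subgroup G} (h : H ≤ K) : cj g H ≤ cj g K :=
  Subgroup.map_mono h

theorem cj_of_mem {g : G} {H : Subgroup G} (hg : g ∈ H) : cj g H = H := by
  ext x
  rw [mem_cj, Subgroup.mul_mem_cancel_right _ hg, Subgroup.mul_mem_cancel_left _ (H.inv_mem hg)]

theorem relIndex_cj (g : G) (H K : Subgroup G) : (cj g H).relIndex (cj g K) = H.relIndex K :=
  Subgroup.relIndex_map_map_of_injective H K (MulAut.conj g).injective

theorem cj_stabilizer {α : Type*} [MulAction G α] (g : G) (a : α) :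
    stabilizer G (g • a) = cj g (stabilizer G a) := by
  ext x
  rw [mem_cj, mem_stabilizer_iff, mem_stabilizer_iff, mul_smul, mul_smul, inv_smul_eq_iff]

/-- The relative index is 0 exactly when it is infinite, so algebraicity becomes a statement on
subgroups. -/
theorem relIndex_stabilizer {α : Type*} [MulAction G α] (H : Subgroup G) (a : α) :
    (stabilizer G a).relIndex H = 0 ↔ {z | ∃ h ∈ H, z = h • a}.Infinite := by
  have e1 : (stabilizer G a).relIndex H = (orbit H a).ncard := by
    rw [← index_stabilizer]
    rfl
  have e2 : {z | ∃ h ∈ H, z = h • a} = orbit H a := by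
    ext z
    constructor
    · rintro ⟨h, hh, rfl⟩
      exact ⟨⟨h, hh⟩, rfl⟩
    · rintro ⟨⟨h, hh⟩, rfl⟩
      exact ⟨h, hh, rfl⟩
  rw [e1, e2]
  constructor
  · intro h hf
    exact ((Set.ncard_pos hf).2 ⟨a, mem_orbit_self a⟩).ne' h
  · exact fun h => h.ncard

theorem relIndex_stabilizer_ne {α : Type*} [MulAction G α] (H : Subgroup G) (a : α) :
    (stabilizer G a).relIndex H ≠ 0 ↔ {z | ∃ h ∈ H, z = h • a}.Finite := by
  rw [Ne, relIndex_stabilizer, Set.not_infinite]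

theorem relIndex_ne_zero_mono {H K L : Subgroup G} (h : L ≤ K) (hH : H.relIndex K ≠ 0) :
    H.relIndex L ≠ 0 :=
  mt (Subgroup.relIndex_eq_zero_of_le_right h) hH

end Conj

namespace OpenSubgroups

variable {G : Type*} [Group G] {Op : Subgroup G → Prop}

/-- An action with finitely many orbits and open point stabilizers. -/
structure SmoothAction {G : Type*} [Group G] (Op : Subgroup G → Prop) (α : Type*) [MulAction G α] :
    Prop where
  stab : ∀ a : α, Op (stabilizer G a)
  orbits : ∃ F : Set α, F.Finite ∧ ∀ a, ∃ f ∈ F, ∃ g : G, a = g • f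

/-- The `H`-orbits inside the orbit of `f` correspond to the double cosets of `H` and the stabilizer
of `f`. -/
theorem SmoothAction.cover {α : Type*} [MulAction G α] (hα : SmoothAction Op α)
    (hO : OpenSubgroups Op) {H : Subgroup G} (hH : Op H) :
    ∃ F : Set α, F.Finite ∧ ∀ a, ∃ f ∈ F, ∃ h ∈ H, a = h • f := by
  obtain ⟨F, hF, hcov⟩ := hα.orbits
  choose F' hF' hcov' using fun f : α => hO.cover hH (hα.stab f)
  refine ⟨⋃ f ∈ F, (fun φ => φ • f) '' F' f, hF.biUnion fun f _ => (hF' f).image _, fun a => ?_⟩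
  obtain ⟨f, hf, g, rfl⟩ := hcov a
  obtain ⟨h, hh, φ, hφ, k, hk, rfl⟩ := hcov' f g
  refine ⟨φ • f, mem_biUnion hf ⟨φ, hφ, rfl⟩, h, hh, ?_⟩
  rw [mul_smul, mul_smul, show k • f = f from hk]

theorem SmoothAction.prod {α β : Type*} [MulAction G α] [MulAction G β] (hα : SmoothAction Op α)
    (hβ : SmoothAction Op β) (hO : OpenSubgroups Op) : SmoothAction Op (α × β) := by
  refine ⟨fun a => ?_, ?_⟩
  · refine hO.mono ?_ (hO.inf (hα.stab a.1) (hβ.stab a.2))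
    rintro g ⟨h1, h2⟩
    exact Prod.ext h1 h2
  · obtain ⟨F, hF, hcov⟩ := hα.orbits
    choose F' hF' hcov' using fun a : α => hβ.cover hO (hα.stab a)
    refine ⟨⋃ f ∈ F, (fun b => (f, b)) '' F' f, hF.biUnion fun f _ => (hF' f).image _, ?_⟩
    rintro ⟨a, b⟩
    obtain ⟨f, hf, g, rfl⟩ := hcov a
    obtain ⟨b', hb', h, hh, e⟩ := hcov' f (g⁻¹ • b)
    refine ⟨(f, b'), mem_biUnion hf ⟨b', hb', rfl⟩, g * h, ?_⟩
    rw [Prod.smul_mk, mul_smul, mul_smul, ← e, smul_inv_smul, show h • f = f from hh]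

theorem SmoothAction.of_surjective {α β : Type*} [MulAction G α] [MulAction G β]
    (hα : SmoothAction Op α) (hO : OpenSubgroups Op) (φ : α → β) (hφ : Function.Surjective φ)
    (hg : ∀ (g : G) a, φ (g • a) = g • φ a) : SmoothAction Op β := by
  refine ⟨fun b => ?_, ?_⟩
  · obtain ⟨a, rfl⟩ := hφ b
    refine hO.mono ?_ (hα.stab a)
    intro g hga
    rw [mem_stabilizer_iff, ← hg, show g • a = a from hga]
  · obtain ⟨F, hF, hcov⟩ := hα.orbits
    refine ⟨φ '' F, hF.image _, fun b => ?_⟩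
    obtain ⟨a, rfl⟩ := hφ b
    obtain ⟨f, hf, g, rfl⟩ := hcov a
    exact ⟨φ f, ⟨f, hf, rfl⟩, g, hg g f⟩

theorem SmoothAction.pi_fin {α : Type*} [MulAction G α] (hα : SmoothAction Op α)
    (hO : OpenSubgroups Op) (n : ℕ) : SmoothAction Op (Fin n → α) := by
  induction n with
  | zero =>
    refine ⟨fun a => hO.mono (fun g _ => Subsingleton.elim _ _) hO.top,
      ⟨{Fin.elim0}, finite_singleton _, fun a => ⟨Fin.elim0, rfl, 1, Subsingleton.elim _ _⟩⟩⟩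
  | succ n ih =>
    refine (hα.prod ih hO).of_surjective hO (fun p => Fin.cons p.1 p.2) (fun v => ?_) ?_
    · exact ⟨(v 0, Fin.tail v), Fin.cons_self_tail v⟩
    · intro g a
      funext i
      refine Fin.cases ?_ (fun j => ?_) i <;> simp

theorem SmoothAction.pi {α : Type*} [MulAction G α] (hα : SmoothAction Op α)
    (hO : OpenSubgroups Op) (ι : Type*) [Finite ι] : SmoothAction Op (ι → α) := by
  obtain ⟨n, ⟨e⟩⟩ := Finite.exists_equiv_fin ι
  refine (hα.pi_fin hO n).of_surjective hO (fun v => v ∘ e) (fun v => ⟨v ∘ e.symm, ?_⟩)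
    fun g a => rfl
  funext i
  simp

theorem SmoothAction.quotient (hO : OpenSubgroups Op) {K : Subgroup G} (hK : Op K) :
    SmoothAction Op (G ⧸ K) := by
  have key : ∀ a : G ⧸ K, ∃ g : G, a = g • ((1 : G) : G ⧸ K) := fun a => by
    obtain ⟨g, rfl⟩ := QuotientGroup.mk_surjective a
    exact ⟨g, show (g : G ⧸ K) = ((g * 1 : G) : G ⧸ K) by rw [mul_one]⟩
  refine ⟨fun a => ?_, ⟨{((1 : G) : G ⧸ K)}, finite_singleton _, fun a => ?_⟩⟩
  · obtain ⟨g, rfl⟩ := key a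
    rw [cj_stabilizer]
    refine hO.conj g ?_
    rwa [MulAction.stabilizer_quotient]
  · obtain ⟨g, e⟩ := key a
    exact ⟨_, rfl, g, e⟩

/-- An open subgroup of infinite index in `K` has a conjugate which has infinite index in a given
open subgroup of `K`. -/
theorem exists_relIndex_eq_zero (hO : OpenSubgroups Op) {T K K' : Subgroup G} (hT : Op T)
    (hK' : Op K') (hT0 : T.relIndex K = 0) (hKK : K' ≤ K) (hTK : T ≤ K) :
    ∃ k ∈ K, (cj k T).relIndex K' = 0 := by
  by_contra hcon
  push Not at hcon
  -- The infinite set `K / T` splits into finitely many `K'`-orbits; if the conjugates all had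
  -- finite index in `K'`, these orbits would be finite.
  obtain ⟨F, hF, hcov⟩ := hO.cover hK' hT
  have e : stabilizer G ((1 : G) : G ⧸ T) = T := MulAction.stabilizer_quotient T
  refine (relIndex_stabilizer K ((1 : G) : G ⧸ T)).1 (by rwa [e]) ?_
  refine Set.Finite.subset (s := ⋃ f ∈ F ∩ K, {z | ∃ h ∈ K', z = h • f • ((1 : G) : G ⧸ T)})
    ((hF.inter_of_left _).biUnion fun f hf => ?_) ?_
  · rw [← relIndex_stabilizer_ne, cj_stabilizer, e]
    exact hcon f hf.2
  · rintro _ ⟨k, hk, rfl⟩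
    obtain ⟨h, hh, f, hf, t, ht, rfl⟩ := hcov k
    have hfK : f ∈ K := by
      rwa [Subgroup.mul_mem_cancel_right _ (hTK ht), Subgroup.mul_mem_cancel_left _ (hKK hh)] at hk
    refine mem_biUnion ⟨hf, hfK⟩ ⟨h, hh, ?_⟩
    have ht' : t • ((1 : G) : G ⧸ T) = ((1 : G) : G ⧸ T) := by
      rw [← mem_stabilizer_iff, e]; exact ht
    rw [mul_smul, mul_smul, ht']

end OpenSubgroups

/-- The rank over `H` of a point with stabilizer `P` is at least `n`. -/
def RkGE {G : Type*} [Group G] (Op : Subgroup G → Prop) : ℕ → Subgroup G → Subgroup G → Prop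
  | 0, _, _ => True
  | n + 1, P, H => ∃ K T, Op T ∧ T ≤ K ∧ K ≤ H ∧ T.relIndex K = 0 ∧ T.relIndex (K ⊓ P) ≠ 0 ∧
      RkGE Op n P T

namespace RkGE

variable {G : Type*} [Group G] {Op : Subgroup G → Prop} {P Q H H' : Subgroup G} {n m : ℕ}

theorem mono (h : RkGE Op n P H) (hH : H ≤ H') : RkGE Op n P H' := by
  cases n with
  | zero => trivial
  | succ n =>
    obtain ⟨K, T, h1, h2, h3, h4⟩ := h
    exact ⟨K, T, h1, h2, h3.trans hH, h4⟩

theorem pred (h : RkGE Op (n + 1) P H) : RkGE Op n P H := by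
  obtain ⟨K, T, -, h2, h3, -, -, h4⟩ := h
  exact h4.mono (h2.trans h3)

theorem of_le (h : RkGE Op n P H) (hmn : m ≤ n) : RkGE Op m P H := by
  induction n, hmn using Nat.le_induction with
  | base => exact h
  | succ n _ ih => exact ih h.pred

theorem conj (hO : OpenSubgroups Op) (g : G) (h : RkGE Op n P H) :
    RkGE Op n (cj g P) (cj g H) := by
  induction n generalizing H with
  | zero => trivial
  | succ n ih =>
    obtain ⟨K, T, h1, h2, h3, h4, h5, h6⟩ := h
    exact ⟨cj g K, cj g T, hO.conj g h1, cj_mono g h2, cj_mono g h3, by rwa [relIndex_cj],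
      by rwa [← cj_inf, relIndex_cj], ih h6⟩

/-- Every point has a conjugate over `H` whose rank over a smaller open subgroup is the same. -/
theorem exists_conj (hO : OpenSubgroups Op) (h : RkGE Op n P H) (hH' : Op H') (hHH : H' ≤ H) :
    ∃ g ∈ H, RkGE Op n (cj g P) H' := by
  induction n generalizing H P H' with
  | zero => exact ⟨1, H.one_mem, trivial⟩
  | succ n ih =>
    obtain ⟨K, T, hT, hTK, hKH, hT0, hTP, hn⟩ := h
    have hK' : Op (H' ⊓ K) := hO.inf hH' (hO.mono hTK hT)
    -- The witness `T` is moved by `k` so as to have infinite index in the smaller group. The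
    -- element `t` given by the induction hypothesis lies in the moved `T` and does not change it.
    obtain ⟨k, hk, hk0⟩ := hO.exists_relIndex_eq_zero hT hK' hT0 inf_le_right hTK
    obtain ⟨t, ht, htn⟩ := ih (hn.conj hO k) (hO.inf hK' (hO.conj k hT)) inf_le_right
    have htT : cj t (cj k T) = cj k T := cj_of_mem ht
    have htK : t ∈ K := by
      have := cj_mono k hTK ht
      rwa [cj_of_mem hk] at this
    have hK : cj t (cj k K) = K := by rw [cj_of_mem hk, cj_of_mem htK]
    refine ⟨t * k, hKH (K.mul_mem htK hk), H' ⊓ K, H' ⊓ K ⊓ cj k T, hO.inf hK' (hO.conj k hT),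
      inf_le_left, inf_le_left, ?_, ?_, ?_⟩
    · rwa [inf_comm, Subgroup.inf_relIndex_right]
    · have h1 : (cj k T).relIndex (K ⊓ cj (t * k) P) ≠ 0 := by
        rw [← htT, cj_mul]
        nth_rewrite 1 [← hK]
        rwa [← cj_inf, ← cj_inf, relIndex_cj, relIndex_cj]
      have h2 := relIndex_ne_zero_mono (inf_le_inf_right (cj (t * k) P) (inf_le_right :
        H' ⊓ K ≤ K)) h1
      rw [← Subgroup.inf_relIndex_right] at h2 ⊢
      convert h2 using 2
      ext x
      simp only [Subgroup.mem_inf]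
      tauto
    · rwa [cj_mul]

theorem inf_of_mem (h : RkGE Op m Q (H ⊓ P)) : RkGE Op m (P ⊓ Q) H := by
  suffices ∀ T ≤ P, RkGE Op m Q T → RkGE Op m (P ⊓ Q) T from
    (this _ inf_le_right h).mono inf_le_left
  clear h
  induction m with
  | zero => exact fun _ _ _ => trivial
  | succ m ih =>
    rintro H hHP ⟨K, T, h1, h2, h3, h4, h5, h6⟩
    refine ⟨K, T, h1, h2, h3, h4, ?_, ih T (h2.trans (h3.trans hHP)) h6⟩
    rwa [← inf_assoc, inf_eq_left.2 (h3.trans hHP)]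

/-- A step `T` for `P` is also a step for the pair. To continue, the rank of `Q` over `H ⊓ P` must
survive over `T ⊓ P`, which `exists_conj` achieves after moving `Q` by an element of `H ⊓ P`. Such
an element leaves `P` and `H` unchanged, and the move is undone at the end. -/
theorem add (hO : OpenSubgroups Op) (hP : Op P) (h1 : RkGE Op n P H) (h2 : RkGE Op m Q (H ⊓ P)) :
    RkGE Op (n + m) (P ⊓ Q) H := by
  induction n generalizing H P Q with
  | zero => rw [zero_add]; exact h2.inf_of_mem
  | succ n ih =>
    obtain ⟨K, T, hT, hTK, hKH, hT0, hTP, hn⟩ := h1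
    obtain ⟨g, hg, hgm⟩ := h2.exists_conj hO (hO.inf hT hP)
      (inf_le_inf_right P (hTK.trans hKH))
    have h3 := ih hP hn hgm
    have h4 : RkGE Op (n + 1 + m) (P ⊓ cj g Q) H := by
      rw [add_right_comm]
      exact ⟨K, T, hT, hTK, hKH, hT0, relIndex_ne_zero_mono (inf_le_inf_left K inf_le_left) hTP, h3⟩
    have h5 := h4.conj hO g⁻¹
    rwa [cj_inf, cj_inv_cj, cj_of_mem (H.inv_mem hg.1), cj_of_mem (P.inv_mem hg.2)] at h5

/-- Every step for the pair is counted for `P` if `T` has finite index over `K ⊓ P`; otherwise it is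
a step for `Q` over `P`. -/
theorem exists_add (hO : OpenSubgroups Op) (hP : Op P) (h : RkGE Op n (P ⊓ Q) H) :
    ∃ i j, i + j = n ∧ RkGE Op i P H ∧ RkGE Op j Q (H ⊓ P) := by
  induction n generalizing H with
  | zero => exact ⟨0, 0, rfl, trivial, trivial⟩
  | succ n ih =>
    obtain ⟨K, T, hT, hTK, hKH, hT0, hTP, hn⟩ := h
    obtain ⟨i, j, hij, hi, hj⟩ := ih hn
    by_cases hcase : T.relIndex (K ⊓ P) = 0
    · refine ⟨i, j + 1, by omega, hi.mono (hTK.trans hKH), K ⊓ P, T ⊓ P, hO.inf hT hP,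
        inf_le_inf_right P hTK, inf_le_inf_right P hKH,
        Subgroup.relIndex_eq_zero_of_le_left inf_le_left hcase, ?_, hj⟩
      rw [inf_assoc, ← Subgroup.inf_relIndex_right]
      rw [← Subgroup.inf_relIndex_right] at hTP
      convert hTP using 2
      ext x
      simp only [Subgroup.mem_inf]
      tauto
    · exact ⟨i + 1, j, by omega, ⟨K, T, hT, hTK, hKH, hT0, hcase, hi⟩,
        hj.mono (inf_le_inf_right P (hTK.trans hKH))⟩

end RkGE

end OpenSubgroups

/-! ### Additivity of the rank and independent sequences -/

section NumericalRank

open MulAction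

variable {G : Type*} [Group G] {Op : Subgroup G → Prop}

/-- The rank over `H` of a point with stabilizer `P`. -/
noncomputable def rk (Op : Subgroup G → Prop) (P H : Subgroup G) : ℕ := sSup {n | RkGE Op n P H}

/-- An `OpenSubgroups` family with finite ranks. -/
structure FiniteRk {G : Type*} [Group G] (Op : Subgroup G → Prop) : Prop extends OpenSubgroups Op
    where
  finite : ∀ {P : Subgroup G}, Op P → ∃ n, ¬ RkGE Op n P ⊤

namespace FiniteRk

variable {P Q H H' A B D : Subgroup G}

theorem rkGE_iff (hO : FiniteRk Op) (hP : Op P) (H : Subgroup G) (n : ℕ) :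
    RkGE Op n P H ↔ n ≤ rk Op P H := by
  obtain ⟨N, hN⟩ := hO.finite hP
  have hb : BddAbove {n | RkGE Op n P H} := ⟨N, fun n hn => by
    by_contra hlt
    exact hN ((RkGE.mono hn le_top).of_le (by omega))⟩
  constructor
  · exact fun h => le_csSup hb h
  · exact fun h => RkGE.of_le (Nat.sSup_mem (s := {n | RkGE Op n P H}) ⟨0, trivial⟩ hb) h

theorem rk_mono (hO : FiniteRk Op) (hP : Op P) (h : H ≤ H') : rk Op P H ≤ rk Op P H' :=
  (hO.rkGE_iff hP _ _).1 (((hO.rkGE_iff hP _ _).2 le_rfl).mono h)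

theorem rk_conj (hO : FiniteRk Op) (hP : Op P) (g : G) :
    rk Op (cj g P) (cj g H) = rk Op P H := by
  refine le_antisymm ?_ ?_
  · have := ((hO.rkGE_iff (hO.conj g hP) (cj g H) _).2 le_rfl).conj hO.toOpenSubgroups g⁻¹
    rw [cj_inv_cj, cj_inv_cj] at this
    exact (hO.rkGE_iff hP _ _).1 this
  · exact (hO.rkGE_iff (hO.conj g hP) _ _).1
      (((hO.rkGE_iff hP _ _).2 le_rfl).conj hO.toOpenSubgroups g)

theorem rk_inf (hO : FiniteRk Op) (hP : Op P) (hQ : Op Q) (H : Subgroup G) :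
    rk Op (P ⊓ Q) H = rk Op P H + rk Op Q (H ⊓ P) := by
  refine le_antisymm ?_ ?_
  · obtain ⟨i, j, hij, hi, hj⟩ := RkGE.exists_add hO.toOpenSubgroups hP
      ((hO.rkGE_iff (hO.inf hP hQ) H _).2 le_rfl)
    rw [← hij]
    exact add_le_add ((hO.rkGE_iff hP _ _).1 hi) ((hO.rkGE_iff hQ _ _).1 hj)
  · exact (hO.rkGE_iff (hO.inf hP hQ) _ _).1 (RkGE.add hO.toOpenSubgroups hP
      ((hO.rkGE_iff hP _ _).2 le_rfl) ((hO.rkGE_iff hQ _ _).2 le_rfl))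

/-- Existence of extensions of full rank: this is the source of independent conjugates. -/
theorem exists_rk_eq (hO : FiniteRk Op) (hP : Op P) (hH' : Op H') (h : H' ≤ H) :
    ∃ g ∈ H, rk Op (cj g P) H' = rk Op P H := by
  obtain ⟨g, hg, h1⟩ := ((hO.rkGE_iff hP H _).2 le_rfl).exists_conj hO.toOpenSubgroups hH' h
  refine ⟨g, hg, le_antisymm ?_ ((hO.rkGE_iff (hO.conj g hP) _ _).1 h1)⟩
  calc rk Op (cj g P) H' ≤ rk Op (cj g P) H := hO.rk_mono (hO.conj g hP) h
    _ = rk Op (cj g P) (cj g H) := by rw [cj_of_mem hg]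
    _ = rk Op P H := hO.rk_conj hP g

/-- If a point `c` with stabilizer `C`, fixed by `H'`, is algebraic over `P` but not over `H`, then
`P` has a smaller rank over `H'` than over `H`. -/
theorem rk_lt_rk (hO : FiniteRk Op) {C : Subgroup G} (hP : Op P) (hH : Op H) (hC : Op C)
    (hHH : H' ≤ H) (hHC : H' ≤ C) (h0 : C.relIndex H = 0) (h1 : C.relIndex (H ⊓ P) ≠ 0) :
    rk Op P H' < rk Op P H := by
  refine (hO.rkGE_iff hP H _).1 ⟨H, H ⊓ C, hO.inf hH hC, inf_le_left, le_rfl, ?_, ?_, ?_⟩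
  · rwa [inf_comm, Subgroup.inf_relIndex_right]
  · rw [← Subgroup.inf_relIndex_right] at h1 ⊢
    convert h1 using 2
    ext x
    simp only [Subgroup.mem_inf]
    tauto
  · exact ((hO.rkGE_iff hP H' _).2 le_rfl).mono (le_inf hHH hHC)

theorem relIndex_ne_zero_of_rk (hO : FiniteRk Op) (hP : Op P) (hH : Op H) (h : rk Op P H = 0) :
    P.relIndex H ≠ 0 := by
  intro h0
  have : RkGE Op 1 P H := ⟨H, H ⊓ P, hO.inf hH hP, inf_le_left, le_rfl, by
    rwa [inf_comm, Subgroup.inf_relIndex_right], by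
    rw [Subgroup.relIndex_self]; exact one_ne_zero, trivial⟩
  have := (hO.rkGE_iff hP H 1).1 this
  omega

/-- A long independent sequence of conjugates of `B` over `A`. The point `c`, with stabilizer `C`,
is definable over `A ⊓ B` but not algebraic over `A` or over `B`. -/
theorem exists_sequence (hO : FiniteRk Op) {C : Subgroup G} (hA : Op A) (hB : Op B) (hD : Op D)
    (hind : rk Op (A ⊓ B) ⊤ = rk Op A ⊤ + rk Op B ⊤) (hC : A ⊓ B ≤ C) (hCA : C.relIndex A = 0)
    (hCB : C.relIndex B = 0) :
    ∃ (δ : G) (g : ℕ → G) (E : ℕ → Subgroup G), E 0 = cj δ D ∧ (∀ n, g n ∈ A) ∧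
      (∀ n, E (n + 1) = E n ⊓ cj (g n) B) ∧ (∀ n, Op (E n)) ∧
      (∀ n, (cj (g n) C).relIndex (A ⊓ E n) = 0) ∧
      ∀ n, ∀ i < n, (cj (g i) C).relIndex (E n) = 0 := by
  have hOpC : Op C := hO.mono hC (hO.inf hA hB)
  have htop : ∀ g : G, cj g (⊤ : Subgroup G) = ⊤ := fun g => cj_of_mem (Subgroup.mem_top g)
  have hBA : rk Op B A = rk Op B ⊤ := by
    have := hO.rk_inf hA hB ⊤
    rw [top_inf_eq] at this
    omega
  -- The parameter with stabilizer `D` is moved so as to be independent from the point with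
  -- stabilizer `A`.
  obtain ⟨δ, -, hδD⟩ := hO.exists_rk_eq hD hA (le_top : A ≤ ⊤)
  have hstep : ∀ P : Subgroup G, ∃ g ∈ A, Op P → P ≤ A → rk Op (cj g B) P = rk Op B ⊤ := by
    intro P
    by_cases h : Op P ∧ P ≤ A
    · obtain ⟨g, hg, e⟩ := hO.exists_rk_eq hB h.1 h.2
      exact ⟨g, hg, fun _ _ => e.trans hBA⟩
    · exact ⟨1, A.one_mem, fun h1 h2 => absurd ⟨h1, h2⟩ h⟩
  choose γ hγA hγ using hstep
  -- `E n` fixes the moved parameter and the first `n` conjugates of the point of `B`; the next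
  -- conjugate is chosen of full rank over `A ⊓ E n`.
  set E : ℕ → Subgroup G := fun n => Nat.rec (cj δ D) (fun _ E => E ⊓ cj (γ (A ⊓ E)) B) n with hE
  set g : ℕ → G := fun n => γ (A ⊓ E n) with hg
  have hEs : ∀ n, E (n + 1) = E n ⊓ cj (g n) B := fun n => rfl
  have hgA : ∀ n, g n ∈ A := fun n => hγA _
  have hOpE : ∀ n, Op (E n) := by
    intro n
    induction n with
    | zero => exact hO.conj δ hD
    | succ n ih => rw [hEs]; exact hO.inf ih (hO.conj _ hB)
  have hOpP : ∀ n, Op (A ⊓ E n) := fun n => hO.inf hA (hOpE n)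
  have hOpB : ∀ n, Op (cj (g n) B) := fun n => hO.conj _ hB
  have hrkB : ∀ n, rk Op (cj (g n) B) ⊤ = rk Op B ⊤ := fun n => by
    conv_lhs => rw [← htop (g n)]
    exact hO.rk_conj hB _
  have hrkP : ∀ n, rk Op (A ⊓ E n) ⊤ = rk Op A ⊤ + rk Op D ⊤ + n * rk Op B ⊤ := by
    intro n
    induction n with
    | zero =>
      have := hO.rk_inf hA (hO.conj δ hD) ⊤
      rw [top_inf_eq, hδD] at this
      rw [show E 0 = cj δ D from rfl, this]
      ring
    | succ n ih =>
      have := hO.rk_inf (hOpP n) (hOpB n) ⊤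
      rw [top_inf_eq, hγ _ (hOpP n) inf_le_left, inf_assoc] at this
      rw [hEs, this, ih]
      ring
  have hrkE : ∀ n, rk Op (E n) ⊤ ≤ rk Op D ⊤ + n * rk Op B ⊤ := by
    intro n
    induction n with
    | zero =>
      have := hO.rk_conj (H := ⊤) hD δ
      rw [htop] at this
      rw [show E 0 = cj δ D from rfl, this]
      omega
    | succ n ih =>
      have := hO.rk_inf (hOpE n) (hOpB n) ⊤
      have h2 := hO.rk_mono (hOpB n) (le_top : ⊤ ⊓ E n ≤ ⊤)
      rw [hrkB] at h2
      rw [hEs, this, add_mul]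
      omega
  have hAB : ∀ n, rk Op (A ⊓ cj (g n) B) ⊤ = rk Op A ⊤ + rk Op B ⊤ := fun n => by
    rw [← hind, ← cj_of_mem (hgA n), ← cj_inf]
    conv_lhs => rw [← htop (g n)]
    rw [hO.rk_conj (hO.inf hA hB), cj_of_mem (hgA n)]
  have hCn : ∀ n, A ⊓ cj (g n) B ≤ cj (g n) C := fun n => by
    have := cj_mono (g n) hC
    rwa [cj_inf, cj_of_mem (hgA n)] at this
  refine ⟨δ, g, E, rfl, hgA, hEs, hOpE, fun n => ?_, fun n i hi => ?_⟩
  -- If the `n`-th conjugate of `c` were algebraic over `A ⊓ E n`, the rank of `A ⊓ E n` over `A`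
  -- would drop when the `n`-th conjugate of `B` is added. By `hrkP` and additivity it does not
  -- change.
  · by_contra hne
    have h1 := hO.rk_lt_rk (hOpP n) hA (hO.conj (g n) hOpC) inf_le_left (hCn n) (by
      have := relIndex_cj (g n) C A
      rwa [cj_of_mem (hgA n), hCA] at this) (by rwa [← inf_assoc, inf_idem])
    have h2 := hO.rk_inf hA (hOpP n) ⊤
    have h3 := hO.rk_inf (hO.inf hA (hOpB n)) (hOpP n) ⊤
    rw [top_inf_eq] at h2 h3
    have e : A ⊓ cj (g n) B ⊓ (A ⊓ E n) = A ⊓ E (n + 1) := by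
      rw [hEs]
      ext x
      simp only [Subgroup.mem_inf]
      tauto
    rw [← inf_assoc, inf_idem, hrkP] at h2
    have h4 := hrkP (n + 1)
    have h5 := hAB n
    rw [add_mul] at h4
    rw [e] at h3
    omega
  -- If the `i`-th conjugate of `c` were algebraic over `E n`, the rank of `E n` over the `i`-th
  -- conjugate of `B` would drop when `A` is added. The exact value `hrkP` and the upper bound
  -- `hrkE` leave no room for this.
  · by_contra hne
    have hle : ∀ m, i < m → E m ≤ cj (g i) B := by
      intro m hm
      induction m, hm using Nat.le_induction with
      | base => rw [hEs]; exact inf_le_right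
      | succ m _ ih => rw [hEs]; exact inf_le_left.trans ih
    have hEi := hle n hi
    have h1 := hO.rk_lt_rk (hOpE n) (hOpB i) (hO.conj (g i) hOpC) (inf_le_right :
      A ⊓ cj (g i) B ≤ _) (hCn i) (by rw [relIndex_cj, hCB]) (by rwa [inf_eq_right.2 hEi])
    have h2 := hO.rk_inf (hOpB i) (hOpE n) ⊤
    have h3 := hO.rk_inf (hO.inf hA (hOpB i)) (hOpE n) ⊤
    rw [top_inf_eq] at h2 h3
    rw [inf_eq_right.2 hEi, hrkB] at h2
    rw [inf_assoc, inf_eq_right.2 hEi, hrkP, hAB] at h3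
    have h4 := hrkE n
    omega

end FiniteRk
end NumericalRank

/-! ### The completion of a linear order of topological rank 1 -/

section RegularCuts

variable {V : Type*} [LinearOrder V]

/-- There are infinitely many points between `x` and `y`. -/
def FarLT (x y : V) : Prop := (Ioo x y).Infinite

theorem FarLT.lt {x y : V} (h : FarLT x y) : x < y := by
  obtain ⟨z, hz⟩ := h.nonempty
  exact hz.1.trans hz.2

theorem FarLT.mono {x y x' y' : V} (h : FarLT x y) (hx : x' ≤ x) (hy : y ≤ y') : FarLT x' y' :=
  Set.Infinite.mono (Ioo_subset_Ioo hx hy) h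

variable (V) in
/-- An initial segment in which every element has an element far above it. -/
structure RegCut where
  /-- the underlying set -/
  carrier : Set V
  lower : IsLowerSet carrier
  regular : ∀ x ∈ carrier, ∃ y ∈ carrier, FarLT x y

namespace RegCut

theorem ext' {L L' : RegCut V} (h : L.carrier = L'.carrier) : L = L' := by
  cases L; cases L'; simp_all

instance : PartialOrder (RegCut V) :=
  PartialOrder.lift RegCut.carrier fun _ _ h => ext' h

theorem le_def {L L' : RegCut V} : L ≤ L' ↔ L.carrier ⊆ L'.carrier := Iff.rfl

theorem total (L L' : RegCut V) : L ≤ L' ∨ L' ≤ L :=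
  L.lower.total L'.lower

/-- Unions of regular cuts are regular and the empty segment is allowed, so the order is complete.
This provides the compactness on which the projection arguments rely. -/
instance : SupSet (RegCut V) where
  sSup S := ⟨⋃ L ∈ S, L.carrier, isLowerSet_iUnion fun L => isLowerSet_iUnion fun _ => L.lower, by
    intro x hx
    simp only [mem_iUnion] at hx ⊢
    obtain ⟨L, hL, hx⟩ := hx
    obtain ⟨y, hy, hxy⟩ := L.regular x hx
    exact ⟨y, ⟨L, hL, hy⟩, hxy⟩⟩

noncomputable instance : CompleteLattice (RegCut V) :=
  completeLatticeOfSup _ fun _ =>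
    ⟨fun _ hL => le_def.2 (subset_biUnion_of_mem (u := RegCut.carrier) hL),
      fun _ hL => le_def.2 (iUnion₂_subset fun _ hL' => hL hL')⟩

instance : @Std.Total (RegCut V) (· ≤ ·) where
  total := total

open Classical in
noncomputable instance : LinearOrder (RegCut V) where
  min_def x y := congrFun₂ inf_eq_minDefault x y
  max_def x y := congrFun₂ sup_eq_maxDefault x y
  le_total := total
  toDecidableLE := inferInstance

noncomputable instance : CompleteLinearOrder (RegCut V) where
  __ := (inferInstance : LinearOrder _)
  __ := (inferInstance : CompleteLattice _)
  __ := LinearOrder.toBiheytingAlgebra _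

instance : TopologicalSpace (RegCut V) := Preorder.topology _

instance : OrderTopology (RegCut V) := ⟨rfl⟩

theorem lt_iff {L L' : RegCut V} : L < L' ↔ ∃ x ∈ L'.carrier, x ∉ L.carrier := by
  rw [← not_le, le_def, Set.not_subset]

end RegCut

/-- The group `G` acts by automorphisms of the linear order `V`. -/
class OrderAction (G V : Type*) [Group G] [LinearOrder V] [MulAction G V] : Prop where
  smul_lt : ∀ (g : G) {x y : V}, x < y → g • x < g • y

section Action

variable {G : Type*} [Group G] [MulAction G V] [OrderAction G V]

theorem OrderAction.smul_le (g : G) {x y : V} (h : x ≤ y) : g • x ≤ g • y := by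
  rcases h.eq_or_lt with rfl | h
  · exact le_rfl
  · exact (OrderAction.smul_lt g h).le

theorem OrderAction.smul_le_iff (g : G) {x y : V} : g • x ≤ g • y ↔ x ≤ y :=
  ⟨fun h => by simpa using OrderAction.smul_le g⁻¹ h, OrderAction.smul_le g⟩

theorem OrderAction.smul_lt_iff (g : G) {x y : V} : g • x < g • y ↔ x < y := by
  rw [← not_le, ← not_le, smul_le_iff]

theorem OrderAction.image_Ioo (g : G) (x y : V) :
    (fun z => g • z) '' Ioo x y = Ioo (g • x) (g • y) := by
  ext z
  constructor
  · rintro ⟨w, hw, rfl⟩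
    exact ⟨smul_lt g hw.1, smul_lt g hw.2⟩
  · intro hz
    refine ⟨g⁻¹ • z, ⟨?_, ?_⟩, smul_inv_smul _ _⟩
    · rw [← smul_lt_iff g, smul_inv_smul]; exact hz.1
    · rw [← smul_lt_iff g, smul_inv_smul]; exact hz.2

theorem FarLT.smul (g : G) {x y : V} (h : FarLT x y) : FarLT (g • x) (g • y) := by
  rw [FarLT, ← OrderAction.image_Ioo]
  exact h.image (MulAction.injective g).injOn

instance : MulAction G (RegCut V) where
  smul g L := ⟨{x | g⁻¹ • x ∈ L.carrier}, fun _ _ hyx hx => L.lower (OrderAction.smul_le _ hyx) hx,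
    by
      intro x hx
      obtain ⟨y, hy, hxy⟩ := L.regular _ hx
      refine ⟨g • y, by simpa using hy, ?_⟩
      have := hxy.smul g
      rwa [smul_inv_smul] at this⟩
  one_smul L := RegCut.ext' (by
    ext x
    change (1 : G)⁻¹ • x ∈ L.carrier ↔ _
    simp)
  mul_smul g h L := RegCut.ext' (by
    ext x
    change (g * h)⁻¹ • x ∈ L.carrier ↔ h⁻¹ • g⁻¹ • x ∈ L.carrier
    rw [mul_inv_rev, mul_smul])

theorem RegCut.mem_smul {g : G} {L : RegCut V} {x : V} :
    x ∈ (g • L).carrier ↔ g⁻¹ • x ∈ L.carrier := Iff.rfl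

theorem RegCut.smul_mem_smul {g : G} {L : RegCut V} {x : V} :
    g • x ∈ (g • L).carrier ↔ x ∈ L.carrier := by
  rw [mem_smul, inv_smul_smul]

end Action

open MulAction OpenSubgroups

/-- An oligomorphic action by automorphisms on an infinite linear order, such that invariant convex
equivalence relations have finitely many infinite classes. -/
structure TameOrder {G : Type*} [Group G] (Op : Subgroup G → Prop) (V : Type*) [LinearOrder V]
    [MulAction G V] [OrderAction G V] : Prop where
  opens : OpenSubgroups Op
  smooth : SmoothAction Op V
  infinite : Infinite V
  topRank : ∀ {H : Subgroup G}, Op H → ∀ r : Setoid V, (∀ h ∈ H, ∀ x y, r x y → r (h • x) (h • y)) →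
    (∀ C ∈ r.classes, C.OrdConnected) → {C ∈ r.classes | C.Infinite}.Finite

namespace TameOrder

variable {G : Type*} [Group G] {Op : Subgroup G → Prop} [MulAction G V] [OrderAction G V]

/-- There are finitely many orbits of pairs, so the finite intervals have bounded size. Hence being
far apart can be tested with finitely many points. -/
theorem exists_bound (hV : TameOrder Op V) :
    ∃ N : ℕ, ∀ x y : V, ∀ T : Finset V, (T : Set V) ⊆ Ioo x y → N < T.card → FarLT x y := by
  obtain ⟨F, hF, hcov⟩ := (hV.smooth.prod hV.smooth hV.opens).orbits
  obtain ⟨N, hN⟩ := (hF.image fun p : V × V => (Ioo p.1 p.2).ncard).bddAbove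
  refine ⟨N, fun x y T hT hc => ?_⟩
  by_contra hfin
  rw [FarLT, Set.not_infinite] at hfin
  obtain ⟨p, hp, g, e⟩ := hcov (x, y)
  have h1 : (Ioo x y).ncard ≤ N := by
    have e1 : x = g • p.1 := congrArg Prod.fst e
    have e2 : y = g • p.2 := congrArg Prod.snd e
    rw [e1, e2, ← OrderAction.image_Ioo, Set.ncard_image_of_injective _ (MulAction.injective g)]
    exact hN ⟨p, hp, rfl⟩
  have h2 := Set.ncard_le_ncard hT hfin
  rw [Set.ncard_coe_finset] at h2
  omega

/-- In an infinite set, some point has many points below it and above it. -/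
theorem exists_middle {S : Set V} (hS : S.Infinite) (N : ℕ) :
    ∃ a ∈ S, ∃ m ∈ S, ∃ b ∈ S, ∃ T T' : Finset V, (T : Set V) ⊆ Ioo a m ∧ (T' : Set V) ⊆ Ioo m b ∧
      N < T.card ∧ N < T'.card := by
  obtain ⟨T, hTS, hT⟩ := hS.exists_subset_card_eq (2 * N + 5)
  set e := T.orderEmbOfFin hT with he
  have hmem : ∀ i, e i ∈ S := fun i => hTS (T.orderEmbOfFin_mem hT i)
  refine ⟨e ⟨0, by omega⟩, hmem _, e ⟨N + 2, by omega⟩, hmem _, e ⟨2 * N + 4, by omega⟩, hmem _,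
    (Finset.univ : Finset (Fin (N + 1))).map ⟨fun i : Fin (N + 1) => e ⟨i + 1, by omega⟩, fun i j h => by
      have := e.injective h
      simp only [Fin.mk.injEq] at this
      exact Fin.ext (by omega)⟩,
    (Finset.univ : Finset (Fin (N + 1))).map ⟨fun i : Fin (N + 1) => e ⟨i + (N + 3), by omega⟩, fun i j h => by
      have := e.injective h
      simp only [Fin.mk.injEq] at this
      exact Fin.ext (by omega)⟩, ?_, ?_, by simp, by simp⟩
  · intro z hz
    simp only [Finset.coe_map, mem_image] at hz
    obtain ⟨i, -, rfl⟩ := hz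
    exact ⟨e.strictMono (by simp only [Fin.mk_lt_mk]; omega),
      e.strictMono (by simp only [Fin.mk_lt_mk]; omega)⟩
  · intro z hz
    simp only [Finset.coe_map, mem_image] at hz
    obtain ⟨i, -, rfl⟩ := hz
    exact ⟨e.strictMono (by simp only [Fin.mk_lt_mk]; omega),
      e.strictMono (by simp only [Fin.mk_lt_mk]; omega)⟩

theorem exists_far (hV : TameOrder Op V) {S : Set V} (hS : S.Infinite) :
    ∃ a ∈ S, ∃ m ∈ S, ∃ b ∈ S, FarLT a m ∧ FarLT m b := by
  obtain ⟨N, hN⟩ := hV.exists_bound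
  obtain ⟨a, ha, m, hm, b, hb, T, T', h1, h2, h3, h4⟩ := exists_middle hS N
  exact ⟨a, ha, m, hm, b, hb, hN _ _ T h1 h3, hN _ _ T' h2 h4⟩

theorem exists_between (hV : TameOrder Op V) {x y : V} (h : FarLT x y) :
    ∃ z, FarLT x z ∧ FarLT z y := by
  obtain ⟨a, ha, m, hm, b, hb, h1, h2⟩ := hV.exists_far h
  exact ⟨m, h1.mono ha.1.le le_rfl, h2.mono le_rfl hb.2.le⟩

theorem exists_far_of_infinite (hV : TameOrder Op V) {S : Set V} (hS : S.Infinite) {x : V}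
    (hx : ∀ y ∈ S, x ≤ y) : ∃ y ∈ S, FarLT x y := by
  obtain ⟨a, ha, m, hm, b, hb, h1, h2⟩ := hV.exists_far hS
  exact ⟨m, hm, h1.mono (hx a ha) le_rfl⟩

/-- The cut of the points far below `x`. -/
def cut (hV : TameOrder Op V) (x : V) : RegCut V :=
  ⟨{w | FarLT w x}, fun _ _ h1 h2 => FarLT.mono h2 h1 le_rfl, fun _ hw =>
    (hV.exists_between hw).imp fun _ h => ⟨h.2, h.1⟩⟩

theorem mem_cut (hV : TameOrder Op V) {w x : V} : w ∈ (hV.cut x).carrier ↔ FarLT w x := Iff.rfl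

theorem smul_cut (hV : TameOrder Op V) (g : G) (x : V) : g • hV.cut x = hV.cut (g • x) := by
  refine RegCut.ext' ?_
  ext w
  rw [RegCut.mem_smul, mem_cut, mem_cut]
  constructor
  · intro h
    have := h.smul g
    rwa [smul_inv_smul] at this
  · intro h
    have := h.smul g⁻¹
    rwa [inv_smul_smul] at this

theorem exists_cut_between (hV : TameOrder Op V) {L L' : RegCut V} (h : L < L') :
    ∃ x, L < hV.cut x ∧ hV.cut x < L' := by
  obtain ⟨a, ha, haL⟩ := RegCut.lt_iff.1 h
  obtain ⟨x, hx, hax⟩ := L'.regular a ha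
  exact ⟨x, RegCut.lt_iff.2 ⟨a, hax, haL⟩, RegCut.lt_iff.2 ⟨x, hx, fun h => h.lt.false⟩⟩

theorem cut_lt_iff (hV : TameOrder Op V) {x y : V} : hV.cut x < hV.cut y ↔ FarLT x y := by
  rw [RegCut.lt_iff]
  constructor
  · rintro ⟨z, hz, hzx⟩
    obtain ⟨w, hzw, hwy⟩ := hV.exists_between hz
    refine hwy.mono (le_of_not_ge fun hwx => hzx ?_) le_rfl
    exact hzw.mono le_rfl hwx
  · intro h
    exact ⟨x, h, fun h => h.lt.false⟩

theorem lt_cut (hV : TameOrder Op V) {L : RegCut V} {y z : V} (hy : y ∉ L.carrier)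
    (hyz : FarLT y z) : L < hV.cut z :=
  RegCut.lt_iff.2 ⟨y, hyz, hy⟩

theorem cut_lt (hV : TameOrder Op V) {L : RegCut V} {y z : V} (hy : y ∈ L.carrier)
    (hzy : z ≤ y) : hV.cut z < L :=
  RegCut.lt_iff.2 ⟨y, hy, fun h => absurd h.lt (not_lt.2 hzy)⟩

theorem denselyOrdered (hV : TameOrder Op V) : DenselyOrdered (RegCut V) :=
  ⟨fun _ _ h => (hV.exists_cut_between h).imp' (fun x => hV.cut x) fun _ h => h⟩

theorem nontrivial (hV : TameOrder Op V) : Nontrivial (RegCut V) := by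
  have := hV.infinite
  obtain ⟨a, -, m, -, -, -, h, -⟩ := hV.exists_far (Set.infinite_univ (α := V))
  exact ⟨_, _, (hV.cut_lt_iff.2 h).ne⟩

/-- An infinite invariant set of cuts is somewhere dense. -/
theorem somewhere_dense (hV : TameOrder Op V) {H : Subgroup G} (hH : Op H) {Z : Set (RegCut V)}
    (hZ : ∀ h ∈ H, ∀ z ∈ Z, h • z ∈ Z) (hinf : Z.Infinite) : (interior (closure Z)).Nonempty := by
  by_contra hemp
  rw [Set.not_nonempty_iff_eq_empty] at hemp
  have hd := hV.denselyOrdered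
  have hn := hV.nontrivial
  -- Two points are equivalent when no cut of `Z` separates them. If `Z` is nowhere dense, any two
  -- of its cuts have between them an interval free of cuts from `Z`, hence an infinite class. A cut
  -- of `Z` is therefore determined by the infinite classes below it, and there are only finitely
  -- many of those.
  set r : Setoid V := ⟨fun x y => ∀ L ∈ Z, x ∈ L.carrier ↔ y ∈ L.carrier,
    fun _ _ _ => Iff.rfl, fun h L hL => (h L hL).symm,
    fun h h' L hL => (h L hL).trans (h' L hL)⟩ with hr
  have hrel : ∀ x y, r x y ↔ ∀ L ∈ Z, x ∈ L.carrier ↔ y ∈ L.carrier := fun _ _ => Iff.rfl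
  have hfin := hV.topRank hH r (by
    intro h hh x y hxy L hL
    have := hxy (h⁻¹ • L) (hZ _ (H.inv_mem hh) L hL)
    rwa [RegCut.mem_smul, RegCut.mem_smul, inv_inv] at this) (by
    rintro C ⟨y, rfl⟩
    refine ⟨fun a ha b hb z hz L hL => ?_⟩
    have ha' := (hrel _ _).1 ha L hL
    have hb' := (hrel _ _).1 hb L hL
    exact ⟨fun h => ha'.1 (L.lower hz.1 h), fun h => L.lower hz.2 (hb'.2 h)⟩)
  refine hinf (Set.Finite.of_injOn (f := fun L => {C | C ∈ {C ∈ r.classes | C.Infinite} ∧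
    C ⊆ L.carrier}) (t := 𝒫 {C ∈ r.classes | C.Infinite}) (fun L _ C hC => hC.1) ?_
    hfin.finite_subsets)
  have key : ∀ L ∈ Z, ∀ L' ∈ Z, L < L' → ¬ {C | C ∈ {C ∈ r.classes | C.Infinite} ∧
      C ⊆ L'.carrier} ⊆ {C | C ∈ {C ∈ r.classes | C.Infinite} ∧ C ⊆ L.carrier} := by
    intro L hL L' hL' hlt hsub
    have hne : (Ioo L L' ∩ (closure Z)ᶜ).Nonempty := by
      by_contra hcon
      rw [Set.not_nonempty_iff_eq_empty, ← Set.subset_compl_iff_disjoint_right.trans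
        Set.disjoint_iff_inter_eq_empty, compl_compl] at hcon
      have h1 := interior_maximal hcon isOpen_Ioo
      rw [hemp] at h1
      exact absurd (Set.nonempty_Ioo.2 hlt) (by rw [Set.subset_empty_iff.1 h1]; simp)
    obtain ⟨u, v, huv, hs⟩ := (isOpen_Ioo.inter isClosed_closure.isOpen_compl).exists_Ioo_subset hne
    obtain ⟨b, hub, hbv⟩ := hV.exists_cut_between huv
    obtain ⟨a, hua, hab⟩ := hV.exists_cut_between hub
    have hab' := hV.cut_lt_iff.1 hab
    have hnoZ : ∀ K ∈ Z, ¬ (hV.cut a < K ∧ K < hV.cut b) := fun K hK h =>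
      (hs ⟨hua.trans h.1, h.2.trans hbv⟩).2 (subset_closure hK)
    obtain ⟨m, ham, hmb⟩ := hV.exists_between hab'
    obtain ⟨l, hal, hlm⟩ := hV.exists_between ham
    have hcls : ∀ x, l ≤ x → x ≤ m → r x m := by
      intro x hlx hxm K hK
      refine ⟨fun hx => ?_, fun hm => K.lower hxm hm⟩
      by_contra hm
      exact hnoZ K hK ⟨hV.cut_lt hx (hal.lt.le.trans hlx), hV.lt_cut hm hmb⟩
    have hC : {x | r x m} ∈ {C ∈ r.classes | C.Infinite} :=
      ⟨⟨m, rfl⟩, Set.Infinite.mono (fun x hx => hcls x hx.1.le hx.2.le) hlm⟩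
    have hmL' : m ∈ L'.carrier := by
      have h1 : hV.cut b < L' := by
        have h2 := (hs ⟨hub, hbv⟩).1
        exact h2.2
      exact RegCut.le_def.1 h1.le hmb
    have hmL : m ∉ L.carrier := by
      intro hmL
      have h2 := (hs ⟨hua, hab.trans hbv⟩).1.1
      exact absurd (hV.cut_lt hmL ham.lt.le) h2.not_gt
    have := hsub ⟨hC, fun x hx => ((hrel _ _).1 hx L' hL').2 hmL'⟩
    exact hmL (this.2 (r.refl m))
  intro L hL L' hL' e
  rcases lt_trichotomy L L' with h | h | h
  · exact absurd e.ge (key L hL L' hL' h)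
  · exact h
  · exact absurd e.le (key L' hL' L hL h)

/-- The completion of a tame linear order, with its action, is tame. -/
theorem tameAction (hV : TameOrder Op V) : TameAction G (RegCut V) Op (range hV.cut) where
  smul_lt g L L' h := by
    obtain ⟨x, hx, hxL⟩ := RegCut.lt_iff.1 h
    exact RegCut.lt_iff.2 ⟨g • x, RegCut.smul_mem_smul.2 hx, fun h => hxL (RegCut.smul_mem_smul.1 h)⟩
  smul_mem g q := by
    rintro ⟨x, rfl⟩
    exact ⟨g • x, (hV.smul_cut g x).symm⟩
  dense h := by
    obtain ⟨x, hx⟩ := hV.exists_cut_between h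
    exact ⟨_, ⟨x, rfl⟩, hx⟩
  inf := hV.opens.inf
  conj := hV.opens.conj
  stab := by
    rintro _ ⟨x, rfl⟩
    refine hV.opens.mono ?_ (hV.smooth.stab x)
    intro g hg
    rw [mem_stabilizer_iff, hV.smul_cut, show g • x = x from hg]
  orbits hH ι _ := by
    obtain ⟨F, hF, hcov⟩ := (hV.smooth.pi hV.opens ι).cover hV.opens hH
    refine ⟨(fun v i => hV.cut (v i)) '' F, hF.image _, fun p hp => ?_⟩
    choose v hv using hp
    obtain ⟨f, hf, h, hh, e⟩ := hcov v
    refine ⟨_, ⟨f, hf, rfl⟩, h, hh, ?_⟩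
    funext i
    rw [← hv, e, Pi.smul_apply, Pi.smul_apply, hV.smul_cut]
  tame hH _ hZ hinf := hV.somewhere_dense hH hZ hinf
  unif {H K} hH hK := by
    -- The conjugate of `K` by `g` is the stabilizer of the coset `gK`. So the orbits in question
    -- are at most as many as the `H`-orbits on `(G ⧸ K) × V`, a number independent of `g`.
    obtain ⟨F, hF, hcov⟩ := ((SmoothAction.quotient hV.opens hK).prod hV.smooth hV.opens).cover
      hV.opens hH
    refine ⟨hF.toFinset.card, fun g => ?_⟩
    have hex : ∀ f : (G ⧸ K) × V, ∃ h ∈ H, (∃ h' ∈ H, h' • f.1 = (g : G ⧸ K)) →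
        h • f.1 = (g : G ⧸ K) := by
      intro f
      by_cases h : ∃ h' ∈ H, h' • f.1 = (g : G ⧸ K)
      · obtain ⟨h', h1, h2⟩ := h
        exact ⟨h', h1, fun _ => h2⟩
      · exact ⟨1, H.one_mem, fun h' => absurd h' h⟩
    choose η hη hη' using hex
    classical
    refine ⟨hF.toFinset.image fun f => hV.cut (η f • f.2), Finset.card_image_le, ?_⟩
    rintro _ ⟨x, rfl⟩
    obtain ⟨f, hf, h, hh, e⟩ := hcov ((g : G ⧸ K), x)
    have e1 : (g : G ⧸ K) = h • f.1 := congrArg Prod.fst e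
    have e2 : x = h • f.2 := congrArg Prod.snd e
    refine ⟨_, Finset.mem_image_of_mem _ (hF.mem_toFinset.2 hf), h * (η f)⁻¹, ⟨?_, ?_⟩, ?_⟩
    · exact H.mul_mem hh (H.inv_mem (hη f))
    · have h1 : (h * (η f)⁻¹) • (g : G ⧸ K) = (g : G ⧸ K) := by
        rw [mul_smul, ← hη' f ⟨h, hh, e1.symm⟩, inv_smul_smul, hη' f ⟨h, hh, e1.symm⟩, e1]
      have h2 : cj g K = stabilizer G (g : G ⧸ K) := by
        have := cj_stabilizer g ((1 : G) : G ⧸ K)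
        rw [MulAction.stabilizer_quotient] at this
        rw [← this]
        congr 1
        show ((g * 1 : G) : G ⧸ K) = _
        rw [mul_one]
      change _ ∈ cj g K
      rw [h2]
      exact h1
    · rw [hV.smul_cut, mul_smul, inv_smul_smul, e2]

end TameOrder

end RegularCuts

/-! ### Elementary permutations of an ω-categorical structure -/

section ElementaryPermutations

open MulAction OpenSubgroups

variable (L : FirstOrder.Language.{u, v}) (M : Type w) [L.Structure M]

/-- The group of the permutations of `M` that preserve all formulas. -/
def elemAut : Subgroup (Equiv.Perm M) where
  carrier := {g | ∀ (n : ℕ) (φ : L.Formula (Fin n)) (v : Fin n → M),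
    φ.Realize (g ∘ v) ↔ φ.Realize v}
  one_mem' _ _ _ := Iff.rfl
  mul_mem' {g h} hg hh n φ v := (hg n φ (h ∘ v)).trans (hh n φ v)
  inv_mem' {g} hg n φ v := by
    have := hg n φ (⇑g⁻¹ ∘ v)
    rwa [← Function.comp_assoc, ← Equiv.Perm.coe_mul, mul_inv_cancel, Equiv.Perm.coe_one,
      Function.id_comp, iff_comm] at this

variable {L M}

theorem realize_smul {α : Type*} [Finite α] (g : elemAut L M) (φ : L.Formula α) (v : α → M) :
    φ.Realize (g • v) ↔ φ.Realize v := by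
  obtain ⟨n, ⟨e⟩⟩ := Finite.exists_equiv_fin α
  have := g.2 n (φ.relabel e) (v ∘ e.symm)
  rw [Formula.realize_relabel, Formula.realize_relabel] at this
  have e1 : (v ∘ e.symm) ∘ e = v := by funext i; simp
  have e2 : (⇑(g : Equiv.Perm M) ∘ (v ∘ e.symm)) ∘ e = g • v := by
    funext i
    simp only [Function.comp_apply, Equiv.symm_apply_apply]
    rfl
  rwa [e1, e2] at this

theorem tupleType_comp {α β : Type} {a b : α → M} (h : tupleType L a = tupleType L b)
    (σ : β → α) : tupleType L (a ∘ σ) = tupleType L (b ∘ σ) := by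
  ext φ
  have := Set.ext_iff.1 h (φ.relabel σ)
  simpa only [tupleType, mem_ofPred_eq, Formula.realize_relabel] using this

theorem tupleType_subset {α : Type} {a b : α → M} (h : tupleType L a ⊆ tupleType L b) :
    tupleType L a = tupleType L b := by
  refine h.antisymm fun φ hφ => ?_
  by_contra hn
  have : φ.not ∈ tupleType L a := by
    simpa only [tupleType, mem_ofPred_eq, Formula.realize_not] using hn
  have := h this
  simp only [tupleType, mem_ofPred_eq, Formula.realize_not] at this hφ
  exact this hφ

theorem OmegaCategorical.finite_types (hcat : OmegaCategorical L M) (α : Type) [Finite α] :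
    (range fun a : α → M => tupleType L a).Finite := by
  obtain ⟨n, ⟨e⟩⟩ := Finite.exists_equiv_fin α
  refine ((hcat.2 n).image fun t => (fun φ : L.Formula α => φ.relabel e) ⁻¹' t).subset ?_
  rintro _ ⟨a, rfl⟩
  refine ⟨_, ⟨a ∘ e.symm, rfl⟩, ?_⟩
  ext φ
  simp only [tupleType, mem_preimage, mem_ofPred_eq, Formula.realize_relabel]
  rw [Function.comp_assoc, e.symm_comp_self, Function.comp_id]

/-- Only finitely many types are realized: take the conjunction of formulas of the type of `a`, one
excluding each other type. -/
theorem OmegaCategorical.exists_isolating (hcat : OmegaCategorical L M) {α : Type} [Finite α]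
    (a : α → M) : ∃ θ : L.Formula α, θ.Realize a ∧
      ∀ c : α → M, θ.Realize c → tupleType L c = tupleType L a := by
  have hfin := (hcat.finite_types α).to_subtype
  have hsep : ∀ p : range fun a : α → M => tupleType L a, ∃ θ : L.Formula α, θ.Realize a ∧
      (p.1 ≠ tupleType L a → θ ∉ p.1) := by
    rintro ⟨_, c, rfl⟩
    by_cases h : tupleType L a ⊆ tupleType L c
    · exact ⟨⊤, by simp, fun h' => absurd (tupleType_subset h).symm h'⟩
    · obtain ⟨θ, h1, h2⟩ := Set.not_subset.1 h
      exact ⟨θ, h1, fun _ => h2⟩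
  choose θ h1 h2 using hsep
  refine ⟨Formula.iInf θ, Formula.realize_iInf.2 h1, fun c hc => ?_⟩
  by_contra hne
  exact h2 ⟨_, c, rfl⟩ hne (Formula.realize_iInf.1 hc _)

theorem OmegaCategorical.exists_extend (hcat : OmegaCategorical L M) {α : Type} [Finite α]
    {a b : α → M} (h : tupleType L a = tupleType L b) (m : M) :
    ∃ d : M, tupleType L (Sum.elim a fun _ : Unit => m) =
      tupleType L (Sum.elim b fun _ : Unit => d) := by
  obtain ⟨θ, h1, h2⟩ := hcat.exists_isolating (Sum.elim a fun _ : Unit => m)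
  have h3 : θ.iExs Unit ∈ tupleType L a := Formula.realize_iExs.2 ⟨_, h1⟩
  rw [h] at h3
  obtain ⟨d, hd⟩ := Formula.realize_iExs.1 h3
  exact ⟨d (), (h2 _ hd).symm⟩

/-- A set of pairs which is a partial elementary map. -/
def IsPartialElem (L : FirstOrder.Language.{u, v}) {M : Type w} [L.Structure M]
    (s : Set (M × M)) : Prop :=
  ∀ (n : ℕ) (v : Fin n → M × M), (∀ i, v i ∈ s) →
    tupleType L (fun i => (v i).1) = tupleType L (fun i => (v i).2)

theorem IsPartialElem.range {α : Type} {a b : α → M} (h : tupleType L a = tupleType L b) :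
    IsPartialElem L (range fun i => (a i, b i)) := by
  intro n v hv
  choose σ hσ using hv
  have := tupleType_comp h σ
  convert this using 2
  · funext i
    exact congrArg Prod.fst (hσ i).symm
  · funext i
    exact congrArg Prod.snd (hσ i).symm

theorem IsPartialElem.exists_insert (hcat : OmegaCategorical L M) {s : Set (M × M)}
    (hs : IsPartialElem L s) (hf : s.Finite) (m : M) :
    ∃ t, t.Finite ∧ IsPartialElem L t ∧ s ⊆ t ∧ ∃ d, (m, d) ∈ t := by
  obtain ⟨n, f, -, hfs⟩ := hf.fin_param
  have h := hs n f fun i => hfs ▸ mem_range_self i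
  obtain ⟨d, hd⟩ := hcat.exists_extend h m
  refine ⟨_, finite_range _, IsPartialElem.range hd, ?_, d, ⟨Sum.inr (), rfl⟩⟩
  rw [← hfs]
  rintro _ ⟨i, rfl⟩
  exact ⟨Sum.inl i, rfl⟩

theorem IsPartialElem.swap {s : Set (M × M)} (hs : IsPartialElem L s) :
    IsPartialElem L (Prod.swap ⁻¹' s) :=
  fun n v hv => (hs n (fun i => (v i).swap) hv).symm

theorem IsPartialElem.eq_iff {s : Set (M × M)} (hs : IsPartialElem L s) {p q : M × M} (hp : p ∈ s)
    (hq : q ∈ s) : p.1 = q.1 ↔ p.2 = q.2 := by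
  have := Set.ext_iff.1 (hs 2 ![p, q] (by
    intro i
    fin_cases i
    · exact hp
    · exact hq)) (Term.equal (Term.var 0) (Term.var 1))
  simpa [tupleType, Formula.realize_equal] using this

/-- Back and forth: an ideal of finite partial elementary maps that meets, for each of the countably
many `m`, the conditions that `m` is in the domain and in the range has as its union the graph of an
elementary permutation. -/
theorem OmegaCategorical.exists_smul_eq_fin (hcat : OmegaCategorical L M) {n : ℕ} {a b : Fin n → M}
    (h : tupleType L a = tupleType L b) : ∃ g : elemAut L M, b = g • a := by
  have := hcat.1
  have := Encodable.ofCountable M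
  let P := {s : Set (M × M) // s.Finite ∧ IsPartialElem L s}
  let D : M ⊕ M → Order.Cofinal P := Sum.elim
    (fun m => ⟨{s | ∃ d, (m, d) ∈ s.1}, fun s => by
      obtain ⟨t, h1, h2, h3, h4⟩ := s.2.2.exists_insert hcat s.2.1 m
      exact ⟨⟨t, h1, h2⟩, h4, h3⟩⟩)
    (fun m => ⟨{s | ∃ d, (d, m) ∈ s.1}, fun s => by
      obtain ⟨t, h1, h2, h3, d, h4⟩ := s.2.2.swap.exists_insert hcat
        (s.2.1.preimage Prod.swap_injective.injOn) m
      exact ⟨⟨Prod.swap ⁻¹' t, h1.preimage Prod.swap_injective.injOn, h2.swap⟩, ⟨d, h4⟩,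
        fun p hp => h3 (by simpa using hp)⟩⟩)
  let p0 : P := ⟨_, finite_range _, IsPartialElem.range h⟩
  let I := Order.idealOfCofinals p0 D
  set U : Set (M × M) := {p | ∃ s ∈ I, p ∈ s.1} with hU
  have hUe : IsPartialElem L U := by
    intro n v hv
    choose s hs hvs using hv
    obtain ⟨t, ht, hst⟩ : ∃ t ∈ I, ∀ i, s i ≤ t := by
      have hdir := directedOn_iff_directed.1 I.directed
      have : Nonempty (I : Set P) := I.nonempty.to_subtype
      obtain ⟨t, ht⟩ := hdir.finite_le fun i => (⟨s i, hs i⟩ : (I : Set P))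
      exact ⟨t.1, t.2, ht⟩
    exact t.2.2 n v fun i => hst i (hvs i)
  have hl : ∀ m, ∃ d, (m, d) ∈ U := fun m => by
    obtain ⟨s, ⟨d, hd⟩, hs⟩ := Order.cofinal_meets_idealOfCofinals p0 D (Sum.inl m)
    exact ⟨d, s, hs, hd⟩
  have hr : ∀ m, ∃ d, (d, m) ∈ U := fun m => by
    obtain ⟨s, ⟨d, hd⟩, hs⟩ := Order.cofinal_meets_idealOfCofinals p0 D (Sum.inr m)
    exact ⟨d, s, hs, hd⟩
  choose f hf using hl
  choose f' hf' using hr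
  let g : Equiv.Perm M := ⟨f, f', fun m => (hUe.eq_iff (hf' (f m)) (hf m)).2 rfl,
    fun m => (hUe.eq_iff (hf (f' m)) (hf' m)).1 rfl⟩
  refine ⟨⟨g, fun n φ v => ?_⟩, ?_⟩
  · have := Set.ext_iff.1 (hUe n (fun i => (v i, f (v i))) fun i => hf (v i)) φ
    exact this.symm
  · funext i
    have h0 : (a i, b i) ∈ U := ⟨p0, Order.mem_idealOfCofinals p0 D, ⟨i, rfl⟩⟩
    exact (hUe.eq_iff h0 (hf (a i))).1 rfl

theorem OmegaCategorical.exists_smul_eq (hcat : OmegaCategorical L M) {α : Type} [Finite α]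
    {a b : α → M} (h : tupleType L a = tupleType L b) : ∃ g : elemAut L M, b = g • a := by
  obtain ⟨n, ⟨e⟩⟩ := Finite.exists_equiv_fin α
  obtain ⟨g, hg⟩ := hcat.exists_smul_eq_fin (tupleType_comp h e.symm)
  refine ⟨g, funext fun i => ?_⟩
  have := congrFun hg (e i)
  simpa using this

theorem OmegaCategorical.finite_orbits (hcat : OmegaCategorical L M) (α : Type) [Finite α] :
    ∃ F : Set (α → M), F.Finite ∧ ∀ v, ∃ f ∈ F, ∃ g : elemAut L M, v = g • f := by
  have hfin := (hcat.finite_types α).to_subtype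
  choose f hf using fun t : range fun a : α → M => tupleType L a => t.2
  refine ⟨range f, finite_range f, fun v => ⟨_, ⟨⟨_, v, rfl⟩, rfl⟩, ?_⟩⟩
  exact hcat.exists_smul_eq (hf ⟨_, v, rfl⟩)

/-- The subgroups containing the pointwise stabilizer of a finite set. -/
def FixOpen (G M : Type*) [Group G] [MulAction G M] (H : Subgroup G) : Prop :=
  ∃ A : Set M, A.Finite ∧ fixingSubgroup G A ≤ H

theorem FixOpen.iff_tuple {G M : Type*} [Group G] [MulAction G M] {H : Subgroup G} :
    FixOpen G M H ↔ ∃ (n : ℕ) (a : Fin n → M), stabilizer G a ≤ H := by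
  constructor
  · rintro ⟨A, hA, h⟩
    obtain ⟨n, f, -, hf⟩ := hA.fin_param
    refine ⟨n, f, fun g hg => h ?_⟩
    rw [mem_fixingSubgroup_iff, ← hf]
    rintro _ ⟨i, rfl⟩
    exact congrFun hg i
  · rintro ⟨n, a, h⟩
    refine ⟨range a, finite_range a, fun g hg => h (funext fun i => ?_)⟩
    exact (mem_fixingSubgroup_iff G).1 hg _ ⟨i, rfl⟩

/-- The double cosets of the stabilizers of `a` and `b` correspond to the orbits of the tuples `(a,
g • b)`, which are finite in number. -/
theorem FixOpen.openSubgroups {G M : Type*} [Group G] [MulAction G M]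
    (h : ∀ (α : Type) [Finite α], ∃ F : Set (α → M), F.Finite ∧ ∀ v, ∃ f ∈ F, ∃ g : G, v = g • f) :
    OpenSubgroups (FixOpen G M) where
  top := ⟨∅, finite_empty, le_top⟩
  mono hHK := fun ⟨A, h1, h2⟩ => ⟨A, h1, h2.trans hHK⟩
  inf := by
    rintro H K ⟨A, h1, h2⟩ ⟨B, h3, h4⟩
    exact ⟨A ∪ B, h1.union h3, le_inf ((fixingSubgroup_antitone G M subset_union_left).trans h2)
      ((fixingSubgroup_antitone G M subset_union_right).trans h4)⟩
  conj := by
    rintro H g hH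
    obtain ⟨n, a, ha⟩ := FixOpen.iff_tuple.1 hH
    refine FixOpen.iff_tuple.2 ⟨n, g • a, ?_⟩
    rw [cj_stabilizer]
    exact cj_mono g ha
  cover := by
    intro H K hH hK
    obtain ⟨n, a, ha⟩ := FixOpen.iff_tuple.1 hH
    obtain ⟨m, b, hb⟩ := FixOpen.iff_tuple.1 hK
    obtain ⟨F, hF, hcov⟩ := h (Fin n ⊕ Fin m)
    have hex : ∀ f : Fin n ⊕ Fin m → M, ∃ γ : G, (∃ γ' g : G, Sum.elim a (γ' • b) = g • f) →
        ∃ g : G, Sum.elim a (γ • b) = g • f := by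
      intro f
      by_cases hf : ∃ γ' g : G, Sum.elim a (γ' • b) = g • f
      · obtain ⟨γ, hγ⟩ := hf
        exact ⟨γ, fun _ => hγ⟩
      · exact ⟨1, fun h => absurd h hf⟩
    choose γ hγ using hex
    refine ⟨γ '' F, hF.image _, fun g => ?_⟩
    obtain ⟨f, hf, k, hk⟩ := hcov (Sum.elim a (g • b))
    obtain ⟨k', hk'⟩ := hγ f ⟨g, k, hk⟩
    have e : Sum.elim a (g • b) = (k * k'⁻¹) • Sum.elim a (γ f • b) := by
      rw [hk', hk, mul_smul, inv_smul_smul]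
    refine ⟨k * k'⁻¹, ha ?_, γ f, ⟨f, hf, rfl⟩, (γ f)⁻¹ * (k * k'⁻¹)⁻¹ * g, hb ?_, by group⟩
    · exact funext fun i => (congrFun e (Sum.inl i)).symm
    · have : g • b = (k * k'⁻¹) • γ f • b := funext fun i => congrFun e (Sum.inr i)
      rw [mem_stabilizer_iff, mul_smul, mul_smul, this, inv_smul_smul, inv_smul_smul]

theorem FixOpen.smoothAction {G M : Type*} [Group G] [MulAction G M]
    (h : ∀ (α : Type) [Finite α], ∃ F : Set (α → M), F.Finite ∧ ∀ v, ∃ f ∈ F, ∃ g : G, v = g • f) :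
    SmoothAction (FixOpen G M) M := by
  refine ⟨fun a => ⟨{a}, finite_singleton a, fun g hg =>
    (mem_fixingSubgroup_iff G).1 hg a rfl⟩, ?_⟩
  obtain ⟨F, hF, hcov⟩ := h Unit
  refine ⟨(fun f => f ()) '' F, hF.image _, fun a => ?_⟩
  obtain ⟨f, hf, g, hg⟩ := hcov fun _ => a
  exact ⟨_, ⟨f, hf, rfl⟩, g, congrFun hg ()⟩

/-- Definable sets are invariant. -/
theorem _root_.Set.Definable.smul_mem {A : Set M} (hA : A.Finite) {α : Type} [Finite α]
    {D : Set (α → M)} (hD : A.Definable L D) {g : elemAut L M} (hg : g ∈ fixingSubgroup _ A)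
    {v : α → M} (hv : v ∈ D) : g • v ∈ D := by
  obtain ⟨φ, rfl⟩ := definable_iff_exists_formula_sum.1 hD
  have := hA.to_subtype
  have h := realize_smul g φ (Sum.elim (↑) v)
  have e : g • (Sum.elim (↑) v : A ⊕ α → M) = Sum.elim (↑) (g • v) := by
    funext i
    rcases i with i | i
    · exact (mem_fixingSubgroup_iff _).1 hg i i.2
    · rfl
  rw [e] at h
  exact h.2 hv

/-- Invariant sets are definable. -/
theorem OmegaCategorical.definable (hcat : OmegaCategorical L M) {A : Set M} (hA : A.Finite)
    {α : Type} [Finite α] {D : Set (α → M)}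
    (hD : ∀ g : elemAut L M, g ∈ fixingSubgroup _ A → ∀ v ∈ D, g • v ∈ D) : A.Definable L D := by
  obtain ⟨n, a, -, ha⟩ := hA.fin_param
  -- By homogeneity an invariant set is the union of the types over `a` that it meets; they are
  -- finitely many, and each is isolated by a formula.
  let T := (fun v : α → M => tupleType L (Sum.elim a v)) '' D
  have hT : T.Finite := (hcat.finite_types (Fin n ⊕ α)).subset (by
    rintro _ ⟨v, -, rfl⟩
    exact ⟨_, rfl⟩)
  have := hT.to_subtype
  have hDT : D = ⋃ t : T, {w | tupleType L (Sum.elim a w) = t.1} := by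
    ext w
    simp only [mem_iUnion, mem_ofPred_eq]
    constructor
    · exact fun hw => ⟨⟨_, w, hw, rfl⟩, rfl⟩
    · rintro ⟨⟨_, v, hv, rfl⟩, h⟩
      obtain ⟨g, hg⟩ := hcat.exists_smul_eq h.symm
      have e : w = g • v := funext fun i => congrFun hg (Sum.inr i)
      rw [e]
      refine hD g ((mem_fixingSubgroup_iff _).2 ?_) v hv
      rw [← ha]
      rintro _ ⟨i, rfl⟩
      exact (congrFun hg (Sum.inl i)).symm
  rw [hDT]
  refine definable_iUnion_of_finite fun t => ?_
  obtain ⟨_, v, hv, rfl⟩ := t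
  obtain ⟨θ, h1, h2⟩ := hcat.exists_isolating (Sum.elim a v)
  refine definable_iff_exists_formula_sum.2
    ⟨θ.relabel (Sum.map (fun i => ⟨a i, ha ▸ mem_range_self i⟩) id), ?_⟩
  ext w
  have e : (Sum.elim (↑) w : A ⊕ α → M) ∘
      Sum.map (fun i => (⟨a i, ha ▸ mem_range_self i⟩ : A)) id = Sum.elim a w := by
    funext i
    rcases i with i | i <;> rfl
  rw [mem_ofPred_eq, mem_ofPred_eq, Formula.realize_relabel, e]
  constructor
  · intro h
    have : θ ∈ tupleType L (Sum.elim a w) := h ▸ h1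
    exact this
  · exact h2 _

end ElementaryPermutations

/-! ### From the rank of definable sets to the rank of stabilizers -/

section Imaginaries

open MulAction OpenSubgroups

variable {L : FirstOrder.Language.{u, v}} {M : Type w} [L.Structure M]

namespace Interpretable

variable {A : Set M}

theorem Codes.unique {X : Interpretable L M A} {v : Fin X.arity → M} {x y : X.Carrier}
    (hx : X.Codes v x) (hy : X.Codes v y) : x = y := by
  obtain ⟨h, rfl⟩ := hx
  obtain ⟨h', rfl⟩ := hy
  rfl

theorem exists_codes (X : Interpretable L M A) (x : X.Carrier) : ∃ v, X.Codes v x := by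
  obtain ⟨⟨v, hv⟩, rfl⟩ := Quotient.exists_rep x
  exact ⟨v, hv, rfl⟩

/-- A sort defined with parameters carries no action of the whole group. The elements fixing the
parameters still act on its classes, which is expressed through representatives. -/
theorem rel_smul (X : Interpretable L M A) {B : Set M} (hB : B.Finite)
    (hrel : B.Definable L {v : Fin X.arity ⊕ Fin X.arity → M |
      ∃ (h₁ : (fun i => v (Sum.inl i)) ∈ X.dom) (h₂ : (fun i => v (Sum.inr i)) ∈ X.dom),
        X.rel ⟨_, h₁⟩ ⟨_, h₂⟩}) {g : elemAut L M}
    (hg : g ∈ fixingSubgroup _ B) {v w : Fin X.arity → M} {x : X.Carrier} (hv : X.Codes v x)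
    (hw : X.Codes w x) : ∃ y, X.Codes (g • v) y ∧ X.Codes (g • w) y := by
  obtain ⟨h1, rfl⟩ := hv
  obtain ⟨h2, e⟩ := hw
  obtain ⟨h3, h4, h5⟩ := hrel.smul_mem hB hg (v := Sum.elim v w)
    ⟨h1, h2, Quotient.exact e.symm⟩
  exact ⟨_, ⟨h3, rfl⟩, ⟨h4, (Quotient.sound h5).symm⟩⟩

theorem DefinableRel.smul {X : Interpretable L M A} {B : Set M} (hB : B.Finite) {α : Type} [Finite α]
    {l : ℕ} {S : (α → M) → (Fin l → X.Carrier) → Prop} (hS : X.DefinableRel B S) {g : elemAut L M}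
    (hg : g ∈ fixingSubgroup _ B) {y : α → M} {x x' : Fin l → X.Carrier} {c : Fin l → Fin X.arity → M}
    (hc : ∀ i, X.Codes (c i) (x i)) (hc' : ∀ i, X.Codes (g • c i) (x' i)) (h : S y x) :
    S (g • y) x' := by
  obtain ⟨x'', h1, h2⟩ := Set.Definable.smul_mem hB hS hg
    (v := Sum.elim y fun p => c p.1 p.2) ⟨x, hc, h⟩
  have : x'' = x' := funext fun i => (h1 i).unique (hc' i)
  exact this ▸ h2

theorem DefinableRel.mono {X : Interpretable L M A} {B B' : Set M} {α : Type} {l : ℕ}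
    {S : (α → M) → (Fin l → X.Carrier) → Prop} (hS : X.DefinableRel B S) (h : B ⊆ B') :
    X.DefinableRel B' S :=
  Set.Definable.mono hS h

theorem DefinableRel.finite {X : Interpretable L M A} {B : Set M} {α : Type}
    {l : ℕ} {S : (α → M) → (Fin l → X.Carrier) → Prop} (hS : X.DefinableRel B S) :
    ∃ B' ⊆ B, B'.Finite ∧ X.DefinableRel B' S := by
  obtain ⟨B', h1, h2⟩ := definable_iff_finitely_definable.1 hS
  exact ⟨B', h1, B'.finite_toSet, h2⟩

/-- The tuples that represent the imaginary element `x`. -/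
def codeSet (X : Interpretable L M A) (x : X.Carrier) : Set (Fin X.arity → M) := {v | X.Codes v x}

theorem codeSet_injective (X : Interpretable L M A) : Function.Injective X.codeSet := by
  intro x y h
  obtain ⟨v, hv⟩ := X.exists_codes x
  have : v ∈ X.codeSet y := h ▸ hv
  exact Codes.unique hv this

end Interpretable

open Pointwise

/-- A set of rank at least `n` contains, for every open subgroup, a point of rank at least `n`. -/
theorem OmegaCategorical.exists_rkGE (hcat : OmegaCategorical L M) {α : Type} [Finite α] {n : ℕ} :
    ∀ {D : Set (α → M)} {H : Subgroup (elemAut L M)}, FixOpen _ M H → rankGE L (n + 1) D →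
      ∃ y ∈ D, RkGE (FixOpen (elemAut L M) M) (n + 1) (stabilizer _ y) H := by
  have hO := FixOpen.openSubgroups (G := elemAut L M) (M := M) fun α _ => hcat.finite_orbits α
  have hM := FixOpen.smoothAction (G := elemAut L M) (M := M) fun α _ => hcat.finite_orbits α
  induction n with
  | zero =>
    intro D H hH hD
    obtain ⟨F, hF, hcov⟩ := (hM.pi hO α).cover hO hH
    by_contra hcon
    push Not at hcon
    refine hD (Set.Finite.subset (s := ⋃ f ∈ {f ∈ F | {z | ∃ h ∈ H, z = h • f}.Finite},
      {z | ∃ h ∈ H, z = h • f}) ((hF.subset fun f hf => hf.1).biUnion fun f hf => hf.2) ?_)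
    intro y hy
    obtain ⟨f, hf, h, hh, e⟩ := hcov y
    refine mem_biUnion ⟨hf, ?_⟩ ⟨h, hh, e⟩
    by_contra hinf
    refine hcon y hy ⟨H, H ⊓ stabilizer _ y, hO.inf hH ((hM.pi hO α).stab y), inf_le_left, le_rfl,
      ?_, by rw [Subgroup.relIndex_self]; exact one_ne_zero, trivial⟩
    rw [inf_comm, Subgroup.inf_relIndex_right, relIndex_stabilizer]
    refine Set.Infinite.mono ?_ hinf
    rintro _ ⟨h', hh', rfl⟩
    exact ⟨h' * h⁻¹, H.mul_mem hh' (H.inv_mem hh), by rw [e, mul_smul, inv_smul_smul]⟩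
  | succ n ih =>
    rintro D H hH ⟨E, X, hinf, hX, hXD, ⟨k, hk⟩, hrk⟩
    obtain ⟨B₁, -, hB₁, h₁⟩ := hX.finite
    obtain ⟨B₂, -, h₂⟩ := definable_iff_finitely_definable.1 E.rel_definable
    have hB : (B₁ ∪ B₂ : Set M).Finite := hB₁.union B₂.finite_toSet
    set K := H ⊓ fixingSubgroup _ (B₁ ∪ B₂ : Set M) with hK
    have hKO : FixOpen _ M K := hO.inf hH ⟨_, hB, le_rfl⟩
    have hKrel : ∀ g ∈ K, ∀ {v w x}, E.Codes v x → E.Codes w x →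
        ∃ y, E.Codes (g • v) y ∧ E.Codes (g • w) y := fun g hg _ _ _ hv hw =>
      E.rel_smul hB (h₂.mono subset_union_right) hg.2 hv hw
    have hKX : ∀ g ∈ K, ∀ {y v x x'}, E.Codes v x → E.Codes (g • v) x' → y ∈ X x → g • y ∈ X x' :=
      fun g hg y v x x' hv hv' hy => Interpretable.DefinableRel.smul hB
        (h₁.mono subset_union_left) hg.2 (x := fun _ => x) (x' := fun _ => x')
        (c := fun _ => v) (fun _ => hv) (fun _ => hv') hy
    have hcls : ∀ g ∈ K, ∀ {v x x'}, E.Codes v x → E.Codes (g • v) x' →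
        g • E.codeSet x = E.codeSet x' := by
      intro g hg v x x' hv hv'
      ext w
      rw [Set.mem_smul_set_iff_inv_smul_mem]
      constructor
      · intro hw
        obtain ⟨y, hy1, hy2⟩ := hKrel g hg hv hw
        rw [smul_inv_smul, Interpretable.Codes.unique hy1 hv'] at hy2
        exact hy2
      · intro hw
        obtain ⟨y, hy1, hy2⟩ := hKrel g⁻¹ (K.inv_mem hg) hv' hw
        rw [inv_smul_smul] at hy1
        rw [Interpretable.Codes.unique hy1 hv] at hy2
        exact hy2
    have hcode : ∀ g ∈ K, ∀ {v x}, E.Codes v x → ∃ x', E.Codes (g • v) x' := fun g hg _ _ hv =>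
      (hKrel g hg hv hv).imp fun _ h => h.1
    -- There are infinitely many classes but finitely many `K`-orbits of representatives, so some
    -- class has an infinite orbit; its stabilizer in `K` serves as `T`.
    obtain ⟨x, hx⟩ : ∃ x, {z | ∃ h ∈ K, z = h • E.codeSet x}.Infinite := by
      by_contra hcon
      push Not at hcon
      obtain ⟨F, hF, hcov⟩ := (hM.pi hO (Fin E.arity)).cover hO hKO
      refine Set.infinite_range_of_injective E.codeSet_injective (Set.Finite.subset
        (s := ⋃ f ∈ F, ⋃ x ∈ {x | E.Codes f x}, {z | ∃ h ∈ K, z = h • E.codeSet x})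
        (hF.biUnion fun f _ => Set.Finite.biUnion ?_ fun x _ => hcon x) ?_)
      · exact Set.Subsingleton.finite fun x hx y hy => Interpretable.Codes.unique hx hy
      · rintro _ ⟨x, rfl⟩
        obtain ⟨v, hv⟩ := E.exists_codes x
        obtain ⟨f, hf, h, hh, rfl⟩ := hcov v
        obtain ⟨x', hx'⟩ := hcode h⁻¹ (K.inv_mem hh) hv
        rw [inv_smul_smul] at hx'
        exact mem_biUnion hf (mem_biUnion hx' ⟨h, hh, (hcls h hh hx' hv).symm⟩)
    have hTO : FixOpen _ M (K ⊓ stabilizer _ (E.codeSet x)) := by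
      obtain ⟨v, hv⟩ := E.exists_codes x
      refine hO.mono ?_ (hO.inf hKO ((hM.pi hO (Fin E.arity)).stab v))
      rintro g ⟨hg, hgv⟩
      exact ⟨hg, hcls g hg hv (by rwa [show g • v = v from hgv])⟩
    obtain ⟨y, hy, hyn⟩ := ih hTO (hrk x)
    refine ⟨y, hXD x hy, K, _, hTO, inf_le_left, inf_le_left, ?_, ?_, hyn⟩
    · rwa [inf_comm, Subgroup.inf_relIndex_right, relIndex_stabilizer]
    -- By inconsistency `y` lies in finitely many members of the family, and automorphisms in `K`
    -- that fix `y` move the class `x` only among their indices.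
    · have hfin : {x' | y ∈ X x'}.Finite := by
        by_contra hinf'
        obtain ⟨s, hs, hsk⟩ := Set.Infinite.exists_subset_card_eq hinf' k
        exact hk s hsk ⟨y, fun t ht => hs ht⟩
      have : (stabilizer _ (E.codeSet x)).relIndex (K ⊓ stabilizer _ y) ≠ 0 := by
        rw [relIndex_stabilizer_ne]
        refine (hfin.image E.codeSet).subset ?_
        rintro _ ⟨g, ⟨hg, hgy⟩, rfl⟩
        obtain ⟨v, hv⟩ := E.exists_codes x
        obtain ⟨x', hx'⟩ := hcode g hg hv
        refine ⟨x', ?_, (hcls g hg hv hx').symm⟩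
        have := hKX g hg hv hx' hy
        rwa [show g • y = y from hgy] at this
      rw [← Subgroup.inf_relIndex_right] at this ⊢
      convert this using 2
      ext g
      simp only [Subgroup.mem_inf]
      tauto

end Imaginaries

/-! ### From the rank of stabilizers to the rank of definable sets -/

section RankComparison

open MulAction OpenSubgroups

variable {L : FirstOrder.Language.{u, v}} {M : Type w} [L.Structure M]

/-- The quotient of an orbit of tuples by an invariant equivalence relation, given by an open
subgroup `T` of `K`. -/
noncomputable def OmegaCategorical.orbitQuotient (hcat : OmegaCategorical L M)
    {K T : Subgroup (elemAut L M)} (hTK : T ≤ K) {n : ℕ} {e : Fin n → M}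
    (he : stabilizer _ e ≤ T) : Interpretable L M (Set.univ : Set M) where
  arity := n
  dom := {v | ∃ k ∈ K, v = k • e}
  rel :=
    { r := fun v w => ∃ k ∈ K, ∃ k' ∈ K, v.1 = k • e ∧ w.1 = k' • e ∧ k⁻¹ * k' ∈ T
      iseqv :=
        { refl := by
            rintro ⟨_, k, hk, rfl⟩
            exact ⟨k, hk, k, hk, rfl, rfl, by simp⟩
          symm := by
            rintro v w ⟨k, hk, k', hk', h1, h2, h3⟩
            exact ⟨k', hk', k, hk, h2, h1, by simpa using T.inv_mem h3⟩
          trans := by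
            rintro v w z ⟨k, hk, k', hk', h1, h2, h3⟩ ⟨l, hl, l', hl', h4, h5, h6⟩
            refine ⟨k, hk, l', hl', h1, h5, ?_⟩
            have : k'⁻¹ * l ∈ T := he (by
              rw [mem_stabilizer_iff, mul_smul, ← h4, h2, inv_smul_smul])
            have := T.mul_mem (T.mul_mem h3 this) h6
            convert this using 1
            group } }
  dom_definable := by
    refine (hcat.definable (finite_range e) fun g hg v hv => ?_).mono (subset_univ _)
    obtain ⟨k, hk, rfl⟩ := hv
    have hge : g ∈ K := hTK (he (funext fun i => (mem_fixingSubgroup_iff _).1 hg _ ⟨i, rfl⟩))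
    exact ⟨g * k, K.mul_mem hge hk, (mul_smul _ _ _).symm⟩
  rel_definable := by
    refine (hcat.definable (finite_range e) fun g hg v hv => ?_).mono (subset_univ _)
    obtain ⟨_, _, k, hk, k', hk', h1, h2, h3⟩ := hv
    have hge : g ∈ K := hTK (he (funext fun i => (mem_fixingSubgroup_iff _).1 hg _ ⟨i, rfl⟩))
    have e1 : (fun i => (g • v) (Sum.inl i)) = (g * k) • e := by
      rw [mul_smul, ← h1]
      rfl
    have e2 : (fun i => (g • v) (Sum.inr i)) = (g * k') • e := by
      rw [mul_smul, ← h2]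
      rfl
    exact ⟨⟨g * k, K.mul_mem hge hk, e1⟩, ⟨g * k', K.mul_mem hge hk', e2⟩, g * k,
      K.mul_mem hge hk, g * k', K.mul_mem hge hk', e1, e2, by
        convert h3 using 1
        group⟩

/-- A set that contains the `H`-orbit of a point of rank at least `n` over `H` has rank at
least `n`. -/
theorem OmegaCategorical.rankGE_of_rkGE (hcat : OmegaCategorical L M) {α : Type} [Finite α] {n : ℕ} :
    ∀ {D : Set (α → M)} {y : α → M} {H : Subgroup (elemAut L M)}, (∀ h ∈ H, h • y ∈ D) →
      RkGE (FixOpen (elemAut L M) M) n (stabilizer _ y) H → rankGE L n D := by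
  have hO := FixOpen.openSubgroups (G := elemAut L M) (M := M) fun α _ => hcat.finite_orbits α
  induction n with
  | zero => intro D y H _ _; trivial
  | succ n ih =>
    rintro D y H hD ⟨K, T, hT, hTK, hKH, hT0, hTP, hn⟩
    -- Rank at least 1 means being infinite. Here `T` has infinite index in `K` but finite index
    -- over the stabilizer of `y`, so the `K`-orbit of `y` is infinite.
    rcases n with _ | n
    · have h1 : (stabilizer (elemAut L M) y).relIndex K = 0 := by
        by_contra hne
        refine Subgroup.relIndex_ne_zero_trans hTP ?_ hT0
        rwa [inf_comm, Subgroup.inf_relIndex_right]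
      refine Set.Infinite.mono ?_ ((relIndex_stabilizer _ _).1 h1)
      rintro _ ⟨k, hk, rfl⟩
      exact hD k (hKH hk)
    obtain ⟨l, e, he⟩ := FixOpen.iff_tuple.1 hT
    set E := hcat.orbitQuotient hTK he with hE
    have hcode : ∀ k ∈ K, ∃ x : E.Carrier, E.Codes (k • e) x := fun k hk => ⟨_, ⟨k, hk, rfl⟩, rfl⟩
    have hrep : ∀ x : E.Carrier, ∃ k ∈ K, E.Codes (k • e) x := fun x => by
      obtain ⟨v, hv⟩ := E.exists_codes x
      obtain ⟨⟨k, hk, rfl⟩, -⟩ := id hv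
      exact ⟨k, hk, hv⟩
    have heq : ∀ {k k' : elemAut L M} {x : E.Carrier}, E.Codes (k • e) x → E.Codes (k' • e) x →
        k⁻¹ * k' ∈ T := by
      rintro k k' x ⟨h1, h2⟩ ⟨h3, h4⟩
      obtain ⟨l, hl, l', hl', h5, h6, h7⟩ := Quotient.exact (h2.trans h4.symm)
      have h8 : k⁻¹ * l ∈ T := he (by
        rw [mem_stabilizer_iff, mul_smul, ← show k • e = l • e from h5, inv_smul_smul])
      have h9 : l'⁻¹ * k' ∈ T := he (by
        rw [mem_stabilizer_iff, mul_smul, show k' • e = l' • e from h6, inv_smul_smul])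
      have := T.mul_mem (T.mul_mem h8 h7) h9
      convert this using 1
      group
    have heq' : ∀ {k k' : elemAut L M} {x : E.Carrier}, k ∈ K → k' ∈ K → E.Codes (k • e) x →
        k⁻¹ * k' ∈ T → E.Codes (k' • e) x := by
      rintro k k' x hk hk' ⟨h1, rfl⟩ h
      refine ⟨⟨k', hk', rfl⟩, Quotient.sound ⟨k', hk', k, hk, rfl, rfl, ?_⟩⟩
      simpa using T.inv_mem h
    choose κ hκ hκe using hrep
    set ψ : E.Carrier → elemAut L M ⧸ T := fun x => ((κ x : elemAut L M) : elemAut L M ⧸ T) with hψ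
    have hψc : ∀ {k : elemAut L M} {x}, E.Codes (k • e) x → ψ x = (k : elemAut L M ⧸ T) :=
      fun h => QuotientGroup.eq.2 (heq (hκe _) h)
    have hψinj : Function.Injective ψ := by
      intro x x' h
      have := heq' (hκ x) (hκ x') (hκe x) (QuotientGroup.eq.1 h)
      exact this.unique (hκe x')
    have hst : stabilizer (elemAut L M) ((1 : elemAut L M) : elemAut L M ⧸ T) = T :=
      MulAction.stabilizer_quotient T
    have hmk : ∀ k : elemAut L M, k • ((1 : elemAut L M) : elemAut L M ⧸ T) =
        (k : elemAut L M ⧸ T) := fun k => by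
      show ((k * 1 : elemAut L M) : elemAut L M ⧸ T) = _
      rw [mul_one]
    -- The family consists of the `K`-translates of the orbit `T • y`, indexed by `K / T`.
    refine ⟨E, fun x => {z | ∃ k ∈ K, E.Codes (k • e) x ∧ ∃ t ∈ T, z = k • t • y}, ?_, ?_, ?_, ?_, ?_⟩
    · by_contra hfin
      rw [not_infinite_iff_finite] at hfin
      rw [← hst, relIndex_stabilizer] at hT0
      refine hT0 ((finite_range ψ).subset ?_)
      rintro _ ⟨k, hk, rfl⟩
      obtain ⟨x, hx⟩ := hcode k hk
      exact ⟨x, (hψc hx).trans (hmk k).symm⟩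
    · refine (hcat.definable (finite_range e) fun g hg v hv => ?_).mono (subset_univ _)
      have hge : g ∈ K := hTK (he (funext fun i => (mem_fixingSubgroup_iff _).1 hg _ ⟨i, rfl⟩))
      obtain ⟨x, hx, k, hk, hkx, t, ht, hz⟩ := hv
      obtain ⟨⟨k', hk', hk'e⟩, -⟩ := id (hx 0)
      have h1 : E.Codes (k' • e) (x 0) := by
        have := hx 0
        rwa [hk'e] at this
      obtain ⟨x', hx'⟩ := hcode (g * k) (K.mul_mem hge hk)
      refine ⟨fun _ => x', fun i => ?_, g * k, K.mul_mem hge hk, hx', t, ht, ?_⟩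
      · have e1 : (fun j => (g • v) (Sum.inr (i, j))) = (g * k') • e := by
          rw [mul_smul, ← hk'e, Subsingleton.elim i 0]
          rfl
        rw [e1]
        refine heq' (K.mul_mem hge hk) (K.mul_mem hge hk') hx' ?_
        have := heq hkx h1
        convert this using 1
        group
      · rw [mul_smul, ← hz]
        rfl
    · rintro x _ ⟨k, hk, -, t, ht, rfl⟩
      rw [← mul_smul]
      exact hD _ (hKH (K.mul_mem hk (hTK ht)))
    · have hfin : {z | ∃ p ∈ K ⊓ stabilizer (elemAut L M) y,
          z = p • ((1 : elemAut L M) : elemAut L M ⧸ T)}.Finite := by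
        rw [← relIndex_stabilizer_ne, hst]
        exact hTP
      -- A common point `k0 • t0 • y` of several members allows their indices to be pulled back into
      -- the finite orbit of the coset `T` under `K ⊓ stabilizer y`.
      refine ⟨hfin.toFinset.card + 1, ?_⟩
      rintro s hs ⟨z, hz⟩
      obtain ⟨x0, hx0⟩ : s.Nonempty := by
        rw [← Finset.card_pos]; omega
      obtain ⟨k0, hk0, -, t0, ht0, rfl⟩ := hz x0 hx0
      have hle := Finset.card_le_card_of_injOn (s := s) (t := hfin.toFinset)
        (fun x => (k0 * t0)⁻¹ • ψ x) (by
          intro x hx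
          obtain ⟨k, hk, hkx, t, ht, hkt⟩ := hz x hx
          rw [Finset.mem_coe, hfin.mem_toFinset]
          refine ⟨(k0 * t0)⁻¹ * (k * t), ⟨K.mul_mem (K.inv_mem (K.mul_mem hk0 (hTK ht0)))
            (K.mul_mem hk (hTK ht)), ?_⟩, ?_⟩
          · show ((k0 * t0)⁻¹ * (k * t)) • y = y
            rw [mul_smul, mul_smul k t, ← hkt, ← mul_smul k0, inv_smul_smul]
          · have ht1 : t • ((1 : elemAut L M) : elemAut L M ⧸ T) = ((1 : elemAut L M) : elemAut L M ⧸ T) := by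
              rw [← mem_stabilizer_iff, hst]; exact ht
            show (k0 * t0)⁻¹ • ψ x = _
            rw [hψc hkx, mul_smul, mul_smul k, ht1, hmk]) (by
          intro x _ x' _ h
          exact hψinj (smul_left_cancel _ h))
      omega
    · intro x
      refine ih (y := κ x • y) (H := cj (κ x) T) ?_ ?_
      · rintro _ ⟨t, ht, rfl⟩
        refine ⟨κ x, hκ x, hκe x, t, ht, ?_⟩
        simp [MulAut.conj_apply, mul_smul]
      · rw [cj_stabilizer]
        exact hn.conj hO _

end RankComparison

/-! ### Finite ranks and the rank of a tuple -/

section RankValues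

open MulAction OpenSubgroups

variable {L : FirstOrder.Language.{u, v}} {M : Type w} [L.Structure M]

theorem OmegaCategorical.openSubgroups (hcat : OmegaCategorical L M) :
    OpenSubgroups (FixOpen (elemAut L M) M) :=
  FixOpen.openSubgroups fun α _ => hcat.finite_orbits α

theorem OmegaCategorical.smoothAction (hcat : OmegaCategorical L M) :
    SmoothAction (FixOpen (elemAut L M) M) M :=
  FixOpen.smoothAction fun α _ => hcat.finite_orbits α

theorem setRank_ne_top {α : Type} {D : Set (α → M)} (h : setRank L D ≠ ⊤) :
    ∃ n, ¬ rankGE L (n + 1) D := by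
  by_contra hcon
  push Not at hcon
  refine h (ENat.eq_top_iff_forall_ge.2 fun n => ?_)
  refine le_trans ?_ (le_iSup₂_of_le (n + 1) (hcon n) le_rfl)
  exact_mod_cast Nat.le_succ n

/-- A single element has rank at most `N`, so an `n`-tuple has rank at most `n * N` by additivity.
An open subgroup contains the stabilizer of a tuple, and the rank of the tuple bounds its own. -/
theorem OmegaCategorical.finiteRk (hcat : OmegaCategorical L M) (hrank : FiniteRank L M) :
    FiniteRk (FixOpen (elemAut L M) M) := by
  have hO := hcat.openSubgroups
  obtain ⟨N, hN⟩ := setRank_ne_top hrank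
  have h1 : ∀ (m : M) (H : Subgroup (elemAut L M)),
      ¬ RkGE (FixOpen (elemAut L M) M) (N + 1) (stabilizer _ m) H := by
    intro m H h
    refine hN (hcat.rankGE_of_rkGE (y := fun _ : Fin 1 => m) (fun _ _ => mem_univ _) (H := H) ?_)
    have e : stabilizer (elemAut L M) (fun _ : Fin 1 => m) = stabilizer _ m := by
      ext g
      exact ⟨fun h => congrFun h 0, fun h => funext fun _ => h⟩
    rwa [e]
  have h2 : ∀ (n : ℕ) (a : Fin n → M) (H : Subgroup (elemAut L M)),
      ¬ RkGE (FixOpen (elemAut L M) M) (n * N + 1) (stabilizer _ a) H := by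
    intro n
    induction n with
    | zero =>
      rintro a H ⟨K, T, -, -, -, h3, h4, -⟩
      have : stabilizer (elemAut L M) a = ⊤ := by
        ext g
        simpa using Subsingleton.elim _ _
      rw [this, inf_top_eq] at h4
      exact h4 h3
    | succ n ih =>
      intro a H h
      have e : stabilizer (elemAut L M) a =
          stabilizer (elemAut L M) (a 0) ⊓ stabilizer (elemAut L M) (Fin.tail a) := by
        ext g
        constructor
        · exact fun h => ⟨congrFun h 0, funext fun i => congrFun h i.succ⟩
        · exact fun h => funext fun i => Fin.cases h.1 (fun j => congrFun h.2 j) i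
      rw [e] at h
      obtain ⟨i, j, hij, hi, hj⟩ := h.exists_add hO (hcat.smoothAction.stab (a 0))
      have h3 : i < N + 1 := by
        by_contra hle
        exact h1 _ _ (hi.of_le (not_lt.1 hle))
      have h4 : j < n * N + 1 := by
        by_contra hle
        exact ih _ _ (hj.of_le (not_lt.1 hle))
      rw [add_mul] at hij
      omega
  refine ⟨hO, fun {P} hP => ?_⟩
  obtain ⟨n, a, ha⟩ := FixOpen.iff_tuple.1 hP
  refine ⟨n * N + 1, fun h => h2 n a ⊤ ?_⟩
  have := h.add (m := 0) (Q := stabilizer _ a) hO hP trivial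
  rwa [inf_eq_right.2 ha] at this

/-- The least `∅`-definable set containing `a` is its orbit, all of whose points have the same rank
over `⊤`. -/
theorem OmegaCategorical.tupleRank_eq (hcat : OmegaCategorical L M) (hrank : FiniteRank L M)
    {α : Type} [Finite α] (a : α → M) :
    tupleRank L a ∅ = (rk (FixOpen (elemAut L M) M) (stabilizer _ a) ⊤ : ℕ) := by
  have hF := hcat.finiteRk hrank
  have hst : ∀ y : α → M, FixOpen (elemAut L M) M (stabilizer _ y) :=
    (hcat.smoothAction.pi hcat.openSubgroups α).stab
  refine le_antisymm ?_ ?_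
  · refine iInf₂_le_of_le (orbit (elemAut L M) a) ⟨hcat.definable finite_empty ?_,
      mem_orbit_self a⟩ ?_
    · rintro g - _ ⟨h, rfl⟩
      exact ⟨g * h, mul_smul _ _ _⟩
    · refine iSup₂_le fun n hn => ?_
      rcases n with _ | n
      · simp
      obtain ⟨_, ⟨g, rfl⟩, hy⟩ := hcat.exists_rkGE hF.top hn
      have h1 := (hF.rkGE_iff (hst _) _ _).1 hy
      have h2 := hF.rk_conj (H := ⊤) (hst a) g
      rw [cj_of_mem (Subgroup.mem_top g)] at h2
      rw [show stabilizer (elemAut L M) ((fun m : elemAut L M => m • a) g) = _ from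
        cj_stabilizer g a, h2] at h1
      exact_mod_cast h1
  · refine le_iInf₂ fun D hD => ?_
    refine le_iSup₂_of_le _ (hcat.rankGE_of_rkGE (y := a) (H := ⊤) (fun g _ => ?_)
      ((hF.rkGE_iff (hst a) ⊤ _).2 le_rfl)) le_rfl
    exact hD.1.smul_mem finite_empty ((mem_fixingSubgroup_iff _).2 fun y hy => absurd hy
      (notMem_empty y)) hD.2

theorem stabilizer_sum_elim {G M α β : Type*} [Group G] [MulAction G M] (a : α → M) (b : β → M) :
    stabilizer G (Sum.elim a b) = stabilizer G a ⊓ stabilizer G b := by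
  ext g
  constructor
  · exact fun h => ⟨funext fun i => congrFun h (Sum.inl i), funext fun i => congrFun h (Sum.inr i)⟩
  · rintro ⟨h1, h2⟩
    refine funext fun i => ?_
    rcases i with i | i
    · exact congrFun h1 i
    · exact congrFun h2 i

/-- Under the hypothesis of the theorem on the ranks, either ranks add up or `a` is algebraic
over `b`. -/
theorem OmegaCategorical.rk_add_or (hcat : OmegaCategorical L M) (hrank : FiniteRank L M)
    {α β : Type} [Finite α] [Finite β] (a : α → M) (b : β → M)
    (hab : RankIndependent L a b ∅ ∨ tupleRank L a ∅ = 1) :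
    rk (FixOpen (elemAut L M) M) (stabilizer _ a ⊓ stabilizer _ b) ⊤ =
      rk (FixOpen (elemAut L M) M) (stabilizer _ a) ⊤ + rk (FixOpen (elemAut L M) M) (stabilizer _ b) ⊤ ∨
    (stabilizer (elemAut L M) a).relIndex (stabilizer _ b) ≠ 0 := by
  have hF := hcat.finiteRk hrank
  have hsta := (hcat.smoothAction.pi hcat.openSubgroups α).stab a
  have hstb := (hcat.smoothAction.pi hcat.openSubgroups β).stab b
  rcases hab with hab | hab
  · left
    rw [RankIndependent, hcat.tupleRank_eq hrank, hcat.tupleRank_eq hrank,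
      hcat.tupleRank_eq hrank, stabilizer_sum_elim] at hab
    exact_mod_cast hab
  · rw [hcat.tupleRank_eq hrank] at hab
    have h1 : rk (FixOpen (elemAut L M) M) (stabilizer _ a) ⊤ = 1 := by exact_mod_cast hab
    by_cases h0 : rk (FixOpen (elemAut L M) M) (stabilizer _ a) (stabilizer _ b) = 0
    · exact Or.inr (hF.relIndex_ne_zero_of_rk hsta hstb h0)
    · left
      have h2 := hF.rk_inf hstb hsta ⊤
      have h3 := hF.rk_mono hsta (le_top : stabilizer (elemAut L M) b ≤ ⊤)
      rw [top_inf_eq, inf_comm] at h2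
      omega

end RankValues

/-! ### The action on imaginaries and on cuts -/

section ActionOnImaginaries

open MulAction OpenSubgroups Pointwise

variable {L : FirstOrder.Language.{u, v}} {M : Type w} [L.Structure M]

theorem mem_fixingSubgroup_empty {G M : Type*} [Group G] [MulAction G M] (g : G) :
    g ∈ fixingSubgroup G (∅ : Set M) :=
  (mem_fixingSubgroup_iff G).2 fun _ h => absurd h (notMem_empty _)

namespace Interpretable

variable {X : Interpretable L M (∅ : Set M)}

theorem smul_mem_dom (X : Interpretable L M (∅ : Set M)) (g : elemAut L M) {v : Fin X.arity → M}
    (hv : v ∈ X.dom) : g • v ∈ X.dom :=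
  X.dom_definable.smul_mem finite_empty (mem_fixingSubgroup_empty g) hv

instance : MulAction (elemAut L M) X.Carrier where
  smul g := Quotient.map (fun v => ⟨g • v.1, X.smul_mem_dom g v.2⟩) fun v w h => by
    obtain ⟨h1, h2, h3⟩ := X.rel_definable.smul_mem finite_empty (mem_fixingSubgroup_empty g)
      (v := Sum.elim v.1 w.1) ⟨v.2, w.2, h⟩
    exact h3
  one_smul x := by
    obtain ⟨v, rfl⟩ := Quotient.exists_rep x
    exact congrArg (Quotient.mk X.rel) (Subtype.ext (one_smul _ _))
  mul_smul g h x := by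
    obtain ⟨v, rfl⟩ := Quotient.exists_rep x
    exact congrArg (Quotient.mk X.rel) (Subtype.ext (mul_smul _ _ _))

theorem Codes.smul {v : Fin X.arity → M} {x : X.Carrier} (h : X.Codes v x) (g : elemAut L M) :
    X.Codes (g • v) (g • x) := by
  obtain ⟨hv, rfl⟩ := h
  exact ⟨X.smul_mem_dom g hv, rfl⟩

theorem smoothAction (hcat : OmegaCategorical L M) (X : Interpretable L M (∅ : Set M)) :
    SmoothAction (FixOpen (elemAut L M) M) X.Carrier := by
  have hpi := hcat.smoothAction.pi hcat.openSubgroups (Fin X.arity)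
  refine ⟨fun x => ?_, ?_⟩
  · obtain ⟨v, hv⟩ := X.exists_codes x
    refine hcat.openSubgroups.mono ?_ (hpi.stab v)
    intro g hg
    refine (hv.smul g).unique ?_
    rwa [show g • v = v from hg]
  · obtain ⟨F, hF, hcov⟩ := hpi.orbits
    refine ⟨⋃ f ∈ F, {x | X.Codes f x}, hF.biUnion fun f _ => Set.Subsingleton.finite
      fun x hx y hy => Codes.unique hx hy, fun x => ?_⟩
    obtain ⟨v, hv⟩ := X.exists_codes x
    obtain ⟨f, hf, g, rfl⟩ := hcov v
    have := hv.smul g⁻¹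
    rw [inv_smul_smul] at this
    exact ⟨_, mem_biUnion hf this, g, (smul_inv_smul _ _).symm⟩

theorem DefinableRel.smul_iff {B : Set M} (hB : B.Finite) {α : Type} [Finite α]
    {l : ℕ} {S : (α → M) → (Fin l → X.Carrier) → Prop} (hS : X.DefinableRel B S) {g : elemAut L M}
    (hg : g ∈ fixingSubgroup _ B) {y : α → M} {x : Fin l → X.Carrier} :
    S (g • y) (g • x) ↔ S y x := by
  have key : ∀ {g : elemAut L M}, g ∈ fixingSubgroup _ B → ∀ {y : α → M} {x : Fin l → X.Carrier},
      S y x → S (g • y) (g • x) := by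
    intro g hg y x h
    choose c hc using fun i => X.exists_codes (x i)
    exact hS.smul hB hg hc (fun i => (hc i).smul g) h
  refine ⟨fun h => ?_, key hg⟩
  have := key ((fixingSubgroup _ B).inv_mem hg) h
  rwa [inv_smul_smul, inv_smul_smul] at this

theorem definableRel (hcat : OmegaCategorical L M) {B : Set M} (hB : B.Finite) {α : Type} [Finite α]
    {l : ℕ} {S : (α → M) → (Fin l → X.Carrier) → Prop}
    (hS : ∀ g : elemAut L M, g ∈ fixingSubgroup _ B → ∀ y x, S y x → S (g • y) (g • x)) :
    X.DefinableRel B S := by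
  refine hcat.definable hB fun g hg v hv => ?_
  obtain ⟨x, hx, h⟩ := hv
  exact ⟨g • x, fun i => (hx i).smul g, hS g hg _ _ h⟩

theorem DefinableFamily.smul {k : ℕ} {R : (Fin k → M) → Set X.Carrier} (hR : X.DefinableFamily ∅ R)
    (g : elemAut L M) (d : Fin k → M) : R (g • d) = g • R d := by
  ext x
  rw [Set.mem_smul_set_iff_inv_smul_mem]
  have := DefinableRel.smul_iff finite_empty hR (mem_fixingSubgroup_empty g⁻¹) (y := g • d)
    (x := fun _ => x)
  rw [inv_smul_smul] at this
  exact this.symm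

theorem DefinableSubset.smul {I : Set X.Carrier} (hcat : OmegaCategorical L M)
    (hI : X.DefinableSubset Set.univ I)
    (g : elemAut L M) : X.DefinableSubset Set.univ (g • I) := by
  have hI' : X.DefinableRel Set.univ (α := Fin 0) (l := 1) (fun _ x => x 0 ∈ I) := hI
  show X.DefinableRel Set.univ (α := Fin 0) (l := 1) (fun _ x => x 0 ∈ g • I)
  obtain ⟨B, -, hB, h⟩ := hI'.finite
  refine DefinableRel.mono (definableRel hcat (hB.image fun m => g • m) ?_) (subset_univ _)
  intro g' hg' _ x hx
  rw [Set.mem_smul_set_iff_inv_smul_mem] at hx ⊢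
  have hmem : g⁻¹ * g' * g ∈ fixingSubgroup (elemAut L M) B := by
    refine (mem_fixingSubgroup_iff _).2 fun m hm => ?_
    rw [mul_smul, mul_smul, (mem_fixingSubgroup_iff _).1 hg' _ ⟨m, hm, rfl⟩, inv_smul_smul]
  have := (DefinableRel.smul_iff hB h hmem (y := Fin.elim0) (x := fun _ => g⁻¹ • x 0)).2 hx
  have e : ((g⁻¹ * g' * g) • fun _ : Fin 1 => g⁻¹ • x 0) 0 = g⁻¹ • (g' • x) 0 := by
    simp only [Pi.smul_apply, mul_smul, smul_inv_smul]
  rwa [e] at this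

end Interpretable

/-- The notion of cut is invariant under automorphisms. -/
class InvariantCuts {X : Interpretable L M (∅ : Set M)} (N : CutNotion X.Carrier) : Prop where
  isRep_smul : ∀ (g : elemAut L M) {I : Set X.Carrier}, N.IsRep I → N.IsRep (g • I)
  same_smul : ∀ (g : elemAut L M) {I J : Set X.Carrier} (hI : N.IsRep I) (hJ : N.IsRep J),
    N.same ⟨I, hI⟩ ⟨J, hJ⟩ → N.same ⟨g • I, isRep_smul g hI⟩ ⟨g • J, isRep_smul g hJ⟩

namespace CutNotion

variable {X : Interpretable L M (∅ : Set M)} {N : CutNotion X.Carrier}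

theorem Represents.unique {I : Set X.Carrier} {c c' : N.Completion} (h : N.Represents I c)
    (h' : N.Represents I c') : c = c' := by
  obtain ⟨hI, rfl⟩ := h
  obtain ⟨hI', rfl⟩ := h'
  rfl

theorem exists_represents (c : N.Completion) : ∃ I, N.Represents I c := by
  obtain ⟨⟨I, hI⟩, rfl⟩ := Quotient.exists_rep c
  exact ⟨I, hI, rfl⟩

instance [InvariantCuts N] : MulAction (elemAut L M) N.Completion where
  smul g := Quotient.map (fun I => ⟨g • I.1, InvariantCuts.isRep_smul g I.2⟩)
    fun I J h => InvariantCuts.same_smul g I.2 J.2 h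
  one_smul c := by
    obtain ⟨I, rfl⟩ := Quotient.exists_rep c
    exact congrArg (Quotient.mk N.same) (Subtype.ext (one_smul _ _))
  mul_smul g h c := by
    obtain ⟨I, rfl⟩ := Quotient.exists_rep c
    exact congrArg (Quotient.mk N.same) (Subtype.ext (mul_smul _ _ _))

theorem Represents.smul [InvariantCuts N] {I : Set X.Carrier} {c : N.Completion}
    (h : N.Represents I c) (g : elemAut L M) : N.Represents (g • I) (g • c) := by
  obtain ⟨hI, rfl⟩ := h
  exact ⟨InvariantCuts.isRep_smul g hI, rfl⟩

/-- Definable functions to the completion are equivariant. -/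
theorem DefinableMap.smul_eq [InvariantCuts N] {α : Type} [Finite α] {S : Set (α → M)}
    {f : S → N.Completion} (hf : N.DefinableMap ∅ f) (g : elemAut L M) {s : α → M} (hs : s ∈ S)
    (hgs : g • s ∈ S) : f ⟨g • s, hgs⟩ = g • f ⟨s, hs⟩ := by
  obtain ⟨k, R, hR, h1, h2⟩ := hf
  obtain ⟨d, hd⟩ := h1 ⟨s, hs⟩
  obtain ⟨h3, h4⟩ := h2.smul_mem finite_empty (mem_fixingSubgroup_empty g) (v := Sum.elim s d)
    ⟨hs, hd⟩
  have h5 := hd.smul g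
  rw [← hR.smul] at h5
  exact Represents.unique h4 h5

/-- A value of a definable function to the completion with a finite orbit over `B` is algebraic
over `B`. -/
theorem DefinableMap.algebraic [InvariantCuts N] (hcat : OmegaCategorical L M) {α : Type}
    {S : Set (α → M)} {f : S → N.Completion} (hf : N.DefinableMap ∅ f) (s : S) {B : Set M}
    (hB : B.Finite) (hfin : {z | ∃ g ∈ fixingSubgroup (elemAut L M) B, z = g • f s}.Finite) :
    N.Algebraic B (f s) := by
  obtain ⟨k, R, hR, h1, -⟩ := hf
  obtain ⟨d, hd⟩ := h1 s
  refine ⟨k, R, hR, {d | ∃ g ∈ fixingSubgroup (elemAut L M) B, N.Represents (R d) (g • f s)}, ?_, ?_,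
    hfin.subset ?_, d, ⟨1, Subgroup.one_mem _, by rwa [one_smul]⟩, hd⟩
  · refine hcat.definable hB ?_
    rintro g hg d ⟨g', hg', h⟩
    refine ⟨g * g', Subgroup.mul_mem _ hg hg', ?_⟩
    rw [hR.smul, mul_smul]
    exact h.smul g
  · rintro d ⟨g, -, h, -⟩
    exact h
  · rintro c ⟨d, ⟨g, hg, h⟩, h'⟩
    exact ⟨g, hg, h'.unique h⟩

end CutNotion

end ActionOnImaginaries

/-! ### Dense orbits shatter: the contradiction with NIP -/

section Shattering

open MulAction OpenSubgroups Topology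

/-- Appending a coordinate. -/
def snocHomeomorph (R : Type*) [TopologicalSpace R] (s : ℕ) : (Fin s → R) × R ≃ₜ (Fin (s + 1) → R) where
  toFun z := Fin.snoc (α := fun _ => R) z.1 z.2
  invFun w := (Fin.init w, w (Fin.last s))
  left_inv z := by simp
  right_inv w := by simp
  continuous_toFun := Continuous.finSnoc continuous_fst continuous_snd
  continuous_invFun := by
    refine Continuous.prodMk (continuous_pi fun i => ?_) (continuous_apply _)
    exact continuous_apply _

namespace TameAction

variable {G R : Type*} [Group G] [CompleteLinearOrder R] [TopologicalSpace R]
  [OrderTopology R] [DenselyOrdered R] [Nontrivial R] [MulAction G R] {Op : Subgroup G → Prop}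
  {Q : Set R}

/-- Iterates `interior_closure_ne_empty`: the coordinate `y s` is added by means of `S s`, which
fixes the earlier coordinates and moves `y s` infinitely often. -/
theorem interior_closure_sequence (hA : TameAction G R Op Q) {H : Subgroup G} (hH : Op H)
    {S : ℕ → Subgroup G} (hS : ∀ s, Op (S s)) {K : ℕ} {y : ℕ → R}
    (hSy : ∀ s, ∀ g ∈ S s, ∀ i < s, g • y i = y i)
    (hHi : ∀ s < K, {z | ∃ h ∈ H, z = h • y s}.Infinite)
    (hSi : ∀ s < K, {z | ∃ g ∈ S s, z = g • y s}.Infinite) {s : ℕ} (hs : s ≤ K) :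
    (interior (closure {z | ∃ h ∈ H, z = h • fun i : Fin s => y i})).Nonempty := by
  induction s with
  | zero =>
    refine ⟨Fin.elim0, mem_interior.2 ⟨univ, fun z _ => subset_closure ⟨1, H.one_mem, ?_⟩, isOpen_univ,
      mem_univ _⟩⟩
    exact Subsingleton.elim _ _
  | succ s ih =>
    have h1 := hA.interior_closure_ne_empty hH (hS s) (c := fun i : Fin s => y i) (y := y s)
      (fun g hg => funext fun i => hSy s g hg i i.2) (hHi s hs) (hSi s hs) (ih (Nat.le_of_succ_le hs))
    have h2 := h1.image (snocHomeomorph R s)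
    rw [Homeomorph.image_interior, Homeomorph.image_closure] at h2
    convert h2 using 4
    ext w
    have e : ∀ h : G, (snocHomeomorph R s) (h • (fun i : Fin s => y i, y s)) =
        h • fun i : Fin (s + 1) => y i := by
      intro h
      funext i
      refine Fin.lastCases ?_ (fun j => ?_) i
      · simp [snocHomeomorph]
      · simp [snocHomeomorph]
    constructor
    · rintro ⟨h, hh, rfl⟩
      exact ⟨_, ⟨h, hh, rfl⟩, e h⟩
    · rintro ⟨_, ⟨h, hh, rfl⟩, rfl⟩
      exact ⟨h, hh, e h⟩

/-- A rational point `m` inside a box in which the orbit is dense divides the box into open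
orthants, one for each `J`, and the orbit meets all of them. -/
theorem exists_shatter (hA : TameAction G R Op Q) {H : Subgroup G} {K : ℕ} {y : Fin K → R}
    (hy : (interior (closure {z | ∃ h ∈ H, z = h • y})).Nonempty) :
    ∃ m : Fin K → R, (∀ i, m i ∈ Q) ∧ ∀ J : Set (Fin K), ∃ h ∈ H, ∀ i,
      (i ∈ J → m i < h • y i) ∧ (i ∉ J → h • y i < m i) := by
  obtain ⟨z, hz⟩ := hy
  obtain ⟨p, q, hp, hq, hpq, hsub⟩ := hA.exists_box isOpen_interior hz
  choose m hm hpm hmq using fun i => hA.dense (hpq i)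
  refine ⟨m, hm, fun J => ?_⟩
  classical
  set U : Set (Fin K → R) := univ.pi fun i => if i ∈ J then Ioo (m i) (q i) else Ioo (p i) (m i) with hU
  have hUo : IsOpen U := isOpen_set_pi finite_univ fun i _ => by
    split_ifs
    exacts [isOpen_Ioo, isOpen_Ioo]
  have hUne : U.Nonempty := univ_pi_nonempty_iff.2 fun i => by
    split_ifs
    exacts [nonempty_Ioo.2 (hmq i), nonempty_Ioo.2 (hpm i)]
  obtain ⟨u, hu⟩ := hUne
  have huc : u ∈ closure {z | ∃ h ∈ H, z = h • y} := by
    refine interior_subset (hsub ⟨fun i => ?_, fun i => ?_⟩)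
    · have := hu i (mem_univ i)
      dsimp only at this
      split_ifs at this
      exacts [((hpm i).trans this.1).le, this.1.le]
    · have := hu i (mem_univ i)
      dsimp only at this
      split_ifs at this
      exacts [this.2.le, (this.2.trans (hmq i)).le]
  obtain ⟨_, hw, h, hh, rfl⟩ := mem_closure_iff.1 huc U hUo hu
  refine ⟨h, hh, fun i => ?_⟩
  have := hw i (mem_univ i)
  dsimp only at this
  constructor
  · intro hi
    rw [if_pos hi] at this
    exact this.1
  · intro hi
    rw [if_neg hi] at this
    exact this.2

end TameAction

/-- Links membership in a cut, on which a relation over `M` can be based, to the order of cuts, in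
which density is expressed. -/
theorem TameOrder.mem_iff_cut_lt {G V : Type*} [Group G] {Op : Subgroup G → Prop} [LinearOrder V]
    [MulAction G V] [OrderAction G V] (hV : TameOrder Op V) {L : RegCut V} {x : V} :
    x ∈ L.carrier ↔ hV.cut x < L := by
  refine ⟨fun h => hV.cut_lt h le_rfl, fun h => ?_⟩
  obtain ⟨w, hw, hwx⟩ := RegCut.lt_iff.1 h
  obtain ⟨w', hw', hww⟩ := L.regular w hw
  refine L.lower (le_of_not_gt fun hlt => hwx ?_) hw'
  exact hww.mono le_rfl hlt.le

section Restrict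

variable {G : Type*} [Group G] {Op : Subgroup G → Prop} {D : Subgroup G}

/-- The open subgroups of an open subgroup. -/
def RestrictOpen (Op : Subgroup G → Prop) (D : Subgroup G) (K : Subgroup D) : Prop :=
  Op (K.map D.subtype)

theorem OpenSubgroups.restrict (hO : OpenSubgroups Op) (hD : Op D) :
    OpenSubgroups (RestrictOpen Op D) where
  top := by
    rw [RestrictOpen, ← MonoidHom.range_eq_map, Subgroup.range_subtype]
    exact hD
  mono h := hO.mono (Subgroup.map_mono h)
  inf {H K} hH hK := by
    rw [RestrictOpen, Subgroup.map_inf _ _ _ D.subtype_injective]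
    exact hO.inf hH hK
  conj {H} g hH := by
    have : (cj g H).map D.subtype = cj (g : G) (H.map D.subtype) := by
      simp only [cj, Subgroup.map_map]
      rfl
    rw [RestrictOpen, this]
    exact hO.conj _ hH
  cover {H K} hH hK := by
    obtain ⟨F, hF, hcov⟩ := hO.cover hH hK
    refine ⟨(↑) ⁻¹' F, hF.preimage Subtype.val_injective.injOn, fun g => ?_⟩
    obtain ⟨_, ⟨h, hh, rfl⟩, f, hf, _, ⟨k, hk, rfl⟩, e⟩ := hcov g
    have hfD : f ∈ D := by
      have h1 : f = (h : G)⁻¹ * g * (k : G)⁻¹ := by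
        rw [e]
        simp [mul_assoc]
      rw [h1]
      exact D.mul_mem (D.mul_mem (D.inv_mem h.2) g.2) (D.inv_mem k.2)
    exact ⟨h, hh, ⟨f, hfD⟩, hf, k, hk, Subtype.ext e⟩

theorem OpenSubgroups.SmoothAction.restrict {α : Type*} [MulAction G α] (hα : SmoothAction Op α)
    (hO : OpenSubgroups Op) (hD : Op D) : SmoothAction (RestrictOpen Op D) α where
  stab a := by
    refine hO.mono ?_ (hO.inf (hα.stab a) hD)
    rintro g ⟨h1, h2⟩
    exact ⟨⟨g, h2⟩, h1, rfl⟩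
  orbits := by
    obtain ⟨F, hF, hcov⟩ := hα.cover hO hD
    refine ⟨F, hF, fun a => ?_⟩
    obtain ⟨f, hf, h, hh, e⟩ := hcov a
    exact ⟨f, hf, ⟨h, hh⟩, e⟩

theorem RestrictOpen.subgroupOf (hO : OpenSubgroups Op) (hD : Op D) {H : Subgroup G} (hH : Op H) :
    RestrictOpen Op D (H.subgroupOf D) := by
  rw [RestrictOpen, Subgroup.subgroupOf_map_subtype]
  exact hO.inf hH hD

end Restrict

section NIP

variable {L : FirstOrder.Language.{u, v}} {M : Type w} [L.Structure M]

/-- Invariant relations do not shatter large sets. -/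
theorem NIPStructure.exists_bound (hNIP : NIPStructure L M) (hcat : OmegaCategorical L M)
    {α β : Type} [Finite α] [Finite β] {Rel : (α → M) → (β → M) → Prop} {H : Subgroup (elemAut L M)}
    (hH : FixOpen (elemAut L M) M H) (hRel : ∀ h ∈ H, ∀ x y, Rel x y → Rel (h • x) (h • y)) :
    ∃ k : ℕ, ¬ ∃ (x : Fin k → α → M) (y : Set (Fin k) → β → M), ∀ i J, Rel (x i) (y J) ↔ i ∈ J := by
  obtain ⟨l, d, hd⟩ := FixOpen.iff_tuple.1 hH
  -- Adjoining the parameters `d` and saturating under the group gives a relation definable without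
  -- parameters, whose fibre at `d` is `Rel`.
  set Θ : Set (α ⊕ (β ⊕ Fin l) → M) :=
    {v | ∃ g : elemAut L M, ∃ x y, Rel x y ∧ v = g • Sum.elim x (Sum.elim y d)} with hΘ
  have hmem : ∀ x y, Sum.elim x (Sum.elim y d) ∈ Θ ↔ Rel x y := by
    intro x y
    constructor
    · rintro ⟨g, x', y', h, e⟩
      have e1 : x = g • x' := funext fun i => congrFun e (Sum.inl i)
      have e2 : y = g • y' := funext fun i => congrFun e (Sum.inr (Sum.inl i))
      have e3 : d = g • d := funext fun i => congrFun e (Sum.inr (Sum.inr i))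
      rw [e1, e2]
      exact hRel g (hd e3.symm) _ _ h
    · intro h
      exact ⟨1, x, y, h, (one_smul _ _).symm⟩
  have hdef : (∅ : Set M).Definable L Θ := by
    refine hcat.definable finite_empty ?_
    rintro g - _ ⟨g', x, y, h, rfl⟩
    exact ⟨g * g', x, y, h, (mul_smul _ _ _).symm⟩
  obtain ⟨φ, hφ⟩ := empty_definable_iff.1 hdef
  obtain ⟨p, ⟨e⟩⟩ := Finite.exists_equiv_fin α
  obtain ⟨q, ⟨e'⟩⟩ := Finite.exists_equiv_fin (β ⊕ Fin l)
  obtain ⟨k, hk⟩ := hNIP p q (φ.relabel (Sum.map e e'))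
  refine ⟨k, fun ⟨x, y, hxy⟩ => hk ⟨fun i => x i ∘ e.symm, fun J => Sum.elim (y J) d ∘ e'.symm,
    fun i J => ?_⟩⟩
  rw [Formula.realize_relabel, ← hxy, ← hmem, hφ]
  have : Sum.elim (x i ∘ e.symm) (Sum.elim (y J) d ∘ e'.symm) ∘ Sum.map e e' =
      Sum.elim (x i) (Sum.elim (y J) d) := by
    funext j
    rcases j with j | j <;> simp
  rw [this]
  rfl

end NIP

/-- The hypothesis that points of `Ψ` are, over a conjugate of `D`, cuts in a tame linear order is
incompatible with independence. -/
theorem OmegaCategorical.false_of_tame {L : FirstOrder.Language.{u, v}} {M : Type w} [L.Structure M]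
    (hcat : OmegaCategorical L M) (hrank : FiniteRank L M) (hNIP : NIPStructure L M)
    {α β : Type} [Finite α] [Finite β] (a : α → M) (b : β → M)
    (hab : rk (FixOpen (elemAut L M) M) (stabilizer _ a ⊓ stabilizer _ b) ⊤ =
      rk (FixOpen (elemAut L M) M) (stabilizer _ a) ⊤ +
        rk (FixOpen (elemAut L M) M) (stabilizer _ b) ⊤)
    (X : Interpretable L M (∅ : Set M)) {Ψ : Type*} [MulAction (elemAut L M) Ψ] (c : Ψ)
    (hc : stabilizer (elemAut L M) a ⊓ stabilizer _ b ≤ stabilizer _ c)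
    (hca : (stabilizer (elemAut L M) c).relIndex (stabilizer _ a) = 0)
    (hcb : (stabilizer (elemAut L M) c).relIndex (stabilizer _ b) = 0)
    {D : Subgroup (elemAut L M)} (hD : FixOpen (elemAut L M) M D)
    (hX : ∀ δ : elemAut L M, ∃ (_ : LinearOrder X.Carrier) (_ : OrderAction (cj δ D) X.Carrier)
      (_ : TameOrder (RestrictOpen (FixOpen (elemAut L M) M) (cj δ D)) X.Carrier)
      (κ : Ψ → RegCut X.Carrier), Function.Injective κ ∧
        ∀ (g : cj δ D) (x : Ψ), κ ((g : elemAut L M) • x) = g • κ x) : False := by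
  have hF := hcat.finiteRk hrank
  have hO := hcat.openSubgroups
  have hsa := (hcat.smoothAction.pi hO α).stab a
  have hsb := (hcat.smoothAction.pi hO β).stab b
  -- The conjugate of `D` comes out of the choice of an independent parameter, so the order on `X`
  -- can only be fixed afterwards.
  obtain ⟨δ, g, E, hE0, hgA, hE, hEo, h1, h2⟩ := hF.exists_sequence hsa hsb hD hab hc hca hcb
  obtain ⟨_, _, hV, κ, hκ, hκg⟩ := hX δ
  have hdn := hV.denselyOrdered
  have hnt := hV.nontrivial
  have hA := hV.tameAction
  have hD' := hO.conj δ hD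
  have hEmono : ∀ {i j}, i ≤ j → E j ≤ E i := by
    intro i j hij
    induction j, hij using Nat.le_induction with
    | base => exact le_rfl
    | succ n _ ih =>
      rw [hE]
      exact inf_le_left.trans ih
  have hED : ∀ n, E n ≤ cj δ D := fun n => hE0 ▸ hEmono (Nat.zero_le n)
  have hEb : ∀ {i n}, i < n → ∀ h ∈ E n, h • g i • b = g i • b := by
    intro i n hin h hh
    have h3 := hEmono (Nat.succ_le_of_lt hin) hh
    rw [hE, ← cj_stabilizer] at h3
    exact h3.2
  have hgc : ∀ {h : elemAut L M} {i : ℕ} {h' : elemAut L M}, h' • a = h • a → h' • b = h • g i • b →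
      h' • c = h • g i • c := by
    intro h i h' ha hb
    have h3 : (h * g i)⁻¹ * h' ∈ stabilizer (elemAut L M) a ⊓ stabilizer _ b := by
      refine ⟨?_, ?_⟩
      · show _ • a = a
        rw [mul_smul, ha, inv_smul_eq_iff, mul_smul, show g i • a = a from hgA i]
      · show _ • b = b
        rw [mul_smul, hb, inv_smul_eq_iff, mul_smul]
    have h4 := hc h3
    rw [mem_stabilizer_iff, mul_smul, inv_smul_eq_iff, mul_smul] at h4
    exact h4
  have hinf : ∀ {T : Subgroup (elemAut L M)} {i : ℕ}, T ≤ cj δ D →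
      (cj (g i) (stabilizer _ c)).relIndex T = 0 →
      {z | ∃ h ∈ T.subgroupOf (cj δ D), z = h • κ (g i • c)}.Infinite := by
    intro T i hT h
    rw [← cj_stabilizer, relIndex_stabilizer] at h
    refine (h.image hκ.injOn).mono ?_
    rintro _ ⟨_, ⟨t, ht, rfl⟩, rfl⟩
    exact ⟨⟨t, hT ht⟩, ht, hκg ⟨t, hT ht⟩ _⟩
  -- For conjugates `(a', b')` of `(a, b)`, a point `x` of `X` is related if it lies in the cut of
  -- the corresponding conjugate of `c`. The pairs `(x, b')` are to be shattered by the tuples `a'`.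
  set Rel : (Fin X.arity ⊕ β → M) → (α → M) → Prop := fun v a' => ∃ h : elemAut L M, ∃ x : X.Carrier,
    a' = h • a ∧ (fun i => v (Sum.inr i)) = h • b ∧ X.Codes (fun i => v (Sum.inl i)) x ∧
      x ∈ (κ (h • c)).carrier with hRel
  obtain ⟨K, hK⟩ := hNIP.exists_bound hcat (Rel := Rel) hD' (by
    rintro d hd v a' ⟨h, x, rfl, e, h3, h4⟩
    refine ⟨d * h, d • x, (mul_smul _ _ _).symm, ?_, h3.smul d, ?_⟩
    · rw [mul_smul, ← e]
      rfl
    · rw [mul_smul]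
      have := hκg ⟨d, hd⟩ (h • c)
      change κ (d • h • c) = _ at this
      rw [this]
      exact RegCut.smul_mem_smul (g := (⟨d, hd⟩ : cj δ D)).2 h4)
  have hne := hA.interior_closure_sequence (H := (E K).subgroupOf (cj δ D))
    (S := fun s => (stabilizer (elemAut L M) a ⊓ E s).subgroupOf (cj δ D))
    (RestrictOpen.subgroupOf hO hD' (hEo K))
    (fun s => RestrictOpen.subgroupOf hO hD' (hO.inf hsa (hEo s))) (K := K)
    (y := fun i => κ (g i • c)) (by
      intro s t ht i hi
      rw [← hκg]
      congr 1
      rw [← hgc (h := t) (h' := g i) _ _]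
      · rw [show t.1 • a = a from ht.1, show g i • a = a from hgA i]
      · exact (hEb hi _ ht.2).symm)
    (fun s hs => hinf (hED K) (h2 K s hs))
    (fun s _ => hinf (inf_le_right.trans (hED s)) (h1 s)) le_rfl
  obtain ⟨m, hm, hsh⟩ := hA.exists_shatter hne
  choose x hx using hm
  choose v hv using fun i => X.exists_codes (x i)
  choose h hh hhJ using hsh
  refine hK ⟨fun i => Sum.elim (v i) (g i • b), fun J => (h J : elemAut L M) • a, fun i J => ?_⟩
  have key : x i ∈ (κ ((h J : elemAut L M) • g i • c)).carrier ↔ i ∈ J := by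
    rw [hκg, hV.mem_iff_cut_lt, hx]
    constructor
    · intro hlt
      by_contra hi
      exact lt_asymm hlt ((hhJ J i).2 hi)
    · exact (hhJ J i).1
  rw [← key]
  have hhb : (h J : elemAut L M) • g i • b = g i • b := hEb i.2 _ (hh J)
  constructor
  · rintro ⟨h', x', e1, e2, h3, h4⟩
    have e3 : x' = x i := Interpretable.Codes.unique h3 (hv i)
    rw [hgc (h := h J) (i := i) e1.symm (by rw [hhb]; exact e2.symm), e3] at h4
    exact h4
  · intro hmem
    refine ⟨h J * g i, x i, ?_, ?_, hv i, ?_⟩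
    · rw [mul_smul, show g i • a = a from hgA i]
    · rw [mul_smul, hhb]
      rfl
    · rwa [mul_smul]

end Shattering

/-! ### Linear orders -/

section LinearCase

open MulAction OpenSubgroups Pointwise

variable {L : FirstOrder.Language.{u, v}} {M : Type w} [L.Structure M]

theorem fixingSubgroup_range {G M ι : Type*} [Group G] [MulAction G M] (a : ι → M) :
    fixingSubgroup G (range a) = stabilizer G a := by
  ext g
  rw [mem_fixingSubgroup_iff]
  constructor
  · exact fun h => funext fun i => h _ ⟨i, rfl⟩
  · rintro h _ ⟨i, rfl⟩
    exact congrFun h i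

theorem OmegaCategorical.algebraic_of_tame (hcat : OmegaCategorical L M) (hrank : FiniteRank L M)
    (hNIP : NIPStructure L M) {m n : ℕ} (a : Fin m → M) (b : Fin n → M)
    (hab : RankIndependent L a b ∅ ∨ tupleRank L a ∅ = 1)
    {X : Interpretable L M (∅ : Set M)} {N : CutNotion X.Carrier} [InvariantCuts N]
    {f : typeLocus L (Sum.elim a b) → N.Completion} (hf : N.DefinableMap ∅ f)
    {D : Subgroup (elemAut L M)} (hD : FixOpen (elemAut L M) M D)
    (hX : ∀ δ : elemAut L M, ∃ (_ : LinearOrder X.Carrier) (_ : OrderAction (cj δ D) X.Carrier)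
      (_ : TameOrder (RestrictOpen (FixOpen (elemAut L M) M) (cj δ D)) X.Carrier)
      (κ : N.Completion → RegCut X.Carrier), Function.Injective κ ∧
        ∀ (g : cj δ D) (x : N.Completion), κ ((g : elemAut L M) • x) = g • κ x) :
    N.Algebraic (range a) (f ⟨Sum.elim a b, rfl⟩) ∨
      N.Algebraic (range b) (f ⟨Sum.elim a b, rfl⟩) := by
  by_contra hcon
  push Not at hcon
  set c := f ⟨Sum.elim a b, rfl⟩ with hc
  have hca : (stabilizer (elemAut L M) c).relIndex (stabilizer _ a) = 0 := by
    rw [relIndex_stabilizer, ← fixingSubgroup_range]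
    exact fun h => hcon.1 (hf.algebraic hcat _ (finite_range a) h)
  have hcb : (stabilizer (elemAut L M) c).relIndex (stabilizer _ b) = 0 := by
    rw [relIndex_stabilizer, ← fixingSubgroup_range]
    exact fun h => hcon.2 (hf.algebraic hcat _ (finite_range b) h)
  have hle : stabilizer (elemAut L M) a ⊓ stabilizer _ b ≤ stabilizer _ c := by
    rw [← stabilizer_sum_elim]
    intro g hg
    have e : g • Sum.elim a b = Sum.elim a b := hg
    have h1 := hf.smul_eq g (s := Sum.elim a b) rfl (by rw [e]; rfl)
    rw [mem_stabilizer_iff, hc, ← h1]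
    congr 1
    exact Subtype.ext e
  rcases hcat.rk_add_or hrank a b hab with h | h
  · exact hcat.false_of_tame hrank hNIP a b h X c hle hca hcb hD hX
  -- If `a` is algebraic over `b`, then so is `c`, which is fixed by the stabilizer of `(a, b)`.
  · rw [← Subgroup.inf_relIndex_right] at h
    exact h (Subgroup.relIndex_eq_zero_of_le_left hle hcb)

variable {X : Interpretable L M (∅ : Set M)}

/-- An equivalence relation invariant under an open subgroup is definable with parameters, so the
hypothesis on definable convex relations applies to it. -/
theorem Interpretable.tameOrder (hcat : OmegaCategorical L M) [LinearOrder X.Carrier]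
    [Infinite X.Carrier] {D : Subgroup (elemAut L M)} (hD : FixOpen (elemAut L M) M D)
    [OrderAction D X.Carrier] (hrk : ∀ r : Setoid X.Carrier,
      X.DefinableRel Set.univ (α := Fin 0) (l := 2) (fun _ x => r (x 0) (x 1)) →
      (∀ C ∈ r.classes, C.OrdConnected) → {C ∈ r.classes | C.Infinite}.Finite) :
    TameOrder (RestrictOpen (FixOpen (elemAut L M) M) D) X.Carrier where
  opens := hcat.openSubgroups.restrict hD
  smooth := (X.smoothAction hcat).restrict hcat.openSubgroups hD
  infinite := inferInstance
  topRank := by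
    rintro H ⟨B, hB, hBH⟩ r hr hC
    refine hrk r (DefinableRel.mono (definableRel hcat hB ?_) (subset_univ _)) hC
    intro g hg _ x hx
    obtain ⟨h, hh, rfl⟩ := hBH hg
    exact hr h hh _ _ hx

theorem infinite_of_no_last {V : Type*} [LinearOrder V] {I : Set V} {x : V} (hx : x ∈ I)
    (hI : ∀ x ∈ I, ∃ y ∈ I, x < y) : {y | y ∈ I ∧ x ≤ y}.Infinite := by
  have h1 : Nonempty {y | y ∈ I ∧ x ≤ y} := ⟨⟨x, hx, le_rfl⟩⟩
  have h2 : NoMaxOrder {y | y ∈ I ∧ x ≤ y} := ⟨fun ⟨y, hy, hxy⟩ => by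
    obtain ⟨z, hz, hyz⟩ := hI y hy
    exact ⟨⟨z, hz, hxy.trans hyz.le⟩, hyz⟩⟩
  exact Set.infinite_coe_iff.1 NoMaxOrder.infinite

variable [LinearOrder X.Carrier]

theorem DefinableLinearOrder.orderAction (h : DefinableLinearOrder X ∅) :
    OrderAction (elemAut L M) X.Carrier := by
  have h' : X.DefinableRel ∅ (α := Fin 0) (l := 2) fun _ x => x 0 ≤ x 1 := h
  have key : ∀ (g : elemAut L M) {x y : X.Carrier}, g • x ≤ g • y ↔ x ≤ y := fun g x y => by
    have := Interpretable.DefinableRel.smul_iff finite_empty h' (mem_fixingSubgroup_empty g)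
      (y := Fin.elim0) (x := ![x, y])
    exact this
  refine ⟨fun g x y hxy => ?_⟩
  rw [← not_le, key, not_le]
  exact hxy

theorem linearCuts_invariant (hcat : OmegaCategorical L M) [OrderAction (elemAut L M) X.Carrier] :
    InvariantCuts (linearCuts X) where
  isRep_smul g I hI := by
    obtain ⟨h1, h2, h3, h4, h5⟩ := hI
    refine ⟨h1.smul hcat g, ?_, h3.smul_set, ?_, ?_⟩
    · intro x y hyx hx
      rw [Set.mem_smul_set_iff_inv_smul_mem] at hx ⊢
      exact h2 (OrderAction.smul_le _ hyx) hx
    · intro h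
      exact h4 (by rw [← inv_smul_smul g I, h, Set.smul_set_univ])
    · rintro _ ⟨x, hx, rfl⟩
      obtain ⟨y, hy, hxy⟩ := h5 x hx
      exact ⟨g • y, ⟨y, hy, rfl⟩, OrderAction.smul_lt g hxy⟩
  same_smul g I J hI hJ h := by
    have h' : (⟨I, hI⟩ : {I // (linearCuts X).IsRep I}) = ⟨J, hJ⟩ := h
    cases h'
    exact Setoid.refl' _ _

/-- Linear cuts as regular cuts. -/
noncomputable def linearCutsToRegCut {G : Type*} [Group G] {Op : Subgroup G → Prop}
    [MulAction G X.Carrier] [OrderAction G X.Carrier] (hV : TameOrder Op X.Carrier) :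
    (linearCuts X).Completion → RegCut X.Carrier :=
  Quotient.lift (fun I => ⟨I.1, I.2.2.1, fun x hx => by
    obtain ⟨y, hy, hxy⟩ := hV.exists_far_of_infinite (infinite_of_no_last hx I.2.2.2.2.2)
      fun y hy => hy.2
    exact ⟨y, hy.1, hxy⟩⟩) fun I J h => by
      have h' : I = J := h
      subst h'
      rfl

theorem OmegaCategorical.algebraic_linear (hcat : OmegaCategorical L M) (hrank : FiniteRank L M)
    (hNIP : NIPStructure L M) {m n : ℕ} (a : Fin m → M) (b : Fin n → M)
    (hab : RankIndependent L a b ∅ ∨ tupleRank L a ∅ = 1) (hX : DefinableLinearOrder X ∅)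
    (hX1 : LinearTopRankOne X) (f : typeLocus L (Sum.elim a b) → (linearCuts X).Completion)
    (hf : (linearCuts X).DefinableMap ∅ f) :
    (linearCuts X).Algebraic (Set.range a) (f ⟨Sum.elim a b, rfl⟩) ∨
      (linearCuts X).Algebraic (Set.range b) (f ⟨Sum.elim a b, rfl⟩) := by
  have hoa := hX.orderAction
  have hinv := linearCuts_invariant (X := X) hcat
  -- The order is infinite because it has a cut: a nonempty set without last element.
  obtain ⟨I, hI, -⟩ := CutNotion.exists_represents (f ⟨Sum.elim a b, rfl⟩)
  obtain ⟨-, -, ⟨x, hx⟩, -, hI⟩ := hI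
  have hinf : Infinite X.Carrier :=
    Set.infinite_univ_iff.1 ((infinite_of_no_last hx hI).mono (subset_univ _))
  refine hcat.algebraic_of_tame hrank hNIP a b hab hf hcat.openSubgroups.top fun δ => ?_
  have hoa' : OrderAction (cj δ (⊤ : Subgroup (elemAut L M))) X.Carrier :=
    ⟨fun g x y h => OrderAction.smul_lt (g : elemAut L M) h⟩
  have hV := X.tameOrder hcat (hcat.openSubgroups.conj δ hcat.openSubgroups.top) hX1
  refine ⟨inferInstance, hoa', hV, linearCutsToRegCut hV, ?_, ?_⟩
  · intro c c' h
    obtain ⟨I, rfl⟩ := Quotient.exists_rep c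
    obtain ⟨J, rfl⟩ := Quotient.exists_rep c'
    exact congrArg (Quotient.mk _) (Subtype.ext (congrArg RegCut.carrier h))
  · intro g c
    obtain ⟨I, rfl⟩ := Quotient.exists_rep c
    refine RegCut.ext' (Set.ext fun x => ?_)
    exact Set.mem_smul_set_iff_inv_smul_mem

end LinearCase

/-! ### Cutting a circular order open at a point -/

section CutOpen

/-- The strict order obtained by cutting a circular order at `v`. -/
def CutLT {V : Type*} [CircularOrder V] (v x y : V) : Prop :=
  (x = v ∧ y ≠ v) ∨ sbtw v x y

namespace CutLT

variable {V : Type*} [CircularOrder V] {v x y z : V}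

theorem ne_base (h : CutLT v x y) : y ≠ v := by
  rcases h with h | h
  · exact h.2
  · rintro rfl
    exact sbtw_irrefl_left_right h

theorem irrefl (x : V) : ¬ CutLT v x x := by
  rintro (h | h)
  · exact h.2 h.1
  · exact sbtw_irrefl_right h

theorem trans (h1 : CutLT v x y) (h2 : CutLT v y z) : CutLT v x z := by
  rcases h1 with h1 | h1
  · exact Or.inl ⟨h1.1, h2.ne_base⟩
  · rcases h2 with h2 | h2
    · rw [h2.1] at h1
      exact absurd h1 sbtw_irrefl_left_right
    · exact Or.inr (sbtw_trans_right h1 h2)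

theorem trichotomy (v x y : V) : CutLT v x y ∨ x = y ∨ CutLT v y x := by
  by_cases hx : x = v
  · by_cases hy : y = v
    · exact Or.inr (Or.inl (hx.trans hy.symm))
    · exact Or.inl (Or.inl ⟨hx, hy⟩)
  by_cases hy : y = v
  · exact Or.inr (Or.inr (Or.inl ⟨hy, hx⟩))
  by_cases hxy : x = y
  · exact Or.inr (Or.inl hxy)
  rcases circ_tri hxy hy (Ne.symm hx) with h | h
  · exact Or.inl (Or.inr h.cyclic_right)
  · exact Or.inr (Or.inr (Or.inr h.cyclic_right))

theorem sbtw (h1 : CutLT v x y) (h2 : CutLT v y z) : sbtw x y z := by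
  have hy := h1.ne_base
  have h3 := h2.resolve_left fun h => hy h.1
  rcases h1 with h1 | h1
  · rwa [h1.1]
  · exact (sbtw_trans_right h3.cyclic_left h1.cyclic_right).cyclic_right

theorem sbtw_iff : SBtw.sbtw x y z ↔ (CutLT v x y ∧ CutLT v y z) ∨ (CutLT v y z ∧ CutLT v z x) ∨
    (CutLT v z x ∧ CutLT v x y) := by
  constructor
  · intro h
    rcases trichotomy v x y with h1 | rfl | h1
    · rcases trichotomy v y z with h2 | rfl | h2
      · exact Or.inl ⟨h1, h2⟩
      · exact absurd h sbtw_irrefl_right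
      · rcases trichotomy v z x with h3 | rfl | h3
        · exact Or.inr (Or.inr ⟨h3, h1⟩)
        · exact absurd h sbtw_irrefl_left_right
        · exact absurd (h3.sbtw h2).cyclic_left h.not_sbtw
    · exact absurd h sbtw_irrefl_left
    · rcases trichotomy v y z with h2 | rfl | h2
      · rcases trichotomy v z x with h3 | rfl | h3
        · exact Or.inr (Or.inl ⟨h2, h3⟩)
        · exact absurd h sbtw_irrefl_left_right
        · exact absurd (h1.sbtw h3).cyclic_right h.not_sbtw
      · exact absurd h sbtw_irrefl_right
      · exact absurd (h2.sbtw h1) h.not_sbtw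
  · rintro (h | h | h)
    · exact h.1.sbtw h.2
    · exact (h.1.sbtw h.2).cyclic_right
    · exact (h.1.sbtw h.2).cyclic_left

end CutLT

open Classical in
/-- The linear order obtained by cutting a circular order at `v`. -/
noncomputable abbrev cutOrder {V : Type*} [CircularOrder V] (v : V) : LinearOrder V :=
  have : IsStrictTotalOrder V (CutLT v) :=
    { irrefl := CutLT.irrefl
      trans := fun _ _ _ => CutLT.trans
      trichotomous := fun x y h1 h2 => ((CutLT.trichotomy v x y).resolve_left h1).resolve_right h2 }
  linearOrderOfSTO (CutLT v)

end CutOpen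

/-! ### Tails of bounded convex sets -/

section Tails

variable {V : Type*} [CircularOrder V] {I J : Set V}

/-- A point `w` outside `I` orients it: an arc contained in `I` cannot pass through `w`, so the
induced order is that of the circle cut at `w`. -/
theorem CircLT.trans (hI : CircConvex I) (hb : Iᶜ.Nonempty) {x y z : V} (hx : x ∈ I) (hy : y ∈ I)
    (hz : z ∈ I) (h1 : CircLT I x y) (h2 : CircLT I y z) : CircLT I x z := by
  obtain ⟨w, hw⟩ := hb
  have hwx : w ≠ x := fun e => hw (e ▸ hx)
  have hwy : w ≠ y := fun e => hw (e ▸ hy)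
  have hwz : w ≠ z := fun e => hw (e ▸ hz)
  have hxz : x ≠ z := by
    rintro rfl
    rcases circ_tri h1.1 hwy.symm hwx with h | h
    · exact hw (h2.2 h.cyclic_left)
    · exact hw (h1.2 h.cyclic_left)
  rcases circ_tri h1.1 h2.1 hxz.symm with h | h
  · refine (hI.total hx hz hxz).resolve_right fun h3 => ?_
    rcases circ_tri h1.1 hwy.symm hwx with k | k
    · rcases circ_tri h2.1 hwz.symm hwy with k' | k'
      · rcases circ_tri hxz.symm hwx.symm hwz with k'' | k''
        · have h4 := sbtw_trans_right k.cyclic_right k'.cyclic_right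
          exact sbtw_asymm k''.cyclic_right h4.cyclic_left
        · exact hw (h3.2 k''.cyclic_left)
      · exact hw (h2.2 k'.cyclic_left)
    · exact hw (h1.2 k.cyclic_left)
  · refine ⟨hxz, (cIoo_left_subset (mem_cIoo.2 ?_)).trans h1.2⟩
    exact h.cyclic_left

theorem CircEndSegment.circLT_iff (h : CircEndSegment I J) {x y : V} (hx : x ∈ I) :
    CircLT I x y ↔ CircLT J x y := by
  refine ⟨fun k => ⟨k.1, k.2.trans h.1⟩, fun k => ⟨k.1, fun z hz => ?_⟩⟩
  refine h.2 x hx z (k.2 hz) ⟨?_, (cIoo_left_subset hz).trans k.2⟩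
  rintro rfl
  exact sbtw_irrefl_left hz

/-- The points of `I` from `j` on. -/
def circAfter (I : Set V) (j : V) : Set V := {y | y ∈ I ∧ (y = j ∨ CircLT I j y)}

theorem circAfter_endSegment (hI : CircConvex I) (hb : Iᶜ.Nonempty) {j : V} (hj : j ∈ I) :
    CircEndSegment (circAfter I j) I := by
  refine ⟨fun y hy => hy.1, fun x hx y hy hxy => ⟨hy, Or.inr ?_⟩⟩
  rcases hx.2 with rfl | h
  · exact hxy
  · exact h.trans hI hb hj hx.1 hy hxy

variable [LinearOrder V]

/-- The points that are below all points of a tail of `I`. -/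
def tailCut (I : Set V) : Set V := {x | ∃ j ∈ I, ∀ y ∈ I, CircLT I j y → x < y}

/-- Only the part of a set beyond some point matters for `tailCut`, and an end segment has the same
tails. -/
theorem CircEndSegment.tailCut_eq (h : CircEndSegment I J) (hI : I.Nonempty) (hJ : CircConvex J)
    (hb : Jᶜ.Nonempty) : tailCut I = tailCut J := by
  ext x
  constructor
  · rintro ⟨j, hj, hx⟩
    refine ⟨j, h.1 hj, fun y hy hjy => ?_⟩
    exact hx y (h.2 j hj y hy hjy) ((h.circLT_iff hj).2 hjy)
  · rintro ⟨j, hj, hx⟩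
    obtain ⟨i, hi⟩ := hI
    by_cases hjI : j ∈ I
    · exact ⟨j, hjI, fun y hy hjy => hx y (h.1 hy) ((h.circLT_iff hjI).1 hjy)⟩
    · have hji : CircLT J j i := by
        refine (hJ.total hj (h.1 hi) fun e => hjI (e ▸ hi)).resolve_right fun k => hjI ?_
        exact h.2 i hi j hj k
      exact ⟨i, hi, fun y hy hiy => hx y (h.1 hy)
        (hji.trans hJ hb hj (h.1 hi) (h.1 hy) ((h.circLT_iff hi).1 hiy))⟩

theorem CircSameCut.tailCut_eq (h : CircSameCut I J) (hI : CircPreCut I) (hJ : CircPreCut J) :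
    tailCut I = tailCut J := by
  rcases h with h | h
  · exact h.tailCut_eq hI.2.2.1 hJ.1 hJ.2.1.nonempty
  · exact (h.tailCut_eq hJ.2.2.1 hI.1 hI.2.1.nonempty).symm

/-- The linear order is obtained by cutting the circular order. -/
structure IsCutOrder (V : Type*) [CircularOrder V] [LinearOrder V] (v : V) : Prop where
  bot : ∀ x : V, v ≤ x
  sbtw_iff : ∀ x y z : V, sbtw x y z ↔ (x < y ∧ y < z) ∨ (y < z ∧ z < x) ∨ (z < x ∧ x < y)

namespace IsCutOrder

variable {v : V}

theorem convex (hv : IsCutOrder V v) (hI : I.OrdConnected) : CircConvex I := by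
  have key : ∀ x ∈ I, ∀ y ∈ I, x < y → cIoo x y ⊆ I := by
    intro x hx y hy hxy z hz
    rcases (hv.sbtw_iff _ _ _).1 hz with h | h | h
    · exact hI.out hx hy ⟨h.1.le, h.2.le⟩
    · exact absurd h.2 hxy.not_gt
    · exact absurd h.1 hxy.not_gt
  intro x hx y hy hxy
  rcases lt_or_gt_of_ne hxy with h | h
  · exact Or.inl (key x hx y hy h)
  · exact Or.inr (key y hy x hx h)

/-- On a tail, the two orders agree. -/
theorem exists_tail (hv : IsCutOrder V v) (hI : CircPreCut I) :
    ∃ j ∈ I, ∀ y ∈ circAfter I j, ∀ z ∈ I, CircLT I y z → y < z := by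
  -- The two orders can disagree only where `I` passes through the base point `v`. If `v ∈ I`, the
  -- tail is started at `v`; otherwise it may start anywhere.
  by_cases hvI : v ∈ I
  · refine ⟨v, hvI, fun y hy z hz hyz => ?_⟩
    by_contra hlt
    have hzy : z < y := lt_of_le_of_ne (not_lt.1 hlt) hyz.1.symm
    obtain ⟨w, hw⟩ := hI.2.1.nonempty
    have hvw : v < w := lt_of_le_of_ne (hv.bot w) fun e => hw (e ▸ hvI)
    rcases lt_trichotomy w y with h | rfl | h
    · rcases hy.2 with rfl | h'
      · exact absurd hvw h.not_gt
      · exact hw (h'.2 ((hv.sbtw_iff _ _ _).2 (Or.inl ⟨hvw, h⟩)))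
    · exact hw hy.1
    · exact hw (hyz.2 ((hv.sbtw_iff _ _ _).2 (Or.inr (Or.inr ⟨hzy, h⟩))))
  · obtain ⟨j, hj⟩ := hI.2.2.1
    refine ⟨j, hj, fun y hy z hz hyz => ?_⟩
    by_contra hlt
    have hzy : z < y := lt_of_le_of_ne (not_lt.1 hlt) hyz.1.symm
    have hvz : v < z := lt_of_le_of_ne (hv.bot z) fun e => hvI (e ▸ hz)
    exact hvI (hyz.2 ((hv.sbtw_iff _ _ _).2 (Or.inr (Or.inl ⟨hvz, hzy⟩))))

/-- A tail on which the orders agree generates `tailCut I` downwards, and conversely is the part of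
`tailCut I` from `j` on. So the linear cut retains enough of `I` to recover the circular cut. -/
theorem exists_tail' (hv : IsCutOrder V v) (hI : CircPreCut I) : ∃ j ∈ I,
    CircEndSegment (circAfter I j) I ∧ (∀ x ∈ circAfter I j, ∃ y ∈ circAfter I j, x < y) ∧
    (∀ x, x ∈ tailCut I ↔ ∃ t ∈ circAfter I j, x < t) ∧
    (∀ x, x ∈ circAfter I j ↔ j ≤ x ∧ x ∈ tailCut I) ∧
    ∀ y ∈ circAfter I j, ∀ z ∈ I, CircLT I y z → y < z := by
  obtain ⟨j, hj, h1⟩ := hv.exists_tail hI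
  have hend := circAfter_endSegment hI.1 hI.2.1.nonempty hj
  have hjj : j ∈ circAfter I j := ⟨hj, Or.inl rfl⟩
  have hnl : ∀ x ∈ circAfter I j, ∃ y ∈ circAfter I j, x < y := fun x hx => by
    obtain ⟨y, hy, hxy⟩ := hI.2.2.2 x hx.1
    exact ⟨y, hend.2 x hx y hy hxy, h1 x hx y hy hxy⟩
  have hcut : ∀ x, x ∈ tailCut I ↔ ∃ t ∈ circAfter I j, x < t := by
    intro x
    constructor
    · rintro ⟨i, hi, hx⟩
      by_cases hij : i ∈ circAfter I j
      · obtain ⟨y, hy, hiy⟩ := hI.2.2.2 i hi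
        exact ⟨y, hend.2 i hij y hy hiy, hx y hy hiy⟩
      · refine ⟨j, hjj, hx j hj ?_⟩
        refine (hI.1.total hi hj fun e => hij (e ▸ hjj)).resolve_right fun k => hij ?_
        exact ⟨hi, Or.inr k⟩
    · rintro ⟨t, ht, hxt⟩
      exact ⟨t, ht.1, fun y hy hty => hxt.trans (h1 t ht y hy hty)⟩
  refine ⟨j, hj, hend, hnl, hcut, fun x => ⟨fun hx => ⟨?_, (hcut x).2 (hnl x hx)⟩, ?_⟩, h1⟩
  · rcases hx.2 with rfl | h
    · exact le_rfl
    · exact (h1 j hjj x hx.1 h).le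
  · rintro ⟨hjx, hx⟩
    obtain ⟨t, ht, hxt⟩ := (hcut x).1 hx
    rcases hjx.eq_or_lt with rfl | hjx
    · exact hjj
    · have hjt : CircLT I j t := ht.2.resolve_left fun e => (hjx.trans hxt).ne e.symm
      have hxI : x ∈ cIoo j t := (hv.sbtw_iff _ _ _).2 (Or.inl ⟨hjx, hxt⟩)
      exact ⟨hjt.2 hxI, Or.inr ⟨hjx.ne, (cIoo_left_subset hxI).trans hjt.2⟩⟩

/-- Of the two tails, the one with the later starting point is an end segment of both sets. -/
theorem sameCut (hv : IsCutOrder V v) (hI : CircPreCut I) (hJ : CircPreCut J)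
    (h : tailCut I = tailCut J) : CircSameCut I J := by
  have key : ∀ {I J : Set V}, CircPreCut I → CircPreCut J → tailCut I = tailCut J →
      ∀ {i j : V}, i ≤ j → i ∈ I → j ∈ J →
      CircEndSegment (circAfter I i) I → CircEndSegment (circAfter J j) J →
      (∀ x, x ∈ circAfter I i ↔ i ≤ x ∧ x ∈ tailCut I) →
      (∀ x, x ∈ circAfter J j ↔ j ≤ x ∧ x ∈ tailCut J) →
      (∀ y ∈ circAfter I i, ∀ z ∈ I, CircLT I y z → y < z) → CircSameCut I J := by
    intro I J hI hJ h i j hij hi hj hIe hJe hIm hJm hlt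
    have hsub : circAfter J j ⊆ circAfter I i := by
      intro x hx
      rw [hIm, h]
      exact ⟨hij.trans ((hJm x).1 hx).1, ((hJm x).1 hx).2⟩
    refine same_of_common (J := circAfter J j) hI.1 hJ.1 hI.2.1.nonempty hJ.2.1.nonempty
      ⟨j, hj, Or.inl rfl⟩
      ⟨hsub.trans hIe.1, fun x hx y hy hxy => ?_⟩ hJe
    have h2 := hIe.2 x (hsub hx) y hy hxy
    rw [hJm, ← h]
    exact ⟨((hJm x).1 hx).1.trans (hlt x (hsub hx) y hy hxy).le, ((hIm y).1 h2).2⟩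
  obtain ⟨i, hi, hIe, -, -, hIm, hIl⟩ := hv.exists_tail' hI
  obtain ⟨j, hj, hJe, -, -, hJm, hJl⟩ := hv.exists_tail' hJ
  rcases le_total i j with hij | hij
  · exact key hI hJ h hij hi hj hIe hJe hIm hJm hIl
  · exact (key hJ hI h.symm hij hj hi hJe hIe hJm hIm hJl).symm

/-- The regular cut of a tail. -/
def regCut (hv : IsCutOrder V v) {G : Type*} [Group G] {Op : Subgroup G → Prop}
    [MulAction G V] [OrderAction G V] (hV : TameOrder Op V) (hI : CircPreCut I) : RegCut V where
  carrier := tailCut I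
  lower := by
    rintro x y hyx ⟨j, hj, hx⟩
    exact ⟨j, hj, fun z hz hjz => hyx.trans_lt (hx z hz hjz)⟩
  regular := by
    intro x hx
    obtain ⟨j, hj, hIe, hnl, hcut, hm, -⟩ := hv.exists_tail' hI
    obtain ⟨t, ht, hxt⟩ := (hcut x).1 hx
    obtain ⟨y, hy, hty⟩ := hV.exists_far_of_infinite (infinite_of_no_last ht hnl) fun y hy => hy.2
    exact ⟨y, ((hm y).1 hy.1).2, hty.mono hxt.le le_rfl⟩

end IsCutOrder

end Tails

/-! ### Automorphisms of circular orders -/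

section CircularAction

open MulAction OpenSubgroups Pointwise

/-- The group `G` acts by automorphisms of the circular order `V`. -/
class CircAction (G V : Type*) [Group G] [CircularOrder V] [MulAction G V] : Prop where
  sbtw_smul : ∀ (g : G) {x y z : V}, sbtw x y z → sbtw (g • x) (g • y) (g • z)

variable {G V : Type*} [Group G] [CircularOrder V] [MulAction G V] [CircAction G V] {I J : Set V}

theorem smul_cIoo (g : G) (x y : V) : g • cIoo x y = cIoo (g • x) (g • y) := by
  ext z
  rw [Set.mem_smul_set_iff_inv_smul_mem]
  constructor
  · intro h
    have := CircAction.sbtw_smul g (mem_cIoo.1 h)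
    rwa [smul_inv_smul] at this
  · intro h
    have := CircAction.sbtw_smul g⁻¹ (mem_cIoo.1 h)
    rwa [inv_smul_smul, inv_smul_smul] at this

theorem CircLT.smul (g : G) {x y : V} (h : CircLT I x y) : CircLT (g • I) (g • x) (g • y) :=
  ⟨fun e => h.1 (MulAction.injective g e), by
    rw [← smul_cIoo]
    exact Set.smul_set_mono h.2⟩

theorem CircLT.of_smul {g : G} {x y : V} (h : CircLT (g • I) (g • x) (g • y)) : CircLT I x y := by
  have := h.smul g⁻¹
  rwa [inv_smul_smul, inv_smul_smul, inv_smul_smul] at this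

theorem CircEndSegment.smul (g : G) (h : CircEndSegment J I) : CircEndSegment (g • J) (g • I) := by
  refine ⟨Set.smul_set_mono h.1, ?_⟩
  rintro _ ⟨x, hx, rfl⟩ _ ⟨y, hy, rfl⟩ hxy
  exact ⟨y, h.2 x hx y hy hxy.of_smul, rfl⟩

theorem CircPreCut.smul (g : G) (h : CircPreCut I) : CircPreCut (g • I) := by
  obtain ⟨h1, h2, h3, h4⟩ := h
  refine ⟨?_, ?_, h3.smul_set, ?_⟩
  · rintro _ ⟨x, hx, rfl⟩ _ ⟨y, hy, rfl⟩ hxy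
    change cIoo (g • x) (g • y) ⊆ _ ∨ cIoo (g • y) (g • x) ⊆ _
    rw [← smul_cIoo, ← smul_cIoo]
    exact (h1 x hx y hy fun e => hxy (congrArg (g • ·) e)).imp Set.smul_set_mono Set.smul_set_mono
  · rw [← Set.smul_set_compl]
    exact h2.image (MulAction.injective g).injOn
  · rintro _ ⟨x, hx, rfl⟩
    obtain ⟨y, hy, hxy⟩ := h4 x hx
    exact ⟨g • y, ⟨y, hy, rfl⟩, hxy.smul g⟩

theorem CircSameCut.smul (g : G) (h : CircSameCut I J) : CircSameCut (g • I) (g • J) :=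
  h.imp (fun h => h.smul g) fun h => h.smul g

theorem smul_tailCut [LinearOrder V] (g : G) (hg : ∀ {x y : V}, x < y ↔ g • x < g • y) (I : Set V) :
    tailCut (g • I) = g • tailCut I := by
  ext x
  rw [Set.mem_smul_set_iff_inv_smul_mem]
  constructor
  · rintro ⟨_, ⟨j, hj, rfl⟩, hx⟩
    refine ⟨j, hj, fun y hy hjy => ?_⟩
    rw [hg, smul_inv_smul]
    exact hx _ ⟨y, hy, rfl⟩ (hjy.smul g)
  · rintro ⟨j, hj, hx⟩
    refine ⟨g • j, ⟨j, hj, rfl⟩, ?_⟩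
    rintro _ ⟨y, hy, rfl⟩ hjy
    have := hg.1 (hx y hy hjy.of_smul)
    rwa [smul_inv_smul] at this

theorem isCutOrder_cutOrder {V : Type*} [CircularOrder V] (v : V) :
    @IsCutOrder V _ (cutOrder v) v := by
  let _ := cutOrder v
  refine ⟨fun x => ?_, fun x y z => CutLT.sbtw_iff (v := v)⟩
  rw [← not_lt]
  exact fun h => CutLT.ne_base h rfl

theorem orderAction_cutOrder {D : Subgroup G} {v : V} (hD : ∀ g ∈ D, g • v = v) :
    @OrderAction D V _ (cutOrder v) _ := by
  let _ := cutOrder v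
  refine ⟨fun g x y h => ?_⟩
  have h' : CutLT v x y := h
  change CutLT v ((g : G) • x) ((g : G) • y)
  have hv := hD g g.2
  rcases h' with h' | h'
  · left
    rw [h'.1, hv]
    refine ⟨rfl, fun e => h'.2 ?_⟩
    rw [← hv] at e
    exact MulAction.injective (g : G) e
  · right
    have := CircAction.sbtw_smul (g : G) h'
    rwa [hv] at this

end CircularAction

/-! ### Circular orders -/

section CircularCase

open MulAction OpenSubgroups Pointwise

variable {L : FirstOrder.Language.{u, v}} {M : Type w} [L.Structure M]
  {X : Interpretable L M (∅ : Set M)} [CircularOrder X.Carrier]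

theorem DefinableCircularOrder.circAction (h : DefinableCircularOrder X ∅) :
    CircAction (elemAut L M) X.Carrier := by
  have h' : X.DefinableRel ∅ (α := Fin 0) (l := 3) fun _ x => btw (x 0) (x 1) (x 2) := h
  have key : ∀ (g : elemAut L M) {x y z : X.Carrier}, btw (g • x) (g • y) (g • z) ↔ btw x y z :=
    fun g x y z => by
      have := Interpretable.DefinableRel.smul_iff finite_empty h' (mem_fixingSubgroup_empty g)
        (y := Fin.elim0) (x := ![x, y, z])
      exact this
  refine ⟨fun g x y z hxy => ?_⟩
  rw [sbtw_iff_not_btw] at hxy ⊢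
  rwa [key]

theorem circularCuts_invariant (hcat : OmegaCategorical L M) [CircAction (elemAut L M) X.Carrier] :
    InvariantCuts (circularCuts X) where
  isRep_smul g I hI := ⟨hI.1.smul hcat g, hI.2.smul g⟩
  same_smul g I J hI hJ h := by
    have h' : CircSameCut I J := h
    exact h'.smul g

/-- Circular cuts as regular cuts. -/
noncomputable def circularCutsToRegCut [LinearOrder X.Carrier] {v : X.Carrier}
    (hv : IsCutOrder X.Carrier v) {G : Type*} [Group G] {Op : Subgroup G → Prop}
    [MulAction G X.Carrier] [OrderAction G X.Carrier] (hV : TameOrder Op X.Carrier) :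
    (circularCuts X).Completion → RegCut X.Carrier :=
  Quotient.lift (fun I => hv.regCut hV I.2.2) fun I J h => by
    have h' : CircSameCut I.1 J.1 := h
    exact RegCut.ext' (h'.tailCut_eq I.2.2 J.2.2)

/-- Naming a point `v` turns the circular order into a linear one, preserved by the stabilizer of
`v`. Convex sets of the linear order are convex in the circular one, so topological rank 1 is
inherited, and circular cuts become regular cuts through their tails. Since `D` is the stabilizer of
`v`, its conjugates correspond to cutting at the translates of `v`. -/
theorem OmegaCategorical.algebraic_circular (hcat : OmegaCategorical L M) (hrank : FiniteRank L M)
    (hNIP : NIPStructure L M) {m n : ℕ} (a : Fin m → M) (b : Fin n → M)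
    (hab : RankIndependent L a b ∅ ∨ tupleRank L a ∅ = 1) (hX : DefinableCircularOrder X ∅)
    (hX1 : CircularTopRankOne X) (f : typeLocus L (Sum.elim a b) → (circularCuts X).Completion)
    (hf : (circularCuts X).DefinableMap ∅ f) :
    (circularCuts X).Algebraic (Set.range a) (f ⟨Sum.elim a b, rfl⟩) ∨
      (circularCuts X).Algebraic (Set.range b) (f ⟨Sum.elim a b, rfl⟩) := by
  have hca := hX.circAction
  have hinv := circularCuts_invariant (X := X) hcat
  obtain ⟨I, hI, -⟩ := CutNotion.exists_represents (f ⟨Sum.elim a b, rfl⟩)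
  obtain ⟨-, -, hIc, ⟨v, hvI⟩, -⟩ := hI
  have hinf : Infinite X.Carrier := Set.infinite_univ_iff.1 (hIc.mono (subset_univ _))
  have hDv := (X.smoothAction hcat).stab v
  refine hcat.algebraic_of_tame hrank hNIP a b hab hf hDv fun δ => ?_
  have hD : ∀ g ∈ cj δ (stabilizer (elemAut L M) v), g • δ • v = δ • v := by
    intro g hg
    rwa [← cj_stabilizer] at hg
  let _ := cutOrder (δ • v)
  have hv : IsCutOrder X.Carrier (δ • v) := isCutOrder_cutOrder _
  have hoa : OrderAction (cj δ (stabilizer (elemAut L M) v)) X.Carrier := orderAction_cutOrder hD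
  have hV := X.tameOrder hcat (hcat.openSubgroups.conj δ hDv) fun r hr hC =>
    hX1 r hr fun C hCr => hv.convex (hC C hCr)
  refine ⟨inferInstance, hoa, hV, circularCutsToRegCut hv hV, ?_, ?_⟩
  · intro c c' h
    obtain ⟨I, rfl⟩ := Quotient.exists_rep c
    obtain ⟨J, rfl⟩ := Quotient.exists_rep c'
    exact Quotient.sound (hv.sameCut I.2.2 J.2.2 (congrArg RegCut.carrier h))
  · intro g c
    obtain ⟨I, rfl⟩ := Quotient.exists_rep c
    refine RegCut.ext' ((smul_tailCut (g : elemAut L M) (fun {x y} => ?_) I.1).trans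
      (Set.ext fun x => Set.mem_smul_set_iff_inv_smul_mem))
    exact (OrderAction.smul_lt_iff g).symm

end CircularCase

theorem mainTheorem10 {L : FirstOrder.Language.{u, v}} {M : Type w} [L.Structure M]
    (hcat : OmegaCategorical L M) (hrank : FiniteRank L M) (hNIP : NIPStructure L M)
    {m n : ℕ} (a : Fin m → M) (b : Fin n → M)
    (hab : RankIndependent L a b ∅ ∨ tupleRank L a ∅ = 1)
    (X : Interpretable L M (∅ : Set M)) :
    (∀ [LinearOrder X.Carrier], DefinableLinearOrder X ∅ → LinearTopRankOne X →
      ∀ f : typeLocus L (Sum.elim a b) → (linearCuts X).Completion,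
        (linearCuts X).DefinableMap ∅ f →
        (linearCuts X).Algebraic (Set.range a) (f ⟨Sum.elim a b, rfl⟩) ∨
        (linearCuts X).Algebraic (Set.range b) (f ⟨Sum.elim a b, rfl⟩)) ∧
    (∀ [CircularOrder X.Carrier], DefinableCircularOrder X ∅ → CircularTopRankOne X →
      ∀ f : typeLocus L (Sum.elim a b) → (circularCuts X).Completion,
        (circularCuts X).DefinableMap ∅ f →
        (circularCuts X).Algebraic (Set.range a) (f ⟨Sum.elim a b, rfl⟩) ∨
        (circularCuts X).Algebraic (Set.range b) (f ⟨Sum.elim a b, rfl⟩)) := by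
  exact ⟨fun h1 h2 f hf => hcat.algebraic_linear hrank hNIP a b hab h1 h2 f hf,
    fun h1 h2 f hf => hcat.algebraic_circular hrank hNIP a b hab h1 h2 f hf⟩
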